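/- Let $k\ge 1$ and let $(r_n)$ be independent random variables, uniformly distributed on $[0,1]$. Let $\mathbb{P}'=\{n\ge 3:\ r_n\le 1/\log n\}$ (Cramér's random model), let $p'_1<p'_2<\cdots$ be its elements in increasing order (almost surely $\mathbb{P}'$ is infinite), let $z_{n,k}$ be the indicator of the event that $r_n\le 1/\log n$ and $(n,k)=1$, and let $\mu_n(t)=\mathbf{E}[z_{n,k}\cos(t\log n)]$. Put $$B'_N(t)=\sum_{\substack{1\le n\le N\\ (p'_n,k)=1}}\cos(t\log p'_n),\qquad m_N(t)=\sum_{3\le n\le p'_N}\mu_n(t),\qquad s^2=\frac{\varphi(k)}{2k},$$ $$M_N(t)=\frac{\varphi(k)}{k}\,\mathrm{Re}\,\mathrm{Ei}\big((1+it)\log(N\log N)\big),\qquad \mathrm{Ei}(z)=\gamma+\log z+\sum_{n\ge1}\frac{z^n}{n\cdot n!}.$$ (a) As $N\to\infty$ and $t\to\infty$ jointly, in the range $t\le N^A$ with an arbitrary fixed exponent $A\in\mathbb{N}$ (in particular when $N\to\infty$ first and then $t\to\infty$), $$\sqrt{\frac{1+\frac{\log\log N}{\log N}}{s^2N}}\;\big(B'_N(t)-m_N(t)\big)\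 \overset{d}{\longrightarrow}\ \mathcal N(0,1).$$ (b) For every fixed real $t$, almost surely $m_N(t)=M_N(t)+o(N)$ as $N\to\infty$. (c) The same holds with $p'_N$ replaced by its asymptotic value $N\log N$: if $\widetilde B_N(t)=\sum_{3\le n\le N\log N}z_{n,k}\cos(t\log n)$ and $\widetilde m_N(t)=\mathbf{E}[\widetilde B_N(t)]$, then $$\sqrt{\frac{1+\frac{\log\log N}{\log N}}{s^2N}}\;\big(\widetilde B_N(t)-\widetilde m_N(t)\big)\ \overset{d}{\longrightarrow}\ \mathcal N(0,1)$$ in the same joint limit as in (a), and for every fixed real $t$, $\widetilde m_N(t)=M_N(t)+o(\sqrt N)$ as $N\to\infty$. -/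

import Mathlib

open MeasureTheory ProbabilityTheory Filter
open scoped Topology

noncomputable section

/-- The exponential integral `Ei z = γ + log z + ∑_{n ≥ 1} z ^ n / (n · n!)`, with the principal
logarithm. The real part does not depend on the branch of the logarithm. -/
def expIntegralEi (z : ℂ) : ℂ :=
  (Real.eulerMascheroniConstant : ℂ) + Complex.log z +
    ∑' n : ℕ, z ^ (n + 1) / (((n + 1 : ℕ) : ℂ) * ((n + 1).factorial : ℂ))

/-- The random set of pseudo-primes: `n ≥ 3` belongs to it when `r n ≤ 1 / log n`. -/
def pseudoPrimes {Ω : Type*} (r : ℕ → Ω → ℝ) (ω : Ω) : Set ℕ :=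
  {n | 3 ≤ n ∧ r n ω ≤ 1 / Real.log n}

/-- `pseudoPrime r j ω` is the `j`-th smallest pseudo-prime, `j = 1, 2, 3, …`. -/
def pseudoPrime {Ω : Type*} (r : ℕ → Ω → ℝ) (j : ℕ) (ω : Ω) : ℕ :=
  Nat.nth (fun n => n ∈ pseudoPrimes r ω) (j - 1)

/-- The sum of `cos (t log p'_j)` over those of the first `N` pseudo-primes `p'_1 < … < p'_N`
that are coprime to `k`. -/
def pseudoPrimeCosSum {Ω : Type*} (r : ℕ → Ω → ℝ) (k N : ℕ) (t : ℝ) (ω : Ω) : ℝ :=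
  ∑ j ∈ Finset.Icc 1 N with (pseudoPrime r j ω).Coprime k,
    Real.cos (t * Real.log (pseudoPrime r j ω))

open Classical in
/-- The indicator `z_{n,k}` of the event that `r n ≤ 1 / log n` and `n` is coprime to `k`. -/
def cramerIndicator {Ω : Type*} (r : ℕ → Ω → ℝ) (k n : ℕ) (ω : Ω) : ℝ :=
  if r n ω ≤ 1 / Real.log n ∧ n.Coprime k then 1 else 0

/-- The sum of `z_{n,k} cos (t log n)` over `3 ≤ n ≤ X`. -/
def cutoffCosSum {Ω : Type*} (r : ℕ → Ω → ℝ) (k : ℕ) (t : ℝ) (X : ℕ) (ω : Ω) : ℝ :=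
  ∑ n ∈ Finset.Icc 3 X, cramerIndicator r k n ω * Real.cos (t * Real.log n)

/-- The sum over `3 ≤ n ≤ X` of the means `μ_n = E [z_{n,k} cos (t log n)]`. -/
def sumOfMeans {Ω : Type*} [MeasurableSpace Ω] (P : Measure Ω) (r : ℕ → Ω → ℝ)
    (k : ℕ) (t : ℝ) (X : ℕ) : ℝ :=
  ∑ n ∈ Finset.Icc 3 X, ∫ ω, cramerIndicator r k n ω * Real.cos (t * Real.log n) ∂P

/-- The normalizing factor `√((1 + log log N / log N) / (s² N))` with `s² = φ(k) / (2k)`. -/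
def cltScale (k N : ℕ) : ℝ :=
  √((1 + Real.log (Real.log N) / Real.log N) / ((k.totient : ℝ) / (2 * (k : ℝ)) * (N : ℝ)))

/-- The function `(φ(k) / k) · Re Ei((1 + i t) log (N log N))`. -/
def meanMainTerm (k N : ℕ) (t : ℝ) : ℝ :=
  (k.totient : ℝ) / (k : ℝ) *
    (expIntegralEi ((1 + (t : ℂ) * Complex.I) *
      ((Real.log ((N : ℝ) * Real.log N) : ℝ) : ℂ))).re

/-- The joint limit `N → ∞`, `t → ∞` of pairs `(N, t)` in the range `t ≤ N ^ A`. -/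
def jointLimit (A : ℕ) : Filter (ℕ × ℝ) :=
  (atTop ×ˢ atTop) ⊓ 𝓟 {q | q.2 ≤ (q.1 : ℝ) ^ A}

end

/-! The centered sum up to a fixed cutoff `X` is a sum of independent variables `(z_n - E z_n) cos
(t log n)`, each bounded by `1`. After scaling by about `N ^ (-1/2)` the summands are uniformly
small, so a central limit theorem for bounded arrays (`tendstoInDistribution_sum_of_bounded`) needs
only the convergence of the variance.

The variance is the sum over `n` coprime to `k` of `(1 / log n) (1 - 1 / log n) cos² (t log n)`, and
`cos² = (1 + cos 2·) / 2`. The constant half gives `φ(k) / (2k) · X / log X`, which is asymptotic to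
`s² N` for `X = N log N`; the factor `1 + log log N / log N` tends to `1` and is harmless. The other
half is negligible once `∑ n ^ (2it)` over `n < X` coprime to `k` is `o(X)`, uniformly for `t → ∞`,
`t ≤ N ^ A`. This is van der Corput's method: Kuzmin–Landau gives a second derivative test, Weyl
differencing raises its order, and order `A + 2` at most is needed for `t ≤ M ^ A`
(`exists_norm_sum_unitExp_log_le`).

For the random cutoff, Hoeffding and Borel–Cantelli place `p'_N` almost surely in `(1 ± ε) N log N`.
The event `n ≤ p'_N` depends only on `r_j` with `j < n`, so passing from `N log N` to `p'_N` adds a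
martingale transform. Its increments are orthogonal and its second moment is at most the sum of `1 /
log n` over the window, about `2 ε N` (`measureReal_sum_centeredTerm_sub_ge_le`). Chebyshev and
Slutsky then transfer the limit law.

For the means, `Re Ei ((1 + it) log x)` is a primitive of `cos (t log x) / log x`. Partial summation
against the integers coprime to `k`, whose counting function has bounded error, leaves `O(1 + log
X)` for fixed `t`; moving the cutoff to `p'_N` costs `o(N)` by the same window estimate. -/

/-! ### Exponential sums: the Kuzmin–Landau inequality. -/

/-- The additive character `x ↦ exp (2 π i x)` of the real line. -/
noncomputable def unitExp (x : ℝ) : ℂ := Complex.exp ((2 * Real.pi * x : ℝ) * Complex.I)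

lemma unitExp_add (x y : ℝ) : unitExp (x + y) = unitExp x * unitExp y := by
  unfold unitExp
  rw [← Complex.exp_add]
  congr 1
  push_cast
  ring

lemma norm_unitExp (x : ℝ) : ‖unitExp x‖ = 1 := Complex.norm_exp_ofReal_mul_I _

lemma unitExp_intCast (k : ℤ) : unitExp k = 1 := by
  unfold unitExp
  rw [Complex.exp_eq_one_iff]
  exact ⟨k, by push_cast; ring⟩

lemma conj_unitExp (x : ℝ) : (starRingEnd ℂ) (unitExp x) = unitExp (-x) := by
  unfold unitExp
  rw [← Complex.exp_conj, map_mul, Complex.conj_ofReal, Complex.conj_I]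
  congr 1
  push_cast
  ring

/-- Increments of the phase matter only modulo `1`, so their common integer part can be removed. -/
lemma unitExp_sub_int_mul (x : ℝ) (k : ℤ) (n : ℕ) : unitExp (x - k * n) = unitExp x := by
  have : x - k * n = x + ((-k * n : ℤ) : ℝ) := by push_cast; ring
  rw [this, unitExp_add, unitExp_intCast, mul_one]

lemma unitExp_eq (x : ℝ) : unitExp x =
    Complex.mk (1 - 2 * Real.sin (Real.pi * x) ^ 2)
      (2 * Real.sin (Real.pi * x) * Real.cos (Real.pi * x)) := by
  have h : 2 * Real.pi * x = 2 * (Real.pi * x) := by ring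
  apply Complex.ext
  · rw [unitExp, Complex.exp_ofReal_mul_I_re, h, Real.cos_two_mul, Real.cos_sq']
    ring
  · rw [unitExp, Complex.exp_ofReal_mul_I_im, h, Real.sin_two_mul]

/-- The coefficient `1 / (exp (2 π i v) - 1) = -1/2 - (i/2) cot (π v)` used in the summation by
parts of the Kuzmin–Landau inequality. -/
noncomputable def kuzminCoeff (v : ℝ) : ℂ :=
  Complex.mk (-1 / 2) (-(Real.cos (Real.pi * v) / Real.sin (Real.pi * v)) / 2)

lemma kuzminCoeff_mul {v : ℝ} (h : Real.sin (Real.pi * v) ≠ 0) :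
    kuzminCoeff v * (unitExp v - 1) = 1 := by
  rw [unitExp_eq, kuzminCoeff]
  have hc := Real.sin_sq_add_cos_sq (Real.pi * v)
  apply Complex.ext
  · simp
    field_simp
    linarith
  · simp
    field_simp
    ring

lemma two_mul_le_sin_pi_mul {θ v : ℝ} (hθ : 0 ≤ θ) (h1 : θ ≤ v) (h2 : v ≤ 1 - θ) :
    2 * θ ≤ Real.sin (Real.pi * v) := by
  have hpi := Real.pi_pos
  rcases le_total v (1 / 2) with h | h
  · have := Real.mul_le_sin (x := Real.pi * v) (mul_nonneg hpi.le (hθ.trans h1))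
      (by nlinarith)
    have h3 : 2 / Real.pi * (Real.pi * v) = 2 * v := by field_simp
    linarith
  · have := Real.mul_le_sin (x := Real.pi * (1 - v)) (by nlinarith) (by nlinarith)
    have h3 : 2 / Real.pi * (Real.pi * (1 - v)) = 2 * (1 - v) := by field_simp
    have h4 : Real.sin (Real.pi * (1 - v)) = Real.sin (Real.pi * v) := by
      rw [mul_sub, mul_one, Real.sin_pi_sub]
    linarith

/-- Monotonicity follows from `sin (πw - πv) ≥ 0`. It makes the total variation of the coefficients
`kuzminCoeff` telescope. -/
lemma cot_le_cot {v w : ℝ} (hv : 0 < v) (hvw : v ≤ w) (hw : w < 1) :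
    Real.cos (Real.pi * w) / Real.sin (Real.pi * w) ≤
      Real.cos (Real.pi * v) / Real.sin (Real.pi * v) := by
  have hpi := Real.pi_pos
  have h1 : 0 < Real.sin (Real.pi * v) :=
    Real.sin_pos_of_pos_of_lt_pi (by positivity) (by nlinarith)
  have h2 : 0 < Real.sin (Real.pi * w) :=
    Real.sin_pos_of_pos_of_lt_pi (by nlinarith) (by nlinarith)
  rw [div_le_div_iff₀ h2 h1]
  have h3 : 0 ≤ Real.sin (Real.pi * w - Real.pi * v) :=
    Real.sin_nonneg_of_nonneg_of_le_pi (by nlinarith) (by nlinarith)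
  rw [Real.sin_sub] at h3
  linarith

lemma abs_cot_le {θ v : ℝ} (hθ : 0 < θ) (h1 : θ ≤ v) (h2 : v ≤ 1 - θ) :
    |Real.cos (Real.pi * v) / Real.sin (Real.pi * v)| ≤ 1 / (2 * θ) := by
  have h := two_mul_le_sin_pi_mul hθ.le h1 h2
  have h0 : 0 < Real.sin (Real.pi * v) := by linarith
  rw [abs_div, abs_of_pos h0]
  exact div_le_div₀ zero_le_one (Real.abs_cos_le_one _) (by positivity) h

lemma norm_kuzminCoeff_le {θ v : ℝ} (hθ : 0 < θ) (h1 : θ ≤ v) (h2 : v ≤ 1 - θ) :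
    ‖kuzminCoeff v‖ ≤ 1 / (4 * θ) := by
  have h := two_mul_le_sin_pi_mul hθ.le h1 h2
  have h0 : 0 < Real.sin (Real.pi * v) := by linarith
  have hmul := kuzminCoeff_mul h0.ne'
  have hn : ‖unitExp v - 1‖ = 2 * Real.sin (Real.pi * v) := by
    rw [← sq_eq_sq₀ (norm_nonneg _) (by positivity), ← Complex.normSq_eq_norm_sq, unitExp_eq,
      Complex.normSq_apply]
    simp only [Complex.sub_re, Complex.one_re, Complex.sub_im, Complex.one_im]
    nlinarith [Real.sin_sq_add_cos_sq (Real.pi * v)]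
  have h3 : ‖kuzminCoeff v‖ * (2 * Real.sin (Real.pi * v)) = 1 := by
    rw [← hn, ← norm_mul, hmul, norm_one]
  rw [le_div_iff₀ (by positivity)]
  nlinarith [norm_nonneg (kuzminCoeff v)]

/-- The Kuzmin–Landau inequality for a sequence whose increments are monotone and lie in
`[θ, 1 - θ]`. -/
lemma kuzmin_landau_aux {θ : ℝ} (hθ : 0 < θ) (u : ℕ → ℝ) (M : ℕ)
    (hlo : ∀ n ≤ M, θ ≤ u (n + 1) - u n) (hhi : ∀ n ≤ M, u (n + 1) - u n ≤ 1 - θ)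
    (hmono : ∀ n < M, u (n + 1) - u n ≤ u (n + 2) - u (n + 1)) :
    ‖∑ n ∈ Finset.range (M + 1), unitExp (u n)‖ ≤ 1 / θ := by
  set v : ℕ → ℝ := fun n => u (n + 1) - u n with hv
  set c : ℕ → ℝ := fun n => Real.cos (Real.pi * v n) / Real.sin (Real.pi * v n) with hc
  -- Each term is a coefficient times a difference of consecutive terms, which sets up the summation
  -- by parts.
  have hx : ∀ n ≤ M, unitExp (u n) =
      kuzminCoeff (v n) * (unitExp (u (n + 1)) - unitExp (u n)) := by
    intro n hn
    have h0 : Real.sin (Real.pi * v n) ≠ 0 := by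
      have := two_mul_le_sin_pi_mul hθ.le (hlo n hn) (hhi n hn)
      intro h
      rw [h] at this
      linarith
    have h1 : u (n + 1) = u n + v n := by simp [hv]
    have h2 := kuzminCoeff_mul h0
    rw [h1, unitExp_add]
    linear_combination (-unitExp (u n)) * h2
  -- Partial sums minus the upper boundary term: the lower boundary term costs `1 / (4θ)`, and the
  -- variation of the coefficients telescopes to `(c 0 - c m) / 2`.
  have key : ∀ m ≤ M, ‖∑ n ∈ Finset.range (m + 1), unitExp (u n) -
      kuzminCoeff (v m) * unitExp (u (m + 1))‖ ≤ 1 / (4 * θ) + (c 0 - c m) / 2 := by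
    intro m
    induction m with
    | zero =>
      intro h0
      have h1 : ∑ n ∈ Finset.range (0 + 1), unitExp (u n) -
          kuzminCoeff (v 0) * unitExp (u (0 + 1)) = -(kuzminCoeff (v 0) * unitExp (u 0)) := by
        have := hx 0 h0
        simp only [zero_add, Finset.range_one, Finset.sum_singleton] at this ⊢
        linear_combination this
      rw [h1, norm_neg, norm_mul, norm_unitExp, mul_one, sub_self, zero_div, add_zero]
      exact norm_kuzminCoeff_le hθ (hlo 0 h0) (hhi 0 h0)
    | succ m ih =>
      intro hm
      have ih' := ih (by omega)
      have hx' := hx (m + 1) hm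
      have h1 : ∑ n ∈ Finset.range (m + 1 + 1), unitExp (u n) -
          kuzminCoeff (v (m + 1)) * unitExp (u (m + 1 + 1)) =
          (∑ n ∈ Finset.range (m + 1), unitExp (u n) -
            kuzminCoeff (v m) * unitExp (u (m + 1))) +
          (kuzminCoeff (v m) - kuzminCoeff (v (m + 1))) * unitExp (u (m + 1)) := by
        rw [Finset.sum_range_succ]
        linear_combination hx'
      have h2 : ‖kuzminCoeff (v m) - kuzminCoeff (v (m + 1))‖ = (c m - c (m + 1)) / 2 := by
        have hcc : c (m + 1) ≤ c m := by
          apply cot_le_cot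
          · have := hlo m (by omega)
            simp only [hv]; linarith
          · exact hmono m (by omega)
          · have := hhi (m + 1) hm
            simp only [hv]; linarith
        -- The real part of the coefficient is constantly `-1/2`, so differences are purely
        -- imaginary.
        have : kuzminCoeff (v m) - kuzminCoeff (v (m + 1)) =
            ((-(c m - c (m + 1)) / 2 : ℝ) : ℂ) * Complex.I := by
          apply Complex.ext
          · simp [kuzminCoeff]
          · simp only [kuzminCoeff, hc, Complex.sub_im, Complex.mul_im, Complex.ofReal_re,
              Complex.ofReal_im, Complex.I_im, Complex.I_re]
            ring
        rw [this, norm_mul, Complex.norm_I, mul_one, Complex.norm_real, Real.norm_eq_abs,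
          neg_div, abs_neg, abs_of_nonneg (by linarith)]
      rw [h1]
      refine (norm_add_le _ _).trans ?_
      rw [norm_mul, norm_unitExp, mul_one, h2]
      linarith
  have hM := key M le_rfl
  have h1 : ‖kuzminCoeff (v M) * unitExp (u (M + 1))‖ ≤ 1 / (4 * θ) := by
    rw [norm_mul, norm_unitExp, mul_one]
    exact norm_kuzminCoeff_le hθ (hlo M le_rfl) (hhi M le_rfl)
  -- The two boundary terms contribute `1 / (4θ)` each and the variation at most `1 / (2θ)`, in
  -- total `1 / θ`.
  have h2 := abs_le.1 (abs_cot_le hθ (hlo 0 (Nat.zero_le _)) (hhi 0 (Nat.zero_le _)))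
  have h3 := abs_le.1 (abs_cot_le hθ (hlo M le_rfl) (hhi M le_rfl))
  have h4 := norm_add_le (∑ n ∈ Finset.range (M + 1), unitExp (u n) -
      kuzminCoeff (v M) * unitExp (u (M + 1))) (kuzminCoeff (v M) * unitExp (u (M + 1)))
  rw [sub_add_cancel] at h4
  have h5 : 1 / (4 * θ) = 1 / θ / 4 := by field_simp
  have h6 : 1 / (2 * θ) = 1 / θ / 2 := by field_simp
  have h7 : c 0 ≤ 1 / (2 * θ) := h2.2
  have h8 : -(1 / (2 * θ)) ≤ c M := h3.1
  rw [h6] at h7 h8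
  rw [h5] at h1 hM
  linarith

/-- The Kuzmin–Landau inequality. -/
lemma kuzmin_landau {θ : ℝ} (hθ : 0 < θ) (u : ℕ → ℝ) (a b : ℕ) (k : ℤ)
    (hlo : ∀ n ∈ Finset.Ico a b, k + θ ≤ u (n + 1) - u n)
    (hhi : ∀ n ∈ Finset.Ico a b, u (n + 1) - u n ≤ k + 1 - θ)
    (hmono : ∀ n ∈ Finset.Ico a b, u (n + 1) - u n ≤ u (n + 2) - u (n + 1)) :
    ‖∑ n ∈ Finset.Ico a b, unitExp (u n)‖ ≤ 1 / θ := by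
  rcases Nat.lt_or_ge a b with hab | hab
  swap
  · rw [Finset.Ico_eq_empty (by omega)]
    simp
    positivity
  obtain ⟨M, rfl⟩ : ∃ M, b = a + (M + 1) := ⟨b - a - 1, by omega⟩
  have h1 : ∑ n ∈ Finset.Ico a (a + (M + 1)), unitExp (u n) =
      ∑ n ∈ Finset.range (M + 1), unitExp (u (a + n) - k * n) := by
    rw [Finset.sum_Ico_eq_sum_range]
    simp only [unitExp_sub_int_mul]
    simp
  rw [h1]
  apply kuzmin_landau_aux hθ (fun n => u (a + n) - k * n)
  · intro n hn
    have := hlo (a + n) (by simp; omega)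
    push_cast
    rw [← add_assoc]
    linarith
  · intro n hn
    have := hhi (a + n) (by simp; omega)
    push_cast
    rw [← add_assoc]
    linarith
  · intro n hn
    have := hmono (a + n) (by simp; omega)
    push_cast
    rw [← add_assoc, ← add_assoc]
    linarith

/-! ### The second difference test. -/

lemma Finset.exists_eq_Ico_of_ordConnected (s : Finset ℕ)
    (h : ∀ a ∈ s, ∀ b ∈ s, ∀ c, a ≤ c → c ≤ b → c ∈ s) : ∃ a b, s = Finset.Ico a b := by
  rcases s.eq_empty_or_nonempty with rfl | hs
  · exact ⟨0, 0, by simp⟩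
  · refine ⟨s.min' hs, s.max' hs + 1, ?_⟩
    ext c
    simp only [Finset.mem_Ico, Nat.lt_succ_iff]
    exact ⟨fun hc => ⟨s.min'_le c hc, s.le_max' c hc⟩,
      fun hc => h _ (s.min'_mem hs) _ (s.max'_mem hs) c hc.1 hc.2⟩

lemma sub_bounds_of_increment_bounds {v : ℕ → ℝ} {l L : ℝ} {N : ℕ}
    (h : ∀ n < N, l ≤ v (n + 1) - v n ∧ v (n + 1) - v n ≤ L) (a b : ℕ) (hab : a ≤ b)
    (hb : b ≤ N) : l * (b - a) ≤ v b - v a ∧ v b - v a ≤ L * (b - a) := by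
  induction b, hab using Nat.le_induction with
  | base => simp
  | succ b hab ih =>
    obtain ⟨h1, h2⟩ := ih (by omega)
    obtain ⟨h3, h4⟩ := h b (by omega)
    push_cast
    constructor <;> linarith

/-- Consecutive values are at least `l` apart, so few of them fit in an interval of length `θ`. -/
lemma card_le_of_increment_bounds {v : ℕ → ℝ} {l θ y : ℝ} {N : ℕ} (hl : 0 < l) (hθ : 0 ≤ θ)
    (h : ∀ a b : ℕ, a ≤ b → b ≤ N → l * (b - a) ≤ v b - v a) (s : Finset ℕ)
    (hs : ∀ n ∈ s, n ≤ N) (hv : ∀ n ∈ s, y ≤ v n ∧ v n ≤ y + θ) : (s.card : ℝ) ≤ θ / l + 1 := by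
  rcases s.eq_empty_or_nonempty with rfl | hne
  · simp
    positivity
  · have h1 : s ⊆ Finset.Icc (s.min' hne) (s.max' hne) := fun c hc =>
      Finset.mem_Icc.2 ⟨s.min'_le c hc, s.le_max' c hc⟩
    have h2 := Finset.card_le_card h1
    rw [Nat.card_Icc] at h2
    have h3 : s.min' hne ≤ s.max' hne := s.min'_le _ (s.max'_mem hne)
    have h4 := h _ _ h3 (hs _ (s.max'_mem hne))
    have h5 := hv _ (s.max'_mem hne)
    have h6 := hv _ (s.min'_mem hne)
    have h7 : (s.card : ℝ) ≤ (s.max' hne : ℝ) + 1 - (s.min' hne : ℝ) := by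
      have : s.card + s.min' hne ≤ s.max' hne + 1 := by omega
      have : (s.card : ℝ) + (s.min' hne : ℝ) ≤ (s.max' hne : ℝ) + 1 := by exact_mod_cast this
      linarith
    have h8 : (s.max' hne : ℝ) - (s.min' hne : ℝ) ≤ θ / l := by
      rw [le_div_iff₀ hl]
      linarith
    linarith

/-- The part of an exponential sum on which the increments have a given integer part. -/
lemma norm_sum_fiber_le {l θ : ℝ} (hl : 0 < l) (hθ : 0 < θ) (u : ℕ → ℝ) (N : ℕ)
    (h : ∀ a b : ℕ, a ≤ b → b ≤ N →
      l * (b - a) ≤ (u (b + 1) - u b) - (u (a + 1) - u a)) (k : ℤ) :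
    ‖∑ n ∈ Finset.range N with ⌊u (n + 1) - u n⌋ = k, unitExp (u n)‖ ≤
      1 / θ + 2 * (θ / l + 1) := by
  set v : ℕ → ℝ := fun n => u (n + 1) - u n with hv
  have hmono : ∀ a b : ℕ, a ≤ b → b ≤ N → v a ≤ v b := by
    intro a b hab hb
    have h1 := h a b hab hb
    have h2 : (a : ℝ) ≤ b := by exact_mod_cast hab
    have h3 : 0 ≤ l * (b - a) := mul_nonneg hl.le (by linarith)
    simp only [hv]
    linarith
  set F := Finset.range N with hF
  -- Indices whose increment stays `θ` away from the integers form an interval, where Kuzmin–Landau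
  -- applies. The others lie in two windows of length `θ` and are merely counted.
  rw [← Finset.sum_filter_add_sum_filter_not (F.filter fun n => ⌊v n⌋ = k)
    (fun n => k + θ ≤ v n ∧ v n ≤ k + 1 - θ)]
  have hmid : ‖∑ n ∈ (F.filter fun n => ⌊v n⌋ = k) with (k + θ ≤ v n ∧ v n ≤ k + 1 - θ),
      unitExp (u n)‖ ≤ 1 / θ := by
    obtain ⟨a, b, hab⟩ := Finset.exists_eq_Ico_of_ordConnected
      ((F.filter fun n => ⌊v n⌋ = k).filter (fun n => k + θ ≤ v n ∧ v n ≤ k + 1 - θ)) (by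
        intro a ha b hb c hac hcb
        simp only [hF, Finset.mem_filter, Finset.mem_range] at ha hb ⊢
        have h1 := hmono a c hac (by omega)
        have h2 := hmono c b hcb (by omega)
        refine ⟨⟨by omega, ?_⟩, by linarith, by linarith⟩
        rw [Int.floor_eq_iff]
        constructor <;> linarith)
    rw [hab]
    have hmem : ∀ n ∈ Finset.Ico a b, n < N ∧ (k + θ ≤ v n ∧ v n ≤ k + 1 - θ) := by
      intro n hn
      rw [← hab] at hn
      simp only [hF, Finset.mem_filter, Finset.mem_range] at hn
      exact ⟨hn.1.1, hn.2⟩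
    exact kuzmin_landau hθ u a b k (fun n hn => (hmem n hn).2.1) (fun n hn => (hmem n hn).2.2)
      (fun n hn => hmono n (n + 1) (by omega) (hmem n hn).1)
  have hend : ‖∑ n ∈ (F.filter fun n => ⌊v n⌋ = k) with ¬ (k + θ ≤ v n ∧ v n ≤ k + 1 - θ),
      unitExp (u n)‖ ≤ 2 * (θ / l + 1) := by
    refine (norm_sum_le _ _).trans ?_
    simp only [norm_unitExp, Finset.sum_const, nsmul_eq_mul, mul_one]
    have hsub : (F.filter fun n => ⌊v n⌋ = k).filter (fun n => ¬ (k + θ ≤ v n ∧ v n ≤ k + 1 - θ)) ⊆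
        (F.filter fun n => (k : ℝ) ≤ v n ∧ v n ≤ k + θ) ∪
        (F.filter fun n => (k + 1 - θ : ℝ) ≤ v n ∧ v n ≤ k + 1 - θ + θ) := by
      intro n hn
      simp only [Finset.mem_filter, Finset.mem_union, Int.floor_eq_iff] at hn ⊢
      obtain ⟨⟨h1, h2, h3⟩, h4⟩ := hn
      rcases le_or_gt (k + θ : ℝ) (v n) with h5 | h5
      · refine Or.inr ⟨h1, ?_, by linarith⟩
        by_contra h6
        exact h4 ⟨h5, by linarith⟩
      · exact Or.inl ⟨h1, h2, h5.le⟩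
    have h1 := (Finset.card_le_card hsub).trans (Finset.card_union_le _ _)
    have h2 := card_le_of_increment_bounds (v := v) (y := k) hl hθ.le h
      (F.filter fun n => (k : ℝ) ≤ v n ∧ v n ≤ k + θ)
      (fun n hn => by simp [hF] at hn; omega) (fun n hn => (Finset.mem_filter.1 hn).2)
    have h3 := card_le_of_increment_bounds (v := v) (y := k + 1 - θ) hl hθ.le h
      (F.filter fun n => (k + 1 - θ : ℝ) ≤ v n ∧ v n ≤ k + 1 - θ + θ)
      (fun n hn => by simp [hF] at hn; omega) (fun n hn => (Finset.mem_filter.1 hn).2)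
    have h4 := (Nat.cast_le (α := ℝ)).2 h1
    push_cast at h4
    linarith
  exact (norm_add_le _ _).trans (add_le_add hmid hend)

/-- A discrete form of van der Corput's second derivative test. -/
lemma second_difference_test {C l : ℝ} (hl : 0 < l) (hl4 : l ≤ 1 / 4) (u : ℕ → ℝ) (N : ℕ)
    (h : ∀ n < N, l ≤ (u (n + 2) - u (n + 1)) - (u (n + 1) - u n) ∧
      (u (n + 2) - u (n + 1)) - (u (n + 1) - u n) ≤ C * l) :
    ‖∑ n ∈ Finset.range N, unitExp (u n)‖ ≤ (C * l * N + 2) * (4 / √l) := by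
  set v : ℕ → ℝ := fun n => u (n + 1) - u n with hv
  have hb := sub_bounds_of_increment_bounds (v := v) (l := l) (L := C * l) (N := N) h
  have hs : 0 < √l := Real.sqrt_pos.2 hl
  have hs2 : √l ≤ 1 / 2 := by
    rw [Real.sqrt_le_left (by norm_num)]
    linarith
  have hmaps : ∀ n ∈ Finset.range N, ⌊v n⌋ ∈ Finset.Icc ⌊v 0⌋ ⌊v N⌋ := by
    intro n hn
    rw [Finset.mem_range] at hn
    rw [Finset.mem_Icc]
    have h1 := (hb 0 n (by omega) hn.le).1
    have h2 := (hb n N hn.le le_rfl).1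
    have h3 : (n : ℝ) ≤ N := by exact_mod_cast hn.le
    push_cast at h1
    constructor
    · apply Int.floor_le_floor
      have : 0 ≤ l * ((n : ℝ) - 0) := mul_nonneg hl.le (by simp)
      linarith
    · apply Int.floor_le_floor
      have : 0 ≤ l * ((N : ℝ) - n) := mul_nonneg hl.le (by linarith)
      linarith
  -- The increments are monotone and take at most `C l N + 2` integer parts. On each fiber the
  -- choice `θ = √l` balances `1 / θ` against `θ / l`.
  rw [← Finset.sum_fiberwise_of_maps_to hmaps]
  refine (norm_sum_le_of_le _ (fun k _ => norm_sum_fiber_le hl hs u N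
    (fun a b hab hbN => (hb a b hab hbN).1) k)).trans ?_
  rw [Finset.sum_const, nsmul_eq_mul]
  have hcard : ((Finset.Icc ⌊v 0⌋ ⌊v N⌋).card : ℝ) ≤ C * l * N + 2 := by
    rw [Int.card_Icc]
    have h0 := (hb 0 N (by omega) le_rfl)
    have h1 : ⌊v 0⌋ ≤ ⌊v N⌋ := by
      apply Int.floor_le_floor
      have : 0 ≤ l * ((N : ℝ) - (0 : ℕ)) := by simp; positivity
      linarith [h0.1]
    have h2 : (((⌊v N⌋ + 1 - ⌊v 0⌋).toNat : ℤ) : ℝ) = ⌊v N⌋ + 1 - ⌊v 0⌋ := by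
      rw [Int.toNat_of_nonneg (by omega)]
      push_cast
      ring
    have h3 : (((⌊v N⌋ + 1 - ⌊v 0⌋).toNat : ℕ) : ℝ) = ⌊v N⌋ + 1 - ⌊v 0⌋ := by exact_mod_cast h2
    rw [h3]
    have h4 := Int.floor_le (v N)
    have h5 := Int.lt_floor_add_one (v 0)
    have h6 := h0.2
    push_cast at h6
    linarith
  have hval : 1 / √l + 2 * (√l / l + 1) ≤ 4 / √l := by
    have h1 : √l / l = 1 / √l := by
      rw [div_eq_div_iff hl.ne' hs.ne', one_mul, Real.mul_self_sqrt hl.le]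
    rw [h1]
    have h2 : 2 ≤ 1 / √l := by
      rw [le_div_iff₀ hs]
      linarith
    have h3 : 4 / √l = 4 * (1 / √l) := by ring
    rw [h3]
    linarith
  have h0 : 0 ≤ 1 / √l + 2 * (√l / l + 1) := by positivity
  exact mul_le_mul hcard hval h0 ((Nat.cast_nonneg _).trans hcard)

/-! ### Difference tests of higher order by Weyl differencing. -/

/-- Exponential sums over sequences whose `m`-th differences have size about `l` exhibit
cancellation as soon as `l` is small and `l * N ^ 2` is large. -/
def HasDifferenceTest (m : ℕ) : Prop :=
  ∀ C ε : ℝ, 0 < C → 0 < ε → ∃ δ : ℝ, 0 < δ ∧ ∀ (N : ℕ) (l : ℝ) (u : ℕ → ℝ), 0 < l → l ≤ δ →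
    1 ≤ δ * l * (N : ℝ) ^ 2 →
    (∀ n < N, l ≤ (fwdDiff 1)^[m] u n ∧ (fwdDiff 1)^[m] u n ≤ C * l) →
    ‖∑ n ∈ Finset.range N, unitExp (u n)‖ ≤ ε * N

lemma hasDifferenceTest_two : HasDifferenceTest 2 := by
  intro C ε hC hε
  -- The test bounds the sum by `4C √l N + 8 / √l`. Both `√l ≤ √δ` and `1 / √l ≤ √δ N` hold, so `√δ
  -- (4C + 8) ≤ ε` is what is required.
  set δ : ℝ := min (1 / 4) ((ε / (4 * C + 8)) ^ 2) with hδ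
  have hδ0 : 0 < δ := by positivity
  have hsδ : √δ ≤ ε / (4 * C + 8) := by
    rw [Real.sqrt_le_left (by positivity)]
    exact min_le_right _ _
  refine ⟨δ, hδ0, fun N l u hl hlδ hN h => ?_⟩
  have hmain := second_difference_test (C := C) hl (hlδ.trans (min_le_left _ _)) u N (by
    intro n hn
    have := h n hn
    simpa [fwdDiff, add_assoc] using this)
  refine hmain.trans ?_
  have hs : 0 < √l := Real.sqrt_pos.2 hl
  have h1 : √l ≤ √δ := Real.sqrt_le_sqrt hlδ
  have h2 : 1 ≤ √δ * √l * N := by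
    have : √(δ * l * (N : ℝ) ^ 2) = √δ * √l * N := by
      rw [Real.sqrt_mul (by positivity), Real.sqrt_mul hδ0.le, Real.sqrt_sq (by positivity)]
    rw [← this]
    exact Real.one_le_sqrt.2 hN
  have h3 : (C * l * N + 2) * (4 / √l) = 4 * C * √l * N + 8 * (1 / √l) := by
    have : l / √l = √l := Real.div_sqrt
    calc (C * l * N + 2) * (4 / √l) = 4 * C * (l / √l) * N + 8 * (1 / √l) := by ring
      _ = _ := by rw [this]
  have h4 : 1 / √l ≤ √δ * N := by
    rw [div_le_iff₀ hs]
    linarith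
  rw [h3]
  have hN0 : (0 : ℝ) ≤ N := Nat.cast_nonneg N
  calc 4 * C * √l * N + 8 * (1 / √l) ≤ 4 * C * √δ * N + 8 * (√δ * N) := by gcongr
    _ = √δ * (4 * C + 8) * N := by ring
    _ ≤ ε / (4 * C + 8) * (4 * C + 8) * N := by gcongr
    _ = ε * N := by field_simp

/-- The Weyl–van der Corput differencing inequality. -/
lemma norm_sum_le_of_correlations (x : ℕ → ℂ) (hx : ∀ n, ‖x n‖ = 1) (N H : ℕ) (hH : 0 < H)
    {B : ℝ} (hB : ∀ h < H, ∀ h' < h,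
      ‖∑ n ∈ Finset.range N, x (n + h) * (starRingEnd ℂ) (x (n + h'))‖ ≤ B * N) (hB0 : 0 ≤ B) :
    ‖∑ n ∈ Finset.range N, x n‖ ≤ 2 * H + √(1 / H + B) * N := by
  have hH' : (0 : ℝ) < H := by exact_mod_cast hH
  set Z : ℕ → ℂ := fun n => ∑ h ∈ Finset.range H, x (n + h) with hZ
  have hshift : ∀ h : ℕ, ‖∑ n ∈ Finset.range N, x n - ∑ n ∈ Finset.range N, x (n + h)‖ ≤ 2 * h := by
    intro h
    have h1 := Finset.sum_range_add x N h
    have h2 := Finset.sum_range_add x h N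
    have h3 : ∑ n ∈ Finset.range N, x n - ∑ n ∈ Finset.range N, x (n + h) =
        ∑ n ∈ Finset.range h, x n - ∑ n ∈ Finset.range h, x (N + n) := by
      rw [add_comm h N, h1] at h2
      simp only [add_comm _ h]
      linear_combination h2
    rw [h3]
    refine (norm_sub_le _ _).trans ?_
    have h4 := norm_sum_le (Finset.range h) x
    have h5 := norm_sum_le (Finset.range h) fun n => x (N + n)
    simp only [hx, Finset.sum_const, Finset.card_range, nsmul_eq_mul, mul_one] at h4 h5
    linarith
  -- Averaging over `H` shifts replaces each term by the mean of a window of length `H`, with edge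
  -- effects of at most `2H`.
  have havg : (H : ℝ) * ‖∑ n ∈ Finset.range N, x n‖ ≤
      2 * H * H + ‖∑ n ∈ Finset.range N, Z n‖ := by
    have h1 : (H : ℂ) * ∑ n ∈ Finset.range N, x n =
        ∑ h ∈ Finset.range H, (∑ n ∈ Finset.range N, x n - ∑ n ∈ Finset.range N, x (n + h)) +
          ∑ n ∈ Finset.range N, Z n := by
      rw [Finset.sum_sub_distrib]
      simp only [hZ, Finset.sum_const, Finset.card_range, nsmul_eq_mul]
      rw [Finset.sum_comm]
      ring
    have h2 := congrArg norm h1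
    rw [norm_mul, Complex.norm_natCast] at h2
    rw [h2]
    refine (norm_add_le _ _).trans (add_le_add ?_ le_rfl)
    refine (norm_sum_le_of_le _ fun h _ => hshift h).trans ?_
    have : ∀ h ∈ Finset.range H, (2 * h : ℝ) ≤ 2 * H := by
      intro h hh
      have : (h : ℝ) ≤ H := by exact_mod_cast (Finset.mem_range.1 hh).le
      linarith
    refine (Finset.sum_le_sum this).trans ?_
    rw [Finset.sum_const, Finset.card_range, nsmul_eq_mul]
    linarith
  have hcorr : ∀ h ∈ Finset.range H, ∀ h' ∈ Finset.range H,
      ‖∑ n ∈ Finset.range N, x (n + h) * (starRingEnd ℂ) (x (n + h'))‖ ≤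
        (if h = h' then (N : ℝ) else 0) + B * N := by
    intro h hh h' hh'
    rw [Finset.mem_range] at hh hh'
    rcases lt_trichotomy h h' with hlt | rfl | hlt
    · rw [if_neg hlt.ne, zero_add, ← RCLike.norm_conj]
      refine le_trans (le_of_eq ?_) (hB h' hh' h hlt)
      congr 1
      simp [mul_comm]
    · simp only [if_true]
      refine (norm_sum_le _ _).trans ?_
      simp only [norm_mul, RCLike.norm_conj, hx, mul_one, Finset.sum_const, Finset.card_range,
        nsmul_eq_mul]
      nlinarith [(Nat.cast_nonneg N : (0 : ℝ) ≤ N)]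
    · rw [if_neg hlt.ne', zero_add]
      exact hB h hh h' hlt
  -- Opening the square: the `H` diagonal pairs give `N` each, all other pairs are the correlations
  -- bounded by `B N`.
  have hsq : ∑ n ∈ Finset.range N, ‖Z n‖ ^ 2 ≤ H * N + H * H * (B * N) := by
    have h1 : ((∑ n ∈ Finset.range N, ‖Z n‖ ^ 2 : ℝ) : ℂ) =
        ∑ h ∈ Finset.range H, ∑ h' ∈ Finset.range H,
          ∑ n ∈ Finset.range N, x (n + h) * (starRingEnd ℂ) (x (n + h')) := by
      push_cast
      have : ∀ n, ((‖Z n‖ : ℂ)) ^ 2 = ∑ h ∈ Finset.range H, ∑ h' ∈ Finset.range H,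
          x (n + h) * (starRingEnd ℂ) (x (n + h')) := by
        intro n
        rw [← Complex.mul_conj', hZ, map_sum, Finset.sum_mul_sum]
      simp only [this]
      rw [Finset.sum_comm]
      refine Finset.sum_congr rfl fun h _ => ?_
      rw [Finset.sum_comm]
    have h2 : ∑ n ∈ Finset.range N, ‖Z n‖ ^ 2 =
        ‖((∑ n ∈ Finset.range N, ‖Z n‖ ^ 2 : ℝ) : ℂ)‖ := by
      rw [Complex.norm_real, Real.norm_of_nonneg (Finset.sum_nonneg fun n _ => by positivity)]
    rw [h2, h1]
    refine (norm_sum_le_of_le _ fun h hh => norm_sum_le_of_le _ fun h' hh' =>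
      hcorr h hh h' hh').trans (le_of_eq ?_)
    simp only [Finset.sum_add_distrib, Finset.sum_ite_eq, Finset.sum_const, Finset.card_range,
      nsmul_eq_mul]
    rw [Finset.sum_congr rfl (g := fun _ => (N : ℝ)) (fun h hh => if_pos hh)]
    simp
    ring
  have hcs : ‖∑ n ∈ Finset.range N, Z n‖ ^ 2 ≤ N * ∑ n ∈ Finset.range N, ‖Z n‖ ^ 2 := by
    have h1 := sq_sum_le_card_mul_sum_sq (s := Finset.range N) (f := fun n => ‖Z n‖)
    rw [Finset.card_range] at h1
    refine le_trans ?_ h1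
    gcongr
    exact norm_sum_le _ _
  have hZb : ‖∑ n ∈ Finset.range N, Z n‖ ≤ H * (√(1 / H + B) * N) := by
    apply le_of_sq_le_sq _ (by positivity)
    refine hcs.trans ((mul_le_mul_of_nonneg_left hsq (Nat.cast_nonneg N)).trans (le_of_eq ?_))
    rw [mul_pow, mul_pow, Real.sq_sqrt (by positivity)]
    field_simp
  have hfin : (H : ℝ) * ‖∑ n ∈ Finset.range N, x n‖ ≤ H * (2 * H + √(1 / H + B) * N) := by
    linarith
  exact le_of_mul_le_mul_left hfin hH'

/-- Telescoping over the shifts. It shows that differencing trades an `m + 1`-st difference of size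
`l` for an `m`-th difference of size `(h - h') l`, with the same ratio `C` of upper to lower bound.
-/
lemma fwdDiff_iter_shift_sub (u : ℕ → ℝ) (m h h' n : ℕ) (hh : h' ≤ h) :
    (fwdDiff 1)^[m] (fun n => u (n + h) - u (n + h')) n =
      ∑ i ∈ Finset.Ico h' h, (fwdDiff 1)^[m + 1] u (n + i) := by
  have h1 : ∀ k, ((fwdDiff 1)^[k] fun n => u (n + h) - u (n + h')) =
      fun n => (fwdDiff 1)^[k] u (n + h) - (fwdDiff 1)^[k] u (n + h') := by
    intro k
    induction k with
    | zero => rfl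
    | succ k ih =>
      rw [Function.iterate_succ', Function.comp, ih, Function.comp]
      funext n
      simp only [fwdDiff]
      rw [add_right_comm n 1 h, add_right_comm n 1 h']
      ring
  rw [h1]
  have h2 : ∀ i, (fwdDiff 1)^[m + 1] u (n + i) =
      (fwdDiff 1)^[m] u (n + (i + 1)) - (fwdDiff 1)^[m] u (n + i) := by
    intro i
    rw [Function.iterate_succ', Function.comp]
    simp [fwdDiff, add_assoc]
  simp only [h2]
  rw [Finset.sum_Ico_sub (f := fun i => (fwdDiff 1)^[m] u (n + i)) hh]

/-- The correlations of `unitExp (u n)` are exponential sums to which the test of order `m` applies.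
Choosing `H` large but fixed makes the diagonal contribution `1 / H` small. -/
lemma HasDifferenceTest.succ {m : ℕ} (hm : HasDifferenceTest m) : HasDifferenceTest (m + 1) := by
  intro C ε hC hε
  obtain ⟨H, hH⟩ := exists_nat_gt (max 1 (32 / ε ^ 2))
  have hH1 : (1 : ℝ) < H := (le_max_left _ _).trans_lt hH
  have hH0 : (0 : ℝ) < H := by linarith
  have hHε : 1 / (H : ℝ) ≤ ε ^ 2 / 32 := by
    have := (le_max_right (1 : ℝ) (32 / ε ^ 2)).trans hH.le
    rw [div_le_iff₀ (by positivity)] at this ⊢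
    linarith
  obtain ⟨δ', hδ', htest⟩ := hm C (ε ^ 2 / 32) hC (by positivity)
  -- The entries serve in turn: `H l ≤ δ'`; the length condition for `M ≥ N / 2` terms; `H ≤ N / 2`;
  -- and `3H ≤ ε N / 2`, which absorbs the edge effects `2H` and the dropped tail `H`.
  set δ : ℝ := min (min (δ' / H) (δ' / 4)) (min (1 / 2 / H) (min (ε / 2 / (3 * H)) 1)) with hδ
  have hδ0 : 0 < δ := by positivity
  have hδ1 : δ ≤ δ' / H := (min_le_left _ _).trans (min_le_left _ _)
  have hδ2 : δ ≤ δ' / 4 := (min_le_left _ _).trans (min_le_right _ _)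
  have hδ3 : δ ≤ 1 / 2 / H := (min_le_right _ _).trans (min_le_left _ _)
  have hδ4 : δ ≤ ε / 2 / (3 * H) :=
    (min_le_right _ _).trans ((min_le_right _ _).trans (min_le_left _ _))
  refine ⟨δ, hδ0, fun N l u hl hlδ hN hu => ?_⟩
  have hNδ : 1 ≤ δ * N := by
    have h1 : 1 ≤ (δ * N) ^ 2 := by
      refine hN.trans ?_
      rw [mul_pow, sq δ]
      gcongr
    exact (one_le_sq_iff₀ (by positivity)).1 h1
  have hN0 : (0 : ℝ) ≤ N := Nat.cast_nonneg N
  have hHN : (H : ℝ) ≤ N / 2 := by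
    have : (1 : ℝ) ≤ 1 / 2 / H * N := hNδ.trans (by gcongr)
    have h2 : 1 / 2 / (H : ℝ) * N = N / 2 / H := by ring
    rw [h2, le_div_iff₀ hH0] at this
    linarith
  have hHε' : 3 * (H : ℝ) ≤ ε / 2 * N := by
    have : (1 : ℝ) ≤ ε / 2 / (3 * H) * N := hNδ.trans (by gcongr)
    have h2 : ε / 2 / (3 * H) * N = ε / 2 * N / (3 * H) := by ring
    rw [h2, le_div_iff₀ (by positivity)] at this
    linarith
  -- The last `H` terms are set aside so that the shifted indices `n + h` stay in the range where
  -- the differences are controlled.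
  obtain ⟨M, rfl⟩ : ∃ M, N = M + H := by
    have : H ≤ N := by
      have : (H : ℝ) ≤ N := by linarith
      exact_mod_cast this
    exact ⟨N - H, by omega⟩
  have hM : ((M + H : ℕ) : ℝ) / 2 ≤ M := by
    push_cast at hHN ⊢
    linarith
  have hM0 : (0 : ℝ) ≤ M := Nat.cast_nonneg M
  have hcorr : ∀ h < H, ∀ h' < h, ‖∑ n ∈ Finset.range M,
      unitExp (u (n + h)) * (starRingEnd ℂ) (unitExp (u (n + h')))‖ ≤ ε ^ 2 / 32 * M := by
    intro h hh h' hh'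
    have h1 : ∀ n, unitExp (u (n + h)) * (starRingEnd ℂ) (unitExp (u (n + h'))) =
        unitExp (u (n + h) - u (n + h')) := by
      intro n
      rw [conj_unitExp, ← unitExp_add, sub_eq_add_neg]
    simp only [h1]
    have hd1 : (1 : ℝ) ≤ ((h - h' : ℕ) : ℝ) := by
      have : 1 ≤ h - h' := by omega
      exact_mod_cast this
    have hdH : ((h - h' : ℕ) : ℝ) ≤ H := by
      have : h - h' ≤ H := by omega
      exact_mod_cast this
    refine htest M (((h - h' : ℕ) : ℝ) * l) (fun n => u (n + h) - u (n + h')) (by positivity) ?_ ?_ ?_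
    · calc ((h - h' : ℕ) : ℝ) * l ≤ H * (δ' / H) := by
            gcongr
            exact hlδ.trans hδ1
        _ = δ' := by field_simp
    · calc (1 : ℝ) ≤ δ * l * ((M + H : ℕ) : ℝ) ^ 2 := hN
        _ = (4 * δ) * (1 * l) * (((M + H : ℕ) : ℝ) / 2) ^ 2 := by ring
        _ ≤ δ' * (((h - h' : ℕ) : ℝ) * l) * (M : ℝ) ^ 2 := by
            gcongr
            linarith
    · intro n hn
      rw [fwdDiff_iter_shift_sub u m h h' n hh'.le]
      have hb : ∀ i ∈ Finset.Ico h' h, l ≤ (fwdDiff 1)^[m + 1] u (n + i) ∧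
          (fwdDiff 1)^[m + 1] u (n + i) ≤ C * l := fun i hi =>
        hu (n + i) (by rw [Finset.mem_Ico] at hi; omega)
      constructor
      · have := Finset.card_nsmul_le_sum _ _ _ fun i hi => (hb i hi).1
        rwa [Nat.card_Ico, nsmul_eq_mul] at this
      · have := Finset.sum_le_card_nsmul _ _ _ fun i hi => (hb i hi).2
        rw [Nat.card_Ico, nsmul_eq_mul] at this
        linarith
  have hW := norm_sum_le_of_correlations (fun n => unitExp (u n)) (fun n => norm_unitExp _) M H
    (by exact_mod_cast hH0) hcorr (by positivity)
  have hsqrt : √(1 / H + ε ^ 2 / 32) ≤ ε / 2 := by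
    rw [Real.sqrt_le_left (by positivity)]
    nlinarith
  rw [Finset.sum_range_add]
  have htail : ‖∑ n ∈ Finset.range H, unitExp (u (M + n))‖ ≤ H := by
    refine (norm_sum_le _ _).trans ?_
    simp [norm_unitExp]
  have hs2 : √(1 / H + ε ^ 2 / 32) * M ≤ ε / 2 * (M + H : ℕ) := by
    push_cast
    exact mul_le_mul hsqrt (by linarith) hM0 (by positivity)
  refine (norm_add_le _ _).trans ?_
  linarith

lemma hasDifferenceTest (m : ℕ) (hm : 2 ≤ m) : HasDifferenceTest m := by
  induction m, hm using Nat.le_induction with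
  | base => exact hasDifferenceTest_two
  | succ m _ ih => exact ih.succ

/-! ### Cancellation in sums of `n ^ (it)`. -/

/-- An iterated mean value theorem: unit differences of a chain of derivatives form again such a
chain, shorter by one, and the mean value theorem transfers the bounds on the top derivative. -/
lemma fwdDiff_iter_mem_Icc_of_hasDerivAt (m : ℕ) (F : ℕ → ℝ → ℝ) (a lo hi : ℝ)
    (hF : ∀ i < m, ∀ x ∈ Set.Icc a (a + m), HasDerivAt (F i) (F (i + 1) x) x)
    (hb : ∀ x ∈ Set.Icc a (a + m), F m x ∈ Set.Icc lo hi) :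
    (fwdDiff 1)^[m] (F 0) a ∈ Set.Icc lo hi := by
  induction m generalizing F with
  | zero => exact hb a (by simp)
  | succ m ih =>
    rw [Function.iterate_succ, Function.comp]
    have hmem : ∀ x ∈ Set.Icc a (a + m), ∀ y ∈ Set.Icc x (x + 1),
        y ∈ Set.Icc a (a + (m + 1 : ℕ)) := by
      intro x hx y hy
      push_cast
      exact ⟨hx.1.trans hy.1, by linarith [hy.2, hx.2]⟩
    refine ih (fun i x => F i (x + 1) - F i x) ?_ ?_
    · intro i him x hx
      have h1 := hF i (by omega) x (hmem x hx x ⟨le_rfl, by linarith⟩)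
      have h2 := hF i (by omega) (x + 1) (hmem x hx (x + 1) ⟨by linarith, le_rfl⟩)
      exact (h2.comp_add_const x 1).sub h1
    · intro x hx
      have hd : ∀ y ∈ Set.Icc x (x + 1), HasDerivAt (F m) (F (m + 1) y) y := fun y hy =>
        hF m (by omega) y (hmem x hx y hy)
      obtain ⟨y, hy, hslope⟩ := exists_hasDerivAt_eq_slope (F m) (F (m + 1)) (lt_add_one x)
        (fun y hy => (hd y hy).continuousAt.continuousWithinAt)
        (fun y hy => hd y (Set.Ioo_subset_Icc_self hy))
      have h1 := hb y (hmem x hx y (Set.Ioo_subset_Icc_self hy))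
      rw [hslope, add_sub_cancel_left, div_one] at h1
      exact h1

lemma fwdDiff_iter_comp_natCast (g : ℝ → ℝ) (b : ℝ) (m n : ℕ) :
    (fwdDiff 1)^[m] (fun j : ℕ => g (b + j)) n = (fwdDiff 1)^[m] g (b + n) := by
  induction m generalizing n with
  | zero => rfl
  | succ m ih =>
    rw [Function.iterate_succ', Function.iterate_succ', Function.comp, Function.comp]
    simp only [fwdDiff, ih]
    push_cast
    rw [add_assoc]

/-- The sequence consisting of `c * log` and its iterated derivatives. -/
noncomputable def logDerivs (c : ℝ) : ℕ → ℝ → ℝ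
  | 0 => fun y => c * Real.log y
  | i + 1 => fun y => c * ((-1) ^ i * (i.factorial : ℝ) / y ^ (i + 1))

lemma hasDerivAt_logDerivs (c : ℝ) (i : ℕ) {y : ℝ} (hy : 0 < y) :
    HasDerivAt (logDerivs c i) (logDerivs c (i + 1) y) y := by
  cases i with
  | zero =>
    have := (Real.hasDerivAt_log hy.ne').const_mul c
    simpa [logDerivs] using this
  | succ i =>
    have h1 := (((hasDerivAt_pow (i + 1) y).inv (pow_ne_zero _ hy.ne')).const_mul
      (c * ((-1) ^ i * (i.factorial : ℝ))))
    have h2 : logDerivs c (i + 1) = fun y => c * ((-1) ^ i * (i.factorial : ℝ)) *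
        (fun y : ℝ => y ^ (i + 1))⁻¹ y := by
      funext y
      simp only [logDerivs, Pi.inv_apply]
      ring
    rw [h2]
    convert! h1 using 1
    simp only [logDerivs, Nat.factorial_succ]
    push_cast
    field_simp
    ring

/-- Cancellation in `∑ (n + β) ^ (i t)` when `t` lies in the range of the `m`-th derivative test. -/
lemma exists_norm_sum_unitExp_log_le_of_range (m : ℕ) (hm : 2 ≤ m) {ε : ℝ} (hε : 0 < ε) :
    ∃ K : ℝ, 1 ≤ K ∧ ∀ (M : ℕ) (β t : ℝ), β ∈ Set.Icc (0 : ℝ) 1 →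
      K * (M : ℝ) ^ (m - 2) ≤ t → K * t ≤ (M : ℝ) ^ m →
      ‖∑ n ∈ Finset.range M, unitExp (t * Real.log (n + β))‖ ≤ ε * M := by
  -- The first `η M` terms are estimated trivially. On the rest the argument lies between `η M` and
  -- `2M`, so the `m`-th derivative of the logarithm varies at most by the factor `(2 / η) ^ m`.
  set η : ℝ := min (ε / 4) (1 / 2) with hη
  have hη0 : 0 < η := by positivity
  obtain ⟨δ, hδ, htest⟩ := hasDifferenceTest m hm ((2 / η) ^ m) (ε / 2) (by positivity)
    (by positivity)
  -- `4 / ε` pays for rounding up `η M`; `m + 4` keeps arguments below `2M` and leaves at least `M /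
  -- 4` terms; the last two entries yield the conditions `l ≤ δ` and `1 ≤ δ l N²`.
  set K : ℝ := max (max (4 / ε) (m + 4)) (max ((m - 1).factorial / δ) (16 * 2 ^ m / δ)) with hK
  have hK1 : 4 / ε ≤ K := (le_max_left _ _).trans (le_max_left _ _)
  have hK2 : (m + 4 : ℝ) ≤ K := (le_max_right _ _).trans (le_max_left _ _)
  have hK3 : (m - 1).factorial / δ ≤ K := (le_max_left _ _).trans (le_max_right _ _)
  have hK4 : 16 * 2 ^ m / δ ≤ K := (le_max_right _ _).trans (le_max_right _ _)
  have hm0 : (0 : ℝ) ≤ m := Nat.cast_nonneg m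
  refine ⟨K, by linarith, fun M β t hβ hlo hhi => ?_⟩
  have hK0 : 0 < K := by linarith
  rcases Nat.eq_zero_or_pos M with rfl | hMpos
  · simp
  have hMp : (0 : ℝ) < M := by exact_mod_cast hMpos
  have hM2 : (M : ℝ) ^ m = (M : ℝ) ^ (m - 2) * (M : ℝ) ^ 2 := by
    rw [← pow_add]
    congr 1
    omega
  have hKM : K ≤ M := by
    have h1 : K * (K * (M : ℝ) ^ (m - 2)) ≤ (M : ℝ) ^ (m - 2) * (M : ℝ) ^ 2 := by
      rw [← hM2]
      exact (mul_le_mul_of_nonneg_left hlo hK0.le).trans hhi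
    have h2 : K ^ 2 ≤ (M : ℝ) ^ 2 := by
      have h3 : 0 < (M : ℝ) ^ (m - 2) := by positivity
      by_contra h
      push Not at h
      nlinarith
    exact (pow_le_pow_iff_left₀ hK0.le hMp.le (by norm_num)).1 h2
  have ht0 : 0 < t := lt_of_lt_of_le (by positivity) hlo
  have hM1 : 1 ≤ ε / 4 * M := by
    have := hK1.trans hKM
    rw [div_le_iff₀ hε] at this
    linarith
  have hM4 : (m + 4 : ℝ) ≤ M := hK2.trans hKM
  set m0 : ℕ := ⌈η * M⌉₊ with hm0def
  have hm0lo : η * M ≤ m0 := Nat.le_ceil _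
  have hm0hi : (m0 : ℝ) < η * M + 1 := Nat.ceil_lt_add_one (by positivity)
  have hηM1 : η * M ≤ ε / 4 * M := by gcongr; exact min_le_left _ _
  have hηM2 : η * M ≤ 1 / 2 * M := by gcongr; exact min_le_right _ _
  obtain ⟨N, hMN'⟩ : ∃ N, M = m0 + N := by
    have : m0 ≤ M := by
      have : (m0 : ℝ) ≤ M := by linarith
      exact_mod_cast this
    exact ⟨M - m0, by omega⟩
  have hMN : (M : ℝ) = m0 + N := by rw [hMN']; push_cast; ring
  have hN4 : (M : ℝ) / 4 ≤ N := by linarith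
  rw [hMN', Finset.sum_range_add, ← hMN']
  clear_value m0
  set R : ℝ := (M : ℝ)
  have hhead : ‖∑ n ∈ Finset.range m0, unitExp (t * Real.log (n + β))‖ ≤ ε / 2 * R := by
    refine (norm_sum_le _ _).trans ?_
    simp only [norm_unitExp, Finset.sum_const, Finset.card_range, nsmul_eq_mul, mul_one]
    linarith
  set b : ℝ := m0 + β with hb
  have hbpos : 0 < b := by
    have : 0 < η * R := by positivity
    linarith [hβ.1]
  -- This sign makes the `m`-th derivative of `s t log` positive; complex conjugation removes it at
  -- the end.
  set s : ℝ := (-1) ^ (m + 1) with hs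
  have hss : s * s = 1 := by
    rw [hs, ← pow_add, ← two_mul, pow_mul]
    norm_num
  set u : ℕ → ℝ := fun n => logDerivs (s * t) 0 (b + n) with hu
  set l : ℝ := t * (m - 1).factorial / (2 * R) ^ m with hl
  have hl0 : 0 < l := by positivity
  have hu2 : ∀ n : ℕ, unitExp (t * Real.log (((m0 + n : ℕ) : ℝ) + β)) = unitExp (s * u n) := by
    intro n
    congr 1
    simp only [hu, logDerivs, hb]
    push_cast
    rw [← mul_assoc, ← mul_assoc, hss, one_mul, add_right_comm]
  have hsum : ‖∑ n ∈ Finset.range N, unitExp (u n)‖ ≤ ε / 2 * N := by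
    refine htest N l u hl0 ?_ ?_ ?_
    · rw [hl, div_le_iff₀ (by positivity)]
      rw [div_le_iff₀ hδ] at hK3
      have h2m : (1 : ℝ) ≤ 2 ^ m := one_le_pow₀ (by norm_num)
      calc t * (m - 1).factorial ≤ t * (K * δ) := by gcongr
        _ = δ * (1 * (K * t)) := by ring
        _ ≤ δ * (2 ^ m * R ^ m) := by gcongr
        _ = δ * (2 * R) ^ m := by rw [mul_pow]
    · have hfac : (1 : ℝ) ≤ (m - 1).factorial := by exact_mod_cast Nat.factorial_pos _
      rw [div_le_iff₀ hδ] at hK4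
      have h1 : 16 * (2 * R) ^ m ≤ δ * (t * (m - 1).factorial) * R ^ 2 := by
        calc 16 * (2 * R) ^ m = (16 * 2 ^ m) * (R ^ (m - 2) * R ^ 2) := by rw [mul_pow, hM2]; ring
          _ ≤ (K * δ) * (R ^ (m - 2) * R ^ 2) := by gcongr
          _ = δ * (K * R ^ (m - 2) * 1) * R ^ 2 := by ring
          _ ≤ δ * (t * (m - 1).factorial) * R ^ 2 := by gcongr
      calc (1 : ℝ) = 16 * (2 * R) ^ m / (16 * (2 * R) ^ m) := by field_simp
        _ ≤ δ * (t * (m - 1).factorial) * R ^ 2 / (16 * (2 * R) ^ m) := by gcongr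
        _ = δ * l * (R / 4) ^ 2 := by rw [hl]; field_simp; norm_num
        _ ≤ δ * l * (N : ℝ) ^ 2 := by gcongr
    · intro n hn
      rw [hu, fwdDiff_iter_comp_natCast (logDerivs (s * t) 0) b m n]
      have hnN : (n : ℝ) + 1 ≤ N := by exact_mod_cast hn
      have hn0 : (0 : ℝ) ≤ n := Nat.cast_nonneg n
      have hpos : ∀ x ∈ Set.Icc (b + n) (b + n + m), 0 < x := fun x hx => by
        linarith [hx.1]
      refine fwdDiff_iter_mem_Icc_of_hasDerivAt m (logDerivs (s * t)) (b + n) l _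
        (fun i _ x hx => hasDerivAt_logDerivs _ _ (hpos x hx)) ?_
      intro x hx
      have hx0 := hpos x hx
      have hx1 : η * R ≤ x := by linarith [hx.1, hβ.1]
      have hx2 : x ≤ 2 * R := by linarith [hx.2, hβ.2]
      have hval : logDerivs (s * t) m x = t * (m - 1).factorial / x ^ m := by
        obtain ⟨j, rfl⟩ : ∃ j, m = j + 1 := ⟨m - 1, by omega⟩
        simp only [logDerivs, Nat.add_sub_cancel, hs]
        have : ((-1 : ℝ) ^ (j + 1 + 1)) * (-1) ^ j = 1 := by
          rw [← pow_add, show j + 1 + 1 + j = 2 * (j + 1) by ring, pow_mul]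
          norm_num
        calc (-1 : ℝ) ^ (j + 1 + 1) * t * ((-1) ^ j * (j.factorial : ℝ) / x ^ (j + 1))
            = ((-1 : ℝ) ^ (j + 1 + 1) * (-1) ^ j) * (t * (j.factorial : ℝ) / x ^ (j + 1)) := by ring
          _ = _ := by rw [this, one_mul]
      rw [hval]
      constructor
      · rw [hl]
        gcongr
      · have : (2 / η) ^ m * l = t * (m - 1).factorial / (η * R) ^ m := by
          rw [hl, mul_pow, mul_pow, div_pow]
          field_simp
        rw [this]
        gcongr
  have htail : ‖∑ n ∈ Finset.range N, unitExp (t * Real.log (((m0 + n : ℕ) : ℝ) + β))‖ ≤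
      ε / 2 * N := by
    simp only [hu2]
    rcases neg_one_pow_eq_or ℝ (m + 1) with h | h
    · rw [hs, h]
      simpa using hsum
    · rw [hs, h]
      simp only [neg_mul, one_mul, ← conj_unitExp]
      rw [← map_sum, RCLike.norm_conj]
      exact hsum
  refine (norm_add_le _ _).trans ?_
  have : ε / 2 * N ≤ ε / 2 * R := by
    gcongr
    linarith [(Nat.cast_nonneg m0 : (0 : ℝ) ≤ m0)]
  linarith

/-- Cancellation in `∑ (n + β) ^ (i t)`, uniformly for `t` up to a power of the length. -/
lemma exists_norm_sum_unitExp_log_le (A : ℕ) {ε : ℝ} (hε : 0 < ε) :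
    ∃ K : ℝ, 1 ≤ K ∧ ∀ (M : ℕ) (β t : ℝ), β ∈ Set.Icc (0 : ℝ) 1 → K ≤ M → K ≤ t →
      t ≤ (M : ℝ) ^ A →
      ‖∑ n ∈ Finset.range M, unitExp (t * Real.log (n + β))‖ ≤ ε * M := by
  have hex : ∀ m : ℕ, ∃ K : ℝ, 1 ≤ K ∧ (2 ≤ m → ∀ (M : ℕ) (β t : ℝ), β ∈ Set.Icc (0 : ℝ) 1 →
      K * (M : ℝ) ^ (m - 2) ≤ t → K * t ≤ (M : ℝ) ^ m →
      ‖∑ n ∈ Finset.range M, unitExp (t * Real.log (n + β))‖ ≤ ε * M) := by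
    intro m
    by_cases hm : 2 ≤ m
    · obtain ⟨K, hK, h⟩ := exists_norm_sum_unitExp_log_le_of_range m hm hε
      exact ⟨K, hK, fun _ => h⟩
    · exact ⟨1, le_rfl, fun h => absurd h hm⟩
  choose K hK1 hK using hex
  set L : ℝ := ∑ m ∈ Finset.range (A + 3), K m with hL
  have hKL : ∀ m < A + 3, K m ≤ L := fun m hm =>
    Finset.single_le_sum (f := K) (fun i _ => zero_le_one.trans (hK1 i)) (Finset.mem_range.2 hm)
  have hL1 : 1 ≤ L := (hK1 0).trans (hKL 0 (by omega))
  have hL2 : L ≤ L ^ 2 := by nlinarith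
  refine ⟨L ^ 2, by nlinarith, fun M β t hβ hM ht htA => ?_⟩
  have hM0 : 0 < (M : ℝ) := by nlinarith
  have ht0 : 0 < t := by nlinarith
  -- Descent to the least admissible order. If `L t ≤ M ^ m` fails, then `M ≥ L²` gives `L M ^ (m -
  -- 1) < t`, which is the lower bound needed for order `m + 1`; at order `2` the lower bound is
  -- just `t ≥ K 2`.
  have key : ∀ m, 2 ≤ m → m < A + 3 → L * t ≤ (M : ℝ) ^ m →
      ‖∑ n ∈ Finset.range M, unitExp (t * Real.log (n + β))‖ ≤ ε * M := by
    intro m hm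
    induction m, hm using Nat.le_induction with
    | base =>
      intro hmA hmt
      refine hK 2 le_rfl M β t hβ ?_ ?_
      · simp only [le_refl, Nat.sub_eq_zero_of_le, pow_zero, mul_one]
        linarith [hKL 2 hmA]
      · exact (mul_le_mul_of_nonneg_right (hKL 2 hmA) ht0.le).trans hmt
    | succ m hm ih =>
      intro hmA hmt
      by_cases h : L * t ≤ (M : ℝ) ^ m
      · exact ih (by omega) h
      · push Not at h
        refine hK (m + 1) (by omega) M β t hβ ?_ ?_
        · have h1 : (M : ℝ) ^ m = (M : ℝ) ^ (m + 1 - 2) * M := by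
            rw [← pow_succ]
            congr 1
            omega
          have h2 : L * (L * (M : ℝ) ^ (m + 1 - 2)) < L * t := by
            refine lt_of_le_of_lt ?_ h
            rw [h1, ← mul_assoc, ← sq, mul_comm]
            gcongr
          have h3 : L * (M : ℝ) ^ (m + 1 - 2) < t := lt_of_mul_lt_mul_left h2 (by linarith)
          refine le_trans ?_ h3.le
          gcongr
          exact hKL _ hmA
        · exact (mul_le_mul_of_nonneg_right (hKL _ hmA) ht0.le).trans hmt
  refine key (A + 2) (by omega) (by omega) ?_
  calc L * t ≤ M * (M : ℝ) ^ A := by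
        gcongr
        linarith
    _ = (M : ℝ) ^ (A + 1) := by ring
    _ ≤ (M : ℝ) ^ (A + 2) := pow_le_pow_right₀ (by linarith) (by omega)

lemma Finset.sum_range_mul {E : Type*} [AddCommMonoid E] (g : ℕ → E) (k M : ℕ) :
    ∑ n ∈ Finset.range (k * M), g n =
      ∑ a ∈ Finset.range k, ∑ m ∈ Finset.range M, g (k * m + a) := by
  rw [Finset.sum_comm]
  induction M with
  | zero => simp
  | succ M ih => rw [Nat.mul_succ, Finset.sum_range_add, ih, Finset.sum_range_succ]

/-- Cancellation in `∑ n ^ (i t)` over `n < X` coprime to `k`. -/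
lemma exists_norm_sum_coprime_unitExp_log_le {k : ℕ} (hk : 1 ≤ k) (A : ℕ) {ε : ℝ} (hε : 0 < ε) :
    ∃ K : ℝ, ∀ (X : ℕ) (t : ℝ), K ≤ X → K ≤ t → t ≤ (X : ℝ) ^ A →
      ‖∑ n ∈ Finset.range X with n.Coprime k, unitExp (t * Real.log n)‖ ≤ ε * X := by
  have hk0 : (0 : ℝ) < k := by exact_mod_cast hk
  -- The extra power of `M` absorbs the factor `(2k) ^ A` lost in passing from `X` to `M = X / k`.
  obtain ⟨L, hL1, hL⟩ := exists_norm_sum_unitExp_log_le (A + 1) (ε := ε / 2) (by positivity)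
  set K : ℝ := max (max L (k * (L + 1))) (max (k * ((2 * k) ^ A + 1)) (2 * k / ε)) with hK
  have hK1 : L ≤ K := (le_max_left _ _).trans (le_max_left _ _)
  have hK2 : k * (L + 1) ≤ K := (le_max_right _ _).trans (le_max_left _ _)
  have hK3 : k * ((2 * (k : ℝ)) ^ A + 1) ≤ K := (le_max_left _ _).trans (le_max_right _ _)
  have hK4 : 2 * k / ε ≤ K := (le_max_right _ _).trans (le_max_right _ _)
  refine ⟨K, fun X t hX ht htA => ?_⟩
  set M := X / k with hM
  have hdiv := Nat.div_add_mod X k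
  have hmod := Nat.mod_lt X (show k > 0 by omega)
  rw [← hM] at hdiv
  set r := X % k
  have hXk : (X : ℝ) ≤ k * (M + 1) := by
    have : X ≤ k * (M + 1) := by rw [mul_add]; omega
    exact_mod_cast this
  have hMX : (k : ℝ) * M ≤ X := by
    have : k * M ≤ X := by omega
    exact_mod_cast this
  have hML : L ≤ M := by
    have := hK2.trans (hX.trans hXk)
    have := le_of_mul_le_mul_left this hk0
    linarith
  have hMA : (2 * (k : ℝ)) ^ A ≤ M := by
    have := hK3.trans (hX.trans hXk)
    have := le_of_mul_le_mul_left this hk0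
    linarith
  have htM : t ≤ (M : ℝ) ^ (A + 1) := by
    calc t ≤ (X : ℝ) ^ A := htA
      _ ≤ (2 * k * M) ^ A := by
          gcongr
          have : (k : ℝ) * 1 ≤ k * M := by gcongr; linarith
          linarith
      _ = (2 * (k : ℝ)) ^ A * (M : ℝ) ^ A := by rw [mul_pow]
      _ ≤ M * (M : ℝ) ^ A := by gcongr
      _ = (M : ℝ) ^ (A + 1) := by ring
  -- Splitting into residue classes: `log (k m + a) = log k + log (m + a / k)`, so each class is a
  -- shifted sum times a constant of modulus `1`.
  rw [Finset.sum_filter, ← hdiv, Finset.sum_range_add, Finset.sum_range_mul]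
  have hres : ∀ a ∈ Finset.range k, ‖∑ m ∈ Finset.range M, (if (k * m + a).Coprime k then
      unitExp (t * Real.log ((k * m + a : ℕ) : ℝ)) else 0)‖ ≤ ε / 2 * M := by
    intro a ha
    rw [Finset.mem_range] at ha
    have hcop : ∀ m, (k * m + a).Coprime k ↔ a.Coprime k := by
      intro m
      simp
    simp only [hcop]
    by_cases hac : a.Coprime k
    · simp only [if_pos hac]
      have hlog : ∀ m : ℕ, unitExp (t * Real.log ((k * m + a : ℕ) : ℝ)) =
          unitExp (t * Real.log k) * unitExp (t * Real.log (m + (a : ℝ) / k)) := by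
        intro m
        rw [← unitExp_add, ← mul_add]
        congr 2
        have h1 : ((k * m + a : ℕ) : ℝ) = k * (m + (a : ℝ) / k) := by
          push_cast
          field_simp
        rw [h1]
        -- For `a = 0` the term `m = 0` involves `log 0`, but then coprimality forces `k = 1`.
        rcases eq_or_ne a 0 with rfl | ha0
        · obtain rfl : k = 1 := by simpa using hac
          simp
        · have : 0 < a := Nat.pos_of_ne_zero ha0
          rw [Real.log_mul hk0.ne' (by positivity)]
      simp only [hlog]
      rw [← Finset.mul_sum, norm_mul, norm_unitExp, one_mul]
      refine hL M (a / k) t ⟨by positivity, ?_⟩ hML (hK1.trans ht) htM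
      rw [div_le_one hk0]
      exact_mod_cast ha.le
    · simp only [if_neg hac, Finset.sum_const_zero, norm_zero]
      positivity
  have htail : ‖∑ n ∈ Finset.range r, (if (k * M + n).Coprime k then
      unitExp (t * Real.log ((k * M + n : ℕ) : ℝ)) else 0)‖ ≤ k := by
    have h1 : ∀ n ∈ Finset.range r, ‖(if (k * M + n).Coprime k then
      unitExp (t * Real.log ((k * M + n : ℕ) : ℝ)) else 0)‖ ≤ 1 := by
      intro n _
      split_ifs
      · rw [norm_unitExp]
      · simp
    refine (norm_sum_le_of_le _ h1).trans ?_
    simp only [Finset.sum_const, Finset.card_range, nsmul_eq_mul, mul_one]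
    exact_mod_cast hmod.le
  have hmain := norm_sum_le_of_le _ hres
  rw [Finset.sum_const, Finset.card_range, nsmul_eq_mul] at hmain
  refine (norm_add_le _ _).trans ((add_le_add hmain htail).trans ?_)
  rw [hdiv]
  have h5 : (k : ℝ) ≤ ε / 2 * X := by
    have := hK4.trans hX
    rw [div_le_iff₀ hε] at this
    linarith
  have h6 : (k : ℝ) * (ε / 2 * M) ≤ ε / 2 * X := by
    calc (k : ℝ) * (ε / 2 * M) = ε / 2 * (k * M) := by ring
      _ ≤ _ := by gcongr
  linarith

/-! ### A central limit theorem for bounded arrays. -/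

/-- The factors are exchanged one at a time, all others having modulus at most `1`. -/
lemma norm_prod_sub_prod_le_sum {ι : Type*} (s : Finset ι) (a b : ι → ℂ)
    (ha : ∀ i ∈ s, ‖a i‖ ≤ 1) (hb : ∀ i ∈ s, ‖b i‖ ≤ 1) :
    ‖∏ i ∈ s, a i - ∏ i ∈ s, b i‖ ≤ ∑ i ∈ s, ‖a i - b i‖ := by
  classical
  induction s using Finset.induction_on with
  | empty => simp
  | insert i s his ih =>
    rw [Finset.prod_insert his, Finset.prod_insert his, Finset.sum_insert his]
    have h1 : a i * ∏ j ∈ s, a j - b i * ∏ j ∈ s, b j =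
        (a i - b i) * ∏ j ∈ s, a j + b i * (∏ j ∈ s, a j - ∏ j ∈ s, b j) := by ring
    have h2 : ‖∏ j ∈ s, a j‖ ≤ 1 := by
      rw [norm_prod]
      exact Finset.prod_le_one (fun _ _ => norm_nonneg _)
        fun j hj => ha j (Finset.mem_insert_of_mem hj)
    have h3 := hb i (Finset.mem_insert_self i s)
    have h4 := ih (fun j hj => ha j (Finset.mem_insert_of_mem hj))
      (fun j hj => hb j (Finset.mem_insert_of_mem hj))
    rw [h1]
    refine (norm_add_le _ _).trans (add_le_add ?_ ?_)
    · rw [norm_mul]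
      exact mul_le_of_le_one_right (norm_nonneg _) h2
    · rw [norm_mul]
      exact (mul_le_of_le_one_left (norm_nonneg _) h3).trans h4

/-- The characteristic function of a centered bounded variable is close to that of the Gaussian
with the same variance. -/
lemma norm_charFun_map_sub_gaussian_le {Ω : Type*} [MeasurableSpace Ω] (P : Measure Ω)
    [IsProbabilityMeasure P] {Y : Ω → ℝ} (hY : Measurable Y) {b : ℝ} (hb : ∀ ω, |Y ω| ≤ b)
    (hmean : ∫ ω, Y ω ∂P = 0) {x : ℝ} (hx : |x| * b ≤ 1) :
    ‖charFun (P.map Y) x - (Real.exp (-(x ^ 2 * (∫ ω, Y ω ^ 2 ∂P)) / 2) : ℝ)‖ ≤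
      (|x| ^ 3 * b + x ^ 4 * b ^ 2) * ∫ ω, Y ω ^ 2 ∂P := by
  have hb0 : 0 ≤ b := by
    obtain ⟨ω⟩ : Nonempty Ω := P.nonempty_of_neZero
    exact (abs_nonneg _).trans (hb ω)
  set v := ∫ ω, Y ω ^ 2 ∂P with hv
  have hY2 : ∀ ω, Y ω ^ 2 ≤ b ^ 2 := fun ω => by
    rw [← sq_abs]
    exact pow_le_pow_left₀ (abs_nonneg _) (hb ω) 2
  have hi1 : Integrable Y P := .of_bound hY.aestronglyMeasurable b (.of_forall hb)
  have hi2 : Integrable (fun ω => Y ω ^ 2) P :=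
    .of_bound (hY.pow_const 2).aestronglyMeasurable (b ^ 2) (.of_forall fun ω => by
      rw [Real.norm_of_nonneg (sq_nonneg _)]
      exact hY2 ω)
  have hv0 : 0 ≤ v := integral_nonneg fun ω => sq_nonneg _
  have hvb : v ≤ b ^ 2 := by
    have := integral_mono hi2 (integrable_const (b ^ 2)) hY2
    simpa using this
  have hie : Integrable (fun ω => Complex.exp (x * Y ω * Complex.I)) P := by
    refine .of_bound (by fun_prop) 1 (.of_forall fun ω => ?_)
    rw [← Complex.ofReal_mul, Complex.norm_exp_ofReal_mul_I]
  have hchar : charFun (P.map Y) x = ∫ ω, Complex.exp (x * Y ω * Complex.I) ∂P := by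
    rw [charFun_apply_real, integral_map hY.aemeasurable (by fun_prop)]
  -- Second order Taylor expansion; the cubic remainder is bounded through `|Y| ^ 3 ≤ b Y ^ 2`, so
  -- that it is proportional to the variance.
  have htaylor : ‖charFun (P.map Y) x - (1 - x ^ 2 * v / 2 : ℝ)‖ ≤ |x| ^ 3 * b * v := by
    have hj1 : Integrable (fun ω => (x : ℂ) * Complex.I * (Y ω : ℂ)) P := hi1.ofReal.const_mul _
    have hj2 : Integrable (fun ω => (-(x ^ 2 / 2 : ℝ) : ℂ) * ((Y ω ^ 2 : ℝ) : ℂ)) P :=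
      hi2.ofReal.const_mul _
    have hj12 : Integrable (fun ω => (1 : ℂ) + (x : ℂ) * Complex.I * (Y ω : ℂ)) P :=
      (integrable_const _).add hj1
    have hj : Integrable (fun ω => (1 : ℂ) + x * Complex.I * (Y ω : ℂ) + (-(x ^ 2 / 2 : ℝ) : ℂ) *
        ((Y ω ^ 2 : ℝ) : ℂ)) P := hj12.add hj2
    have hpoly : ∫ ω, ((1 : ℂ) + x * Complex.I * (Y ω : ℂ) + (-(x ^ 2 / 2 : ℝ) : ℂ) *
        ((Y ω ^ 2 : ℝ) : ℂ)) ∂P = (1 - x ^ 2 * v / 2 : ℝ) := by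
      rw [integral_add hj12 hj2, integral_add (integrable_const _) hj1,
        integral_const_mul, integral_const_mul, integral_complex_ofReal, integral_complex_ofReal,
        hmean, ← hv]
      simp
      ring
    rw [← hpoly, hchar, ← integral_sub hie hj, ← integral_const_mul]
    refine norm_integral_le_of_norm_le (hi2.const_mul _) (.of_forall fun ω => ?_)
    have hz : ‖(x : ℂ) * Y ω * Complex.I‖ = |x| * |Y ω| := by
      simp
    have hz1 : ‖(x : ℂ) * Y ω * Complex.I‖ ≤ 1 := by
      rw [hz]
      exact (mul_le_mul_of_nonneg_left (hb ω) (abs_nonneg x)).trans hx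
    have hexp := Complex.exp_bound hz1 (n := 3) (by norm_num)
    have hsum : ∑ m ∈ Finset.range 3, ((x : ℂ) * Y ω * Complex.I) ^ m / (m.factorial : ℂ) =
        (1 : ℂ) + x * Complex.I * (Y ω : ℂ) + (-(x ^ 2 / 2 : ℝ) : ℂ) * ((Y ω ^ 2 : ℝ) : ℂ) := by
      simp [Finset.sum_range_succ, Nat.factorial, mul_pow]
      ring
    rw [hsum, hz] at hexp
    refine hexp.trans ?_
    have h1 : ((Nat.succ 3 : ℕ) : ℝ) * (((Nat.factorial 3 : ℕ) : ℝ) * ((3 : ℕ) : ℝ))⁻¹ ≤ 1 := by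
      norm_num [Nat.factorial]
    have h2 : (|x| * |Y ω|) ^ 3 = |x| ^ 3 * |Y ω| * Y ω ^ 2 := by
      rw [← sq_abs (Y ω)]
      ring
    calc (|x| * |Y ω|) ^ 3 * (((Nat.succ 3 : ℕ) : ℝ) *
          (((Nat.factorial 3 : ℕ) : ℝ) * ((3 : ℕ) : ℝ))⁻¹)
        ≤ (|x| * |Y ω|) ^ 3 * 1 := by gcongr
      _ = |x| ^ 3 * |Y ω| * Y ω ^ 2 := by rw [mul_one, h2]
      _ ≤ |x| ^ 3 * b * Y ω ^ 2 := by
        gcongr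
        exact hb ω
  have hgauss : |(1 - x ^ 2 * v / 2) - Real.exp (-(x ^ 2 * v) / 2)| ≤ x ^ 4 * b ^ 2 * v := by
    have hy : |-(x ^ 2 * v) / 2| ≤ 1 := by
      rw [abs_div, abs_neg, abs_of_nonneg (by positivity), abs_two, div_le_one (by norm_num)]
      have : x ^ 2 * v ≤ (|x| * b) ^ 2 := by
        rw [mul_pow, sq_abs]
        gcongr
      have h2 : (|x| * b) ^ 2 ≤ 1 := pow_le_one₀ (by positivity) hx
      linarith
    have h := Real.abs_exp_sub_one_sub_id_le hy
    rw [abs_sub_comm]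
    have h1 : Real.exp (-(x ^ 2 * v) / 2) - (1 - x ^ 2 * v / 2) =
        Real.exp (-(x ^ 2 * v) / 2) - 1 - -(x ^ 2 * v) / 2 := by ring
    rw [h1]
    refine h.trans ?_
    have h3 : (-(x ^ 2 * v) / 2) ^ 2 = x ^ 4 * (v * v) / 4 := by ring
    have h4 : v * v ≤ b ^ 2 * v := by gcongr
    have h5 : x ^ 4 * (v * v) ≤ x ^ 4 * (b ^ 2 * v) := by gcongr
    have h6 : 0 ≤ x ^ 4 * (v * v) := by positivity
    rw [h3]
    linarith
  have hg : ‖((1 - x ^ 2 * v / 2 : ℝ) : ℂ) - (Real.exp (-(x ^ 2 * v) / 2) : ℝ)‖ ≤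
      x ^ 4 * b ^ 2 * v := by
    rw [← Complex.ofReal_sub, Complex.norm_real]
    exact hgauss
  calc ‖charFun (P.map Y) x - (Real.exp (-(x ^ 2 * v) / 2) : ℝ)‖
      ≤ ‖charFun (P.map Y) x - (1 - x ^ 2 * v / 2 : ℝ)‖ +
        ‖((1 - x ^ 2 * v / 2 : ℝ) : ℂ) - (Real.exp (-(x ^ 2 * v) / 2) : ℝ)‖ :=
        norm_sub_le_norm_sub_add_norm_sub _ _ _
    _ ≤ |x| ^ 3 * b * v + x ^ 4 * b ^ 2 * v := add_le_add htaylor hg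
    _ = _ := by ring

/-- The central limit theorem for arrays of uniformly small bounded independent variables. -/
theorem tendstoInDistribution_sum_of_bounded {Ω ι : Type*} [MeasurableSpace Ω] (P : Measure Ω)
    [IsProbabilityMeasure P] {l : Filter ι} [l.IsCountablyGenerated] (s : ι → Finset ℕ)
    (Y : ι → ℕ → Ω → ℝ) (hY : ∀ i j, Measurable (Y i j)) (hindep : ∀ i, iIndepFun (Y i) P)
    (hmean : ∀ i j, j ∈ s i → ∫ ω, Y i j ω ∂P = 0) (b : ι → ℝ)
    (hb : ∀ i j, j ∈ s i → ∀ ω, |Y i j ω| ≤ b i) (hb0 : Tendsto b l (𝓝 0))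
    (hvar : Tendsto (fun i => ∑ j ∈ s i, ∫ ω, Y i j ω ^ 2 ∂P) l (𝓝 1)) :
    TendstoInDistribution (fun i ω => ∑ j ∈ s i, Y i j ω) l (id : ℝ → ℝ) (fun _ => P)
      (gaussianReal 0 1) := by
  have hmeas : ∀ i, AEMeasurable (fun ω => ∑ j ∈ s i, Y i j ω) P := fun i =>
    (Finset.measurable_sum _ fun j _ => hY i j).aemeasurable
  refine ⟨hmeas, aemeasurable_id, ?_⟩
  -- Lévy's continuity theorem is applied along sequences, which suffice because `l` is countably
  -- generated.
  refine tendsto_of_seq_tendsto fun z hz => ?_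
  apply ProbabilityMeasure.tendsto_of_tendsto_charFun
  intro x
  suffices h : Tendsto (fun i => charFun (P.map (fun ω => ∑ j ∈ s i, Y i j ω)) x) l
      (𝓝 (charFun (gaussianReal 0 1) x)) by
    simpa [Function.comp_def] using! h.comp hz
  set V : ι → ℝ := fun i => ∑ j ∈ s i, ∫ ω, Y i j ω ^ 2 ∂P with hV
  have hgauss : charFun (gaussianReal 0 1) x = (Real.exp (-(x ^ 2 * 1) / 2) : ℝ) := by
    rw [charFun_gaussianReal]
    push_cast
    congr 1
    simp
    ring
  have hlim : Tendsto (fun i => ((Real.exp (-(x ^ 2 * V i) / 2) : ℝ) : ℂ)) l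
      (𝓝 (charFun (gaussianReal 0 1) x)) := by
    rw [hgauss]
    refine (Complex.continuous_ofReal.tendsto _).comp ((Real.continuous_exp.tendsto _).comp ?_)
    exact ((hvar.const_mul _).neg).div_const 2
  have hdiff : Tendsto (fun i => charFun (P.map (fun ω => ∑ j ∈ s i, Y i j ω)) x -
      ((Real.exp (-(x ^ 2 * V i) / 2) : ℝ) : ℂ)) l (𝓝 0) := by
    have hsmall : ∀ᶠ i in l, |x| * b i ≤ 1 := by
      have h1 : Tendsto (fun i => |x| * b i) l (𝓝 0) := by simpa using hb0.const_mul |x|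
      filter_upwards [h1.eventually (gt_mem_nhds (zero_lt_one' ℝ))] with i hi using hi.le
    have hbound : Tendsto (fun i => (|x| ^ 3 * b i + x ^ 4 * b i ^ 2) * V i) l (𝓝 0) := by
      have h1 := ((hb0.const_mul (|x| ^ 3)).add ((hb0.pow 2).const_mul (x ^ 4))).mul hvar
      simpa using h1
    refine squeeze_zero_norm' ?_ hbound
    filter_upwards [hsmall] with i hi
    rw [iIndepFun.charFun_map_fun_finsetSum_eq_prod (fun j _ => (hY i j).aemeasurable)
      ((hindep i).restrict _), Finset.prod_apply]
    have hexp : ((Real.exp (-(x ^ 2 * V i) / 2) : ℝ) : ℂ) =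
        ∏ j ∈ s i, ((Real.exp (-(x ^ 2 * ∫ ω, Y i j ω ^ 2 ∂P) / 2) : ℝ) : ℂ) := by
      rw [← Complex.ofReal_prod, ← Real.exp_sum]
      congr 2
      rw [hV, Finset.mul_sum, ← Finset.sum_neg_distrib, Finset.sum_div]
    rw [hexp]
    -- The errors of the factors are proportional to the individual variances, so they add up to
    -- `O(b i)` times the bounded total variance.
    refine (norm_prod_sub_prod_le_sum _ _ _ ?_ ?_).trans ?_
    · intro j _
      have : IsProbabilityMeasure (P.map (Y i j)) :=
        Measure.isProbabilityMeasure_map (hY i j).aemeasurable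
      exact norm_charFun_le_one x
    · intro j _
      rw [Complex.norm_real, Real.norm_of_nonneg (Real.exp_pos _).le, Real.exp_le_one_iff]
      have : 0 ≤ ∫ ω, Y i j ω ^ 2 ∂P := integral_nonneg fun ω => sq_nonneg _
      have : 0 ≤ x ^ 2 * ∫ ω, Y i j ω ^ 2 ∂P := by positivity
      linarith
    · rw [hV, Finset.mul_sum]
      exact Finset.sum_le_sum fun j hj =>
        norm_charFun_map_sub_gaussian_le P (hY i j) (hb i j hj) (hmean i j hj) hi
  simpa using hdiff.add hlim

/-! ### Mean values with respect to the weights `1 / log n`. -/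

lemma tendsto_log_natCast_atTop : Tendsto (fun n : ℕ => Real.log n) atTop atTop :=
  Real.tendsto_log_atTop.comp tendsto_natCast_atTop_atTop

lemma tendsto_log_div_self : Tendsto (fun x : ℝ => Real.log x / x) atTop (𝓝 0) :=
  Real.isLittleO_log_id_atTop.tendsto_div_nhds_zero

lemma one_le_log_of_three_le {n : ℕ} (hn : 3 ≤ n) : 1 ≤ Real.log n := by
  rw [Real.le_log_iff_exp_le (by positivity)]
  have h1 := Real.exp_one_lt_d9
  have h2 : (3 : ℝ) ≤ n := by exact_mod_cast hn
  linarith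

/-- The weights `1 / log n` are nearly constant on `[3, X]`, on average. -/
lemma tendsto_sum_inv_log_sub_inv_log :
    Tendsto (fun X : ℕ => (∑ n ∈ Finset.Icc 3 X, (1 / Real.log n - 1 / Real.log X)) *
      (Real.log X / X)) atTop (𝓝 0) := by
  have hG : Tendsto (fun L : ℝ => 1 / L + (1 / (1 - 2 * (Real.log L / L)) - 1)) atTop (𝓝 0) := by
    have h1 : Tendsto (fun L : ℝ => 1 / L) atTop (𝓝 0) := by
      simpa using tendsto_inv_atTop_zero (𝕜 := ℝ)
    have h2 : Tendsto (fun L : ℝ => 1 / (1 - 2 * (Real.log L / L)) - 1) atTop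
        (𝓝 (1 / (1 - 2 * 0) - 1)) :=
      ((tendsto_const_nhds (x := (1 : ℝ))).div
        ((tendsto_const_nhds (x := (1 : ℝ))).sub (tendsto_log_div_self.const_mul 2))
        (by norm_num)).sub_const 1
    simpa using h1.add h2
  refine squeeze_zero' (g := fun X : ℕ => 1 / Real.log X +
    (1 / (1 - 2 * (Real.log (Real.log X) / Real.log X)) - 1)) ?_ ?_
    (hG.comp tendsto_log_natCast_atTop)
  · filter_upwards [eventually_ge_atTop 3] with X hX
    have hX1 := one_le_log_of_three_le hX
    refine mul_nonneg (Finset.sum_nonneg fun n hn => ?_) (by positivity)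
    rw [Finset.mem_Icc] at hn
    have h1 := one_le_log_of_three_le hn.1
    rw [sub_nonneg]
    apply one_div_le_one_div_of_le (by linarith)
    apply Real.log_le_log
    · have : 0 < n := by omega
      exact_mod_cast this
    · exact_mod_cast hn.2
  · have hev : ∀ᶠ X : ℕ in atTop, Real.log (Real.log X) / Real.log X < 1 / 4 :=
      (tendsto_log_div_self.comp tendsto_log_natCast_atTop).eventually
        (gt_mem_nhds (by norm_num))
    filter_upwards [eventually_ge_atTop 3, hev] with X hX hX4
    set L := Real.log X with hL
    have hL1 : 1 ≤ L := one_le_log_of_three_le hX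
    have hX0 : (0 : ℝ) < X := by
      have : 0 < X := by omega
      exact_mod_cast this
    -- Below `y` the trivial bound gives `X / L²`, negligible against `X / L`; above `y`, `log n` is
    -- at least `log y = L - 2 log L`, hence close to `L`.
    set y : ℝ := X / L ^ 2 with hy
    have hy0 : 0 < y := by positivity
    have hlogy : Real.log y = L * (1 - 2 * (Real.log L / L)) := by
      rw [hy, Real.log_div hX0.ne' (by positivity), Real.log_pow]
      field_simp
      push_cast
      ring
    have hfac : 0 < 1 - 2 * (Real.log L / L) := by linarith
    have hlogL : 0 ≤ Real.log L / L := div_nonneg (Real.log_nonneg hL1) (by linarith)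
    have hlogy0 : 0 < Real.log y := by
      rw [hlogy]
      positivity
    have hlogyL : Real.log y ≤ L := by
      rw [hlogy]
      exact mul_le_of_le_one_right (by linarith) (by linarith)
    have hc0 : 0 ≤ 1 / Real.log y - 1 / L := by
      rw [sub_nonneg]
      exact one_div_le_one_div_of_le hlogy0 hlogyL
    have hterm : ∀ n ∈ Finset.Icc 3 X, 1 / Real.log n - 1 / L ≤
        (if n ∈ Finset.Icc 1 ⌊y⌋₊ then 1 else 0) + (1 / Real.log y - 1 / L) := by
      intro n hn
      rw [Finset.mem_Icc] at hn
      have h1 := one_le_log_of_three_le hn.1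
      split_ifs with h
      · have h2 : 1 / Real.log n ≤ 1 := by
          rw [div_le_one (by linarith)]
          exact h1
        have h3 : 0 ≤ 1 / Real.log y := by positivity
        linarith
      · rw [Finset.mem_Icc, not_and_or] at h
        have h2 : y ≤ n := by
          rcases h with h | h
          · omega
          · push Not at h
            exact (Nat.lt_of_floor_lt h).le
        have h3 : 1 / Real.log n ≤ 1 / Real.log y :=
          one_div_le_one_div_of_le hlogy0 (Real.log_le_log hy0 h2)
        linarith
    have hsum : ∑ n ∈ Finset.Icc 3 X, (1 / Real.log n - 1 / L) ≤
        y + X * (1 / Real.log y - 1 / L) := by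
      refine (Finset.sum_le_sum hterm).trans ?_
      rw [Finset.sum_add_distrib, Finset.sum_const, nsmul_eq_mul, Nat.card_Icc]
      apply add_le_add
      · rw [← Finset.sum_filter, Finset.sum_const, nsmul_eq_mul, mul_one]
        have h1 : (Finset.Icc 3 X).filter (fun n => n ∈ Finset.Icc 1 ⌊y⌋₊) ⊆ Finset.Icc 1 ⌊y⌋₊ :=
          fun n hn => (Finset.mem_filter.1 hn).2
        have h2 := Finset.card_le_card h1
        rw [Nat.card_Icc, Nat.add_sub_cancel] at h2
        calc (((Finset.Icc 3 X).filter (fun n => n ∈ Finset.Icc 1 ⌊y⌋₊)).card : ℝ) ≤ ⌊y⌋₊ := by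
              exact_mod_cast h2
          _ ≤ y := Nat.floor_le hy0.le
      · gcongr
        omega
    calc (∑ n ∈ Finset.Icc 3 X, (1 / Real.log n - 1 / L)) * (L / X)
        ≤ (y + X * (1 / Real.log y - 1 / L)) * (L / X) := by gcongr
      _ = 1 / L + (1 / (1 - 2 * (Real.log L / L)) - 1) := by
        rw [hlogy, hy]
        field_simp

/-- Bounded coefficients with mean value `κ` also have mean value `κ` with respect to the
weights `1 / log n`. -/
lemma tendsto_sum_div_log {ι : Type*} {l : Filter ι} {X : ι → ℕ} (hX : Tendsto X l atTop)
    (c : ι → ℕ → ℝ) (hc : ∀ i n, |c i n| ≤ 1) {κ : ℝ}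
    (h : Tendsto (fun i => (∑ n ∈ Finset.Icc 3 (X i), c i n) / X i) l (𝓝 κ)) :
    Tendsto (fun i => (∑ n ∈ Finset.Icc 3 (X i), c i n / Real.log n) *
      (Real.log (X i) / X i)) l (𝓝 κ) := by
  have hD := tendsto_sum_inv_log_sub_inv_log.comp hX
  have hdiff : Tendsto (fun i => (∑ n ∈ Finset.Icc 3 (X i), c i n / Real.log n) *
      (Real.log (X i) / X i) - (∑ n ∈ Finset.Icc 3 (X i), c i n) / X i) l (𝓝 0) := by
    refine squeeze_zero_norm' ?_ hD
    filter_upwards [hX.eventually_ge_atTop 3] with i hi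
    have hL1 := one_le_log_of_three_le hi
    have hX0 : (0 : ℝ) < X i := by
      have : 0 < X i := by omega
      exact_mod_cast this
    have heq : (∑ n ∈ Finset.Icc 3 (X i), c i n / Real.log n) *
        (Real.log (X i) / X i) - (∑ n ∈ Finset.Icc 3 (X i), c i n) / X i =
        (∑ n ∈ Finset.Icc 3 (X i), c i n * (1 / Real.log n - 1 / Real.log (X i))) *
          (Real.log (X i) / X i) := by
      simp only [mul_sub, Finset.sum_sub_distrib, mul_one_div, ← Finset.sum_div]
      field_simp
    rw [heq, norm_mul, Real.norm_of_nonneg (show 0 ≤ Real.log (X i) / X i by positivity)]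
    simp only [Function.comp]
    gcongr
    refine norm_sum_le_of_le _ fun n hn => ?_
    rw [Finset.mem_Icc] at hn
    have h1 := one_le_log_of_three_le hn.1
    have h2 : 0 ≤ 1 / Real.log n - 1 / Real.log (X i) := by
      rw [sub_nonneg]
      apply one_div_le_one_div_of_le (by linarith)
      apply Real.log_le_log
      · have : 0 < n := by omega
        exact_mod_cast this
      · exact_mod_cast hn.2
    rw [norm_mul, Real.norm_of_nonneg h2]
    exact mul_le_of_le_one_left h2 (hc i n)
  simpa using hdiff.add h

/-- Every complete block of `k` consecutive integers contains exactly `φ(k)` admissible ones, and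
the incomplete block has fewer than `k` elements. -/
lemma abs_card_coprime_sub_le {k : ℕ} (hk : 1 ≤ k) (X : ℕ) :
    |(((Finset.range X).filter fun n => n.Coprime k).card : ℝ) -
      (k.totient : ℝ) / k * X| ≤ k := by
  have hk0 : (0 : ℝ) < k := by exact_mod_cast hk
  have hdiv := Nat.div_add_mod X k
  have hmod := Nat.mod_lt X (show k > 0 by omega)
  set M := X / k
  set r := X % k
  have hcard : ((Finset.range X).filter fun n => n.Coprime k).card =
      k.totient * M + ((Finset.range r).filter fun n => (k * M + n).Coprime k).card := by
    rw [Finset.card_filter, ← hdiv, Finset.sum_range_add, Finset.sum_range_mul, Finset.card_filter]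
    congr 1
    have hcop : ∀ m a, (k * m + a).Coprime k ↔ a.Coprime k := by
      intro m a
      simp
    simp only [hcop, Finset.sum_const, Finset.card_range, smul_eq_mul]
    rw [← Finset.mul_sum, ← Finset.card_filter, mul_comm]
    congr 1
    rw [Nat.totient]
    congr 1
    ext a
    simp [Nat.coprime_comm]
  have h1 : ((Finset.range r).filter fun n => (k * M + n).Coprime k).card ≤ r := by
    refine (Finset.card_filter_le _ _).trans ?_
    simp
  set s := ((Finset.range r).filter fun n => (k * M + n).Coprime k).card
  have h2 : (s : ℝ) ≤ r := by exact_mod_cast h1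
  have h3 : (r : ℝ) ≤ k := by exact_mod_cast hmod.le
  have h4 : (X : ℝ) = k * M + r := by exact_mod_cast hdiv.symm
  have h5 : (k.totient : ℝ) / k ≤ 1 := by
    rw [div_le_one hk0]
    exact_mod_cast Nat.totient_le k
  have h6 : 0 ≤ (k.totient : ℝ) / k * r := by positivity
  have h7 : (k.totient : ℝ) / k * r ≤ r := mul_le_of_le_one_left (Nat.cast_nonneg r) h5
  rw [hcard, h4]
  push_cast
  have h8 : (k.totient : ℝ) * M + s - k.totient / k * (k * M + r) =
      s - (k.totient : ℝ) / k * r := by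
    field_simp
    ring
  rw [h8, abs_le]
  constructor <;> linarith [(Nat.cast_nonneg s : (0 : ℝ) ≤ s)]

lemma Finset.sum_Icc_three_eq {E : Type*} [AddCommGroup E] (g : ℕ → E) {X : ℕ} (hX : 2 ≤ X) :
    ∑ n ∈ Finset.Icc 3 X, g n = ∑ n ∈ Finset.range X, g n + g X - (g 0 + g 1 + g 2) := by
  have h : Finset.Icc 3 X = Finset.Ico 3 (X + 1) := by
    ext n
    simp
  rw [h, Finset.sum_Ico_eq_sub _ (by omega), Finset.sum_range_succ]
  simp [Finset.sum_range_succ]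

/-- Replacing `range X` by `Icc 3 X` does not affect mean values of bounded functions. -/
lemma tendsto_sum_Icc_three_div {ι : Type*} {l : Filter ι} {X : ι → ℕ} (hX : Tendsto X l atTop)
    (c : ι → ℕ → ℝ) (hc : ∀ i n, |c i n| ≤ 1) {κ : ℝ}
    (h : Tendsto (fun i => (∑ n ∈ Finset.range (X i), c i n) / X i) l (𝓝 κ)) :
    Tendsto (fun i => (∑ n ∈ Finset.Icc 3 (X i), c i n) / X i) l (𝓝 κ) := by
  have hX' : Tendsto (fun i => 4 / (X i : ℝ)) l (𝓝 0) :=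
    (tendsto_natCast_atTop_atTop.comp hX).const_div_atTop 4
  have hdiff : Tendsto (fun i => (∑ n ∈ Finset.Icc 3 (X i), c i n) / X i -
      (∑ n ∈ Finset.range (X i), c i n) / X i) l (𝓝 0) := by
    refine squeeze_zero_norm' ?_ hX'
    filter_upwards [hX.eventually_ge_atTop 3] with i hi
    rw [Finset.sum_Icc_three_eq _ (by omega), ← sub_div, norm_div, Real.norm_natCast]
    gcongr
    rw [Real.norm_eq_abs]
    have h0 := abs_le.1 (hc i 0)
    have h1 := abs_le.1 (hc i 1)
    have h2 := abs_le.1 (hc i 2)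
    have h3 := abs_le.1 (hc i (X i))
    rw [abs_le]
    constructor <;> linarith
  simpa using hdiff.add h

lemma tendsto_sum_coprime_indicator_div {k : ℕ} (hk : 1 ≤ k) :
    Tendsto (fun X : ℕ => (∑ n ∈ Finset.range X, if n.Coprime k then (1 : ℝ) else 0) / X) atTop
      (𝓝 ((k.totient : ℝ) / k)) := by
  have hX' : Tendsto (fun X : ℕ => (k : ℝ) / (X : ℝ)) atTop (𝓝 0) :=
    tendsto_natCast_atTop_atTop.const_div_atTop _
  rw [tendsto_iff_norm_sub_tendsto_zero]
  refine squeeze_zero' (.of_forall fun _ => norm_nonneg _) ?_ hX'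
  filter_upwards [eventually_gt_atTop 0] with X hX
  have hX0 : (0 : ℝ) < X := by exact_mod_cast hX
  have h := abs_card_coprime_sub_le hk X
  rw [← Finset.sum_filter, Finset.sum_const, nsmul_eq_mul, mul_one]
  have h1 : (((Finset.range X).filter fun n => n.Coprime k).card : ℝ) / X -
      (k.totient : ℝ) / k = ((((Finset.range X).filter fun n => n.Coprime k).card : ℝ) -
      (k.totient : ℝ) / k * X) / X := by
    field_simp
  rw [h1, norm_div, Real.norm_natCast, Real.norm_eq_abs]
  gcongr

/-! ### The joint limit and asymptotics at the cutoff `N log N`. -/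

instance (A : ℕ) : (jointLimit A).IsCountablyGenerated := by
  unfold jointLimit
  infer_instance

lemma tendsto_fst_jointLimit (A : ℕ) : Tendsto Prod.fst (jointLimit A) atTop :=
  tendsto_fst.mono_left inf_le_left

lemma tendsto_snd_jointLimit (A : ℕ) : Tendsto Prod.snd (jointLimit A) atTop :=
  tendsto_snd.mono_left inf_le_left

lemma eventually_snd_le_jointLimit (A : ℕ) :
    ∀ᶠ q : ℕ × ℝ in jointLimit A, q.2 ≤ (q.1 : ℝ) ^ A :=
  mem_inf_of_right (mem_principal_self _)

lemma tendsto_mul_log_atTop {c : ℝ} (hc : 0 < c) :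
    Tendsto (fun N : ℕ => c * (N * Real.log N)) atTop atTop :=
  (tendsto_natCast_atTop_atTop.atTop_mul_atTop₀ tendsto_log_natCast_atTop).const_mul_atTop hc

lemma tendsto_floor_mul_log_atTop {c : ℝ} (hc : 0 < c) :
    Tendsto (fun N : ℕ => ⌊c * (N * Real.log N)⌋₊) atTop atTop :=
  tendsto_nat_floor_atTop.comp (tendsto_mul_log_atTop hc)

lemma tendsto_floor_mul_log_div {c : ℝ} (hc : 0 < c) :
    Tendsto (fun N : ℕ => (⌊c * (N * Real.log N)⌋₊ : ℝ) / (N * Real.log N)) atTop (𝓝 c) := by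
  have h1 := (tendsto_nat_floor_div_atTop (R := ℝ)).comp (tendsto_mul_log_atTop hc)
  have h2 := h1.mul_const c
  rw [one_mul] at h2
  refine h2.congr' ?_
  filter_upwards [eventually_ge_atTop 3] with N hN
  have := one_le_log_of_three_le hN
  have : (0 : ℝ) < N := by
    have : 0 < N := by omega
    exact_mod_cast this
  simp only [Function.comp]
  field_simp

lemma tendsto_log_log_div_log :
    Tendsto (fun N : ℕ => Real.log (Real.log N) / Real.log N) atTop (𝓝 0) :=
  tendsto_log_div_self.comp tendsto_log_natCast_atTop

lemma tendsto_log_floor_mul_log_div_log {c : ℝ} (hc : 0 < c) :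
    Tendsto (fun N : ℕ => Real.log ⌊c * (N * Real.log N)⌋₊ / Real.log N) atTop (𝓝 1) := by
  have h1 := (Real.continuousAt_log hc.ne').tendsto.comp (tendsto_floor_mul_log_div hc)
  have h2 := h1.div_atTop tendsto_log_natCast_atTop
  have h3 := (h2.add tendsto_log_log_div_log).add (tendsto_const_nhds (x := (1 : ℝ)))
  rw [add_zero, zero_add] at h3
  refine h3.congr' ?_
  filter_upwards [eventually_ge_atTop 3, (tendsto_floor_mul_log_atTop hc).eventually_gt_atTop 0]
    with N hN hX
  have hL := one_le_log_of_three_le hN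
  have hN0 : (0 : ℝ) < N := by
    have : 0 < N := by omega
    exact_mod_cast this
  have hX0 : (0 : ℝ) < ⌊c * (N * Real.log N)⌋₊ := by exact_mod_cast hX
  have hL0 : (0 : ℝ) < Real.log N := by linarith
  simp only [Function.comp]
  rw [Real.log_div hX0.ne' (by positivity), Real.log_mul hN0.ne' hL0.ne']
  field_simp
  ring

lemma tendsto_floor_mul_log_div_mul_log {c : ℝ} (hc : 0 < c) :
    Tendsto (fun N : ℕ => (⌊c * (N * Real.log N)⌋₊ : ℝ) /
      (N * Real.log ⌊c * (N * Real.log N)⌋₊)) atTop (𝓝 c) := by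
  have h := (tendsto_floor_mul_log_div hc).div (tendsto_log_floor_mul_log_div_log hc) one_ne_zero
  rw [div_one] at h
  refine h.congr' ?_
  filter_upwards [eventually_ge_atTop 3] with N hN
  have hL := one_le_log_of_three_le hN
  simp only [Pi.div_apply]
  rw [div_div, mul_assoc, mul_div_cancel₀ _ (by linarith)]

/-- The sum of `1 / log n` up to `c N log N` is asymptotic to `c N`. -/
lemma tendsto_sum_inv_log_div {c : ℝ} (hc : 0 < c) :
    Tendsto (fun N : ℕ => (∑ n ∈ Finset.Icc 3 ⌊c * (N * Real.log N)⌋₊, 1 / Real.log n) / N)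
      atTop (𝓝 c) := by
  have hX := tendsto_floor_mul_log_atTop hc
  have h1 := tendsto_sum_div_log hX (fun _ _ => (1 : ℝ)) (fun _ _ => by simp) (κ := 1)
    (tendsto_sum_Icc_three_div hX _ (fun _ _ => by simp) (by
      refine tendsto_const_nhds.congr' ?_
      filter_upwards [hX.eventually_gt_atTop 0] with N hN
      have : (⌊c * (N * Real.log N)⌋₊ : ℝ) ≠ 0 := by exact_mod_cast hN.ne'
      simp [this]))
  have h2 := h1.mul (tendsto_floor_mul_log_div_mul_log hc)
  rw [one_mul] at h2
  refine h2.congr' ?_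
  filter_upwards [hX.eventually_ge_atTop 3] with N hN
  have hL := one_le_log_of_three_le hN
  have hX0 : (⌊c * (N * Real.log N)⌋₊ : ℝ) ≠ 0 := by
    have : ⌊c * (N * Real.log N)⌋₊ ≠ 0 := by omega
    exact_mod_cast this
  have hL0 : Real.log ⌊c * (N * Real.log N)⌋₊ ≠ 0 := by linarith
  generalize ⌊c * ((N : ℝ) * Real.log N)⌋₊ = X at hX0 hL0 ⊢
  field_simp

/-! ### Asymptotics of the variance. -/

/-- This is where `t → ∞` and `t ≤ N ^ A` are used: `cos (2t log n)` is the real part of `n ^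
(2it)`, which is `unitExp` with frequency `t / π`. -/
lemma tendsto_sum_coprime_cos_div {k : ℕ} (hk : 1 ≤ k) (A : ℕ) {X : ℕ × ℝ → ℕ}
    (hX : ∀ᶠ q in jointLimit A, q.1 ≤ X q) :
    Tendsto (fun q : ℕ × ℝ => (∑ n ∈ Finset.range (X q),
      if n.Coprime k then Real.cos (2 * (q.2 * Real.log n)) else 0) / X q)
      (jointLimit A) (𝓝 0) := by
  rw [Metric.tendsto_nhds]
  intro ε hε
  obtain ⟨K, hK⟩ := exists_norm_sum_coprime_unitExp_log_le hk A (ε := ε / 2) (by positivity)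
  filter_upwards [hX, (tendsto_fst_jointLimit A).eventually_ge_atTop ⌈max K 1⌉₊,
    (tendsto_snd_jointLimit A).eventually_ge_atTop (max (K * Real.pi) 0),
    eventually_snd_le_jointLimit A] with q hqX hqN hqt hqA
  have hpi := Real.pi_pos
  have hN : max K 1 ≤ (q.1 : ℝ) := (Nat.le_ceil _).trans (by exact_mod_cast hqN)
  have hNX : (q.1 : ℝ) ≤ X q := by exact_mod_cast hqX
  have hX0 : (0 : ℝ) < X q := by linarith [le_max_right K 1]
  have ht0 : 0 ≤ q.2 := (le_max_right _ _).trans hqt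
  have h := hK (X q) (q.2 / Real.pi) (((le_max_left _ _).trans hN).trans hNX)
    (by rw [le_div_iff₀ hpi]; exact (le_max_left _ _).trans hqt) (by
      calc q.2 / Real.pi ≤ q.2 := div_le_self ht0 (by linarith [Real.pi_gt_three])
        _ ≤ (q.1 : ℝ) ^ A := hqA
        _ ≤ (X q : ℝ) ^ A := by gcongr)
  have hre : (∑ n ∈ Finset.range (X q),
      if n.Coprime k then Real.cos (2 * (q.2 * Real.log n)) else 0) =
      (∑ n ∈ Finset.range (X q) with n.Coprime k,
        unitExp (q.2 / Real.pi * Real.log n)).re := by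
    rw [Complex.re_sum, Finset.sum_filter]
    refine Finset.sum_congr rfl fun n _ => ?_
    congr 1
    rw [unitExp, Complex.exp_ofReal_mul_I_re]
    congr 1
    field_simp
  rw [dist_zero_right, norm_div, Real.norm_natCast, div_lt_iff₀ hX0, hre, Real.norm_eq_abs]
  calc _ ≤ _ := Complex.abs_re_le_norm _
    _ ≤ ε / 2 * X q := h
    _ < ε * X q := by gcongr; linarith

/-- The variance of the centered sum up to `X` in the random model. -/
noncomputable def cosVariance (k : ℕ) (t : ℝ) (X : ℕ) : ℝ :=
  ∑ n ∈ Finset.Icc 3 X, if n.Coprime k then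
    1 / Real.log n * (1 - 1 / Real.log n) * Real.cos (t * Real.log n) ^ 2 else 0

lemma tendsto_sum_inv_log_sq :
    Tendsto (fun X : ℕ => (∑ n ∈ Finset.Icc 3 X, (1 / Real.log n) ^ 2) * (Real.log X / X))
      atTop (𝓝 0) := by
  have h1 := tendsto_sum_div_log tendsto_id (fun _ _ => (1 : ℝ)) (fun _ _ => by simp) (κ := 1)
    (tendsto_sum_Icc_three_div tendsto_id _ (fun _ _ => by simp) (by
      refine tendsto_const_nhds.congr' ?_
      filter_upwards [eventually_gt_atTop 0] with N hN
      have : (N : ℝ) ≠ 0 := by exact_mod_cast hN.ne'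
      simp [this]))
  have h2 : Tendsto (fun X : ℕ => 1 / Real.log X) atTop (𝓝 0) :=
    tendsto_log_natCast_atTop.const_div_atTop 1
  have h3 := tendsto_sum_inv_log_sub_inv_log.add (h2.mul h1)
  rw [zero_mul, add_zero] at h3
  refine squeeze_zero' ?_ ?_ h3
  · refine .of_forall fun X => mul_nonneg (Finset.sum_nonneg fun n _ => sq_nonneg _) ?_
    exact div_nonneg (Real.log_natCast_nonneg X) (Nat.cast_nonneg X)
  · filter_upwards [eventually_ge_atTop 3] with X hX
    have hL := one_le_log_of_three_le hX
    simp only [id]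
    rw [← mul_assoc, ← add_mul, Finset.mul_sum, ← Finset.sum_add_distrib]
    gcongr with n hn
    rw [Finset.mem_Icc] at hn
    have hn1 := one_le_log_of_three_le hn.1
    have hle : 1 / Real.log X ≤ 1 / Real.log n := by
      apply one_div_le_one_div_of_le (by linarith)
      apply Real.log_le_log
      · have : 0 < n := by omega
        exact_mod_cast this
      · exact_mod_cast hn.2
    have hle1 : 1 / Real.log n ≤ 1 := by
      rw [div_le_one (by linarith)]
      exact hn1
    have h0 : 0 ≤ 1 / Real.log X := by positivity
    nlinarith

/-- By `cos² = (1 + cos 2·) / 2` the limit is half the density of the integers coprime to `k`: the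
oscillating half has mean value zero, and the squared weights `1 / log² n` are of lower order. -/
lemma tendsto_cosVariance {k : ℕ} (hk : 1 ≤ k) (A : ℕ) {X : ℕ × ℝ → ℕ}
    (hX : ∀ᶠ q in jointLimit A, q.1 ≤ X q) :
    Tendsto (fun q : ℕ × ℝ => cosVariance k q.2 (X q) * (Real.log (X q) / X q))
      (jointLimit A) (𝓝 ((k.totient : ℝ) / (2 * k))) := by
  have hXt : Tendsto X (jointLimit A) atTop :=
    tendsto_atTop_mono' _ hX (tendsto_fst_jointLimit A)
  have hk0 : (0 : ℝ) < k := by exact_mod_cast hk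
  have h1 := tendsto_sum_div_log hXt (fun _ n => if n.Coprime k then (1 : ℝ) else 0)
    (fun _ n => by split_ifs <;> simp) (tendsto_sum_Icc_three_div hXt _
      (fun _ n => by split_ifs <;> simp) ((tendsto_sum_coprime_indicator_div hk).comp hXt))
  have hcb : ∀ (q : ℕ × ℝ) (n : ℕ),
      |if n.Coprime k then Real.cos (2 * (q.2 * Real.log n)) else 0| ≤ 1 := by
    intro q n
    split_ifs
    · exact Real.abs_cos_le_one _
    · simp
  have h2 := tendsto_sum_div_log hXt _ hcb (tendsto_sum_Icc_three_div hXt _ hcb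
    (tendsto_sum_coprime_cos_div hk A hX))
  have h3 := tendsto_sum_inv_log_sq.comp hXt
  have hmain := (h1.add h2).div_const 2
  rw [add_zero, div_div, mul_comm (k : ℝ) 2] at hmain
  have hdiff : Tendsto (fun q : ℕ × ℝ => cosVariance k q.2 (X q) * (Real.log (X q) / X q) -
      ((∑ n ∈ Finset.Icc 3 (X q), (if n.Coprime k then (1 : ℝ) else 0) / Real.log n) *
        (Real.log (X q) / X q) +
      (∑ n ∈ Finset.Icc 3 (X q), (if n.Coprime k then Real.cos (2 * (q.2 * Real.log n)) else 0) /
        Real.log n) * (Real.log (X q) / X q)) / 2) (jointLimit A) (𝓝 0) := by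
    refine squeeze_zero_norm (fun q => ?_) h3
    have heq : cosVariance k q.2 (X q) * (Real.log (X q) / X q) -
      ((∑ n ∈ Finset.Icc 3 (X q), (if n.Coprime k then (1 : ℝ) else 0) / Real.log n) *
        (Real.log (X q) / X q) +
      (∑ n ∈ Finset.Icc 3 (X q), (if n.Coprime k then Real.cos (2 * (q.2 * Real.log n)) else 0) /
        Real.log n) * (Real.log (X q) / X q)) / 2 =
        (∑ n ∈ Finset.Icc 3 (X q), if n.Coprime k then
          -((1 / Real.log n) ^ 2 * Real.cos (q.2 * Real.log n) ^ 2) else 0) *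
          (Real.log (X q) / X q) := by
      rw [cosVariance, ← add_mul, mul_div_right_comm, ← sub_mul, ← Finset.sum_add_distrib,
        Finset.sum_div, ← Finset.sum_sub_distrib]
      congr 1
      refine Finset.sum_congr rfl fun n _ => ?_
      split_ifs
      · rw [Real.cos_sq (q.2 * Real.log n)]
        ring
      · simp
    rw [heq, norm_mul, Real.norm_of_nonneg
      (div_nonneg (Real.log_natCast_nonneg (X q)) (Nat.cast_nonneg (X q)))]
    simp only [Function.comp]
    refine mul_le_mul_of_nonneg_right ?_
      (div_nonneg (Real.log_natCast_nonneg (X q)) (Nat.cast_nonneg (X q)))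
    refine norm_sum_le_of_le _ fun n _ => ?_
    split_ifs
    · rw [norm_neg, norm_mul, norm_pow, norm_pow, Real.norm_eq_abs, sq_abs, Real.norm_eq_abs]
      refine mul_le_of_le_one_right (sq_nonneg _) (pow_le_one₀ (abs_nonneg _)
        (Real.abs_cos_le_one _))
    · simp only [norm_zero]
      positivity
  simpa using hdiff.add hmain

lemma cltScale_sq {k N : ℕ} (hk : 1 ≤ k) (hN : 3 ≤ N) :
    cltScale k N ^ 2 = (1 + Real.log (Real.log N) / Real.log N) /
      ((k.totient : ℝ) / (2 * (k : ℝ)) * (N : ℝ)) := by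
  have hL := one_le_log_of_three_le hN
  rw [cltScale, Real.sq_sqrt]
  have := Real.log_nonneg hL
  positivity

lemma totient_div_pos {k : ℕ} (hk : 1 ≤ k) : 0 < (k.totient : ℝ) / (2 * (k : ℝ)) := by
  have h1 : (0 : ℝ) < k := by exact_mod_cast hk
  have h2 : (0 : ℝ) < k.totient := by exact_mod_cast Nat.totient_pos.2 hk
  positivity

lemma eventually_le_floor_mul_log :
    ∀ᶠ N : ℕ in atTop, N ≤ ⌊(N : ℝ) * Real.log N⌋₊ := by
  filter_upwards [eventually_ge_atTop 3] with N hN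
  have hL := one_le_log_of_three_le hN
  apply Nat.le_floor
  exact le_mul_of_one_le_right (Nat.cast_nonneg N) hL

/-- The normalization `cltScale` turns the variance up to `N log N` into `1 + o(1)`. -/
lemma tendsto_cltScale_sq_mul_cosVariance {k : ℕ} (hk : 1 ≤ k) (A : ℕ) :
    Tendsto (fun q : ℕ × ℝ => cltScale k q.1 ^ 2 *
      cosVariance k q.2 ⌊(q.1 : ℝ) * Real.log q.1⌋₊) (jointLimit A) (𝓝 1) := by
  have hs := totient_div_pos hk
  have hfst := tendsto_fst_jointLimit A
  have h1 := tendsto_cosVariance hk A (X := fun q => ⌊(q.1 : ℝ) * Real.log q.1⌋₊)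
    (hfst.eventually eventually_le_floor_mul_log)
  have h2 := (tendsto_floor_mul_log_div_mul_log one_pos).comp hfst
  simp only [one_mul] at h2
  have h3 := ((tendsto_log_log_div_log.const_add 1).div_const
    ((k.totient : ℝ) / (2 * (k : ℝ)))).comp hfst
  have h4 := (h3.mul h1).mul h2
  rw [add_zero, one_div_mul_cancel hs.ne', one_mul] at h4
  refine h4.congr' ?_
  have hX := (tendsto_floor_mul_log_atTop one_pos).comp hfst
  simp only [one_mul] at hX
  filter_upwards [hfst.eventually_ge_atTop 3, hX.eventually_ge_atTop 3] with q hq hq3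
  simp only [Function.comp] at hq3 ⊢
  rw [cltScale_sq hk hq]
  have hL := one_le_log_of_three_le hq3
  have hX0 : (⌊(q.1 : ℝ) * Real.log q.1⌋₊ : ℝ) ≠ 0 := by
    have : ⌊(q.1 : ℝ) * Real.log q.1⌋₊ ≠ 0 := by omega
    exact_mod_cast this
  have hL0 : Real.log ⌊(q.1 : ℝ) * Real.log q.1⌋₊ ≠ 0 := by linarith
  generalize ⌊(q.1 : ℝ) * Real.log q.1⌋₊ = X at hX0 hL0 ⊢
  field_simp

lemma cltScale_nonneg (k N : ℕ) : 0 ≤ cltScale k N := Real.sqrt_nonneg _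

lemma tendsto_cltScale {k : ℕ} (hk : 1 ≤ k) : Tendsto (cltScale k) atTop (𝓝 0) := by
  have h1 : Tendsto (fun N : ℕ => (1 + Real.log (Real.log N) / Real.log N) /
      ((k.totient : ℝ) / (2 * (k : ℝ)) * (N : ℝ))) atTop (𝓝 0) :=
    (tendsto_log_log_div_log.const_add 1).div_atTop
      (tendsto_natCast_atTop_atTop.const_mul_atTop (totient_div_pos hk))
  have h2 := (Real.continuous_sqrt.tendsto 0).comp h1
  rw [Real.sqrt_zero] at h2
  exact h2

/-! ### The random model and the limit law at a deterministic cutoff. -/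

section Model

variable {Ω : Type*} {r : ℕ → Ω → ℝ}

lemma cramerIndicator_mem_Icc (r : ℕ → Ω → ℝ) (k n : ℕ) (ω : Ω) :
    cramerIndicator r k n ω ∈ Set.Icc (0 : ℝ) 1 := by
  unfold cramerIndicator
  split_ifs <;> simp

lemma cramerIndicator_sq (r : ℕ → Ω → ℝ) (k n : ℕ) (ω : Ω) :
    cramerIndicator r k n ω ^ 2 = cramerIndicator r k n ω := by
  unfold cramerIndicator
  split_ifs <;> simp

lemma exists_measurable_cramerIndicator_eq (r : ℕ → Ω → ℝ) (k n : ℕ) :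
    ∃ g : ℝ → ℝ, Measurable g ∧ cramerIndicator r k n = g ∘ r n := by
  classical
  refine ⟨fun x => if x ≤ 1 / Real.log n ∧ n.Coprime k then 1 else 0, ?_, ?_⟩
  · exact Measurable.ite (measurableSet_Iic.inter (MeasurableSet.const _)) measurable_const
      measurable_const
  · funext ω
    simp only [cramerIndicator, Function.comp]

variable [MeasurableSpace Ω] {P : Measure Ω}

lemma measurable_cramerIndicator (hmeas : ∀ n, Measurable (r n)) (k n : ℕ) :
    Measurable (cramerIndicator r k n) := by
  obtain ⟨g, hg, h⟩ := exists_measurable_cramerIndicator_eq r k n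
  rw [h]
  exact hg.comp (hmeas n)

lemma integrable_cramerIndicator [IsProbabilityMeasure P] (hmeas : ∀ n, Measurable (r n)) (k n : ℕ) :
    Integrable (cramerIndicator r k n) P := by
  refine .of_bound (measurable_cramerIndicator hmeas k n).aestronglyMeasurable 1
    (.of_forall fun ω => ?_)
  have := cramerIndicator_mem_Icc r k n ω
  rw [Real.norm_of_nonneg this.1]
  exact this.2

lemma measureReal_uniform_le
    (hunif : ∀ n, pdf.IsUniform (r n) (Set.Icc 0 1) P volume) (n : ℕ) {y : ℝ} (hy0 : 0 ≤ y)
    (hy1 : y ≤ 1) : P.real {ω | r n ω ≤ y} = y := by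
  have h := (hunif n).measure_preimage (by simp) (by simp) (measurableSet_Iic (a := y))
  have h1 : Set.Icc (0 : ℝ) 1 ∩ Set.Iic y = Set.Icc 0 y := by
    ext x
    simp only [Set.mem_inter_iff, Set.mem_Icc, Set.mem_Iic]
    exact ⟨fun h => ⟨h.1.1, h.2⟩, fun h => ⟨⟨h.1, h.2.trans hy1⟩, h.2⟩⟩
  rw [h1, Real.volume_Icc, Real.volume_Icc] at h
  have h2 : {ω | r n ω ≤ y} = r n ⁻¹' Set.Iic y := rfl
  rw [measureReal_def, h2, h]
  simp [hy0]

lemma integral_cramerIndicator (hmeas : ∀ n, Measurable (r n))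
    (hunif : ∀ n, pdf.IsUniform (r n) (Set.Icc 0 1) P volume) (k : ℕ) {n : ℕ} (hn : 3 ≤ n) :
    ∫ ω, cramerIndicator r k n ω ∂P = if n.Coprime k then 1 / Real.log n else 0 := by
  have hL := one_le_log_of_three_le hn
  by_cases hc : n.Coprime k
  · have h1 : cramerIndicator r k n = Set.indicator {ω | r n ω ≤ 1 / Real.log n} 1 := by
      funext ω
      by_cases h : r n ω ≤ 1 / Real.log n
      · rw [Set.indicator_of_mem (show ω ∈ {ω | r n ω ≤ 1 / Real.log n} from h),
          cramerIndicator, if_pos ⟨h, hc⟩, Pi.one_apply]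
      · rw [Set.indicator_of_notMem (show ω ∉ {ω | r n ω ≤ 1 / Real.log n} from h),
          cramerIndicator, if_neg fun h' => h h'.1]
    rw [h1, integral_indicator_one (measurableSet_le (hmeas n) measurable_const), if_pos hc,
      measureReal_uniform_le hunif n (by positivity)]
    rw [div_le_one (by linarith)]
    exact hL
  · simp [cramerIndicator, hc]

/-- The centered variable `(z_{n,k} - E z_{n,k}) * cos (t log n)`. -/
noncomputable def centeredTerm (P : Measure Ω) (r : ℕ → Ω → ℝ) (k : ℕ) (t : ℝ) (n : ℕ) (ω : Ω) :
    ℝ :=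
  (cramerIndicator r k n ω - ∫ ω', cramerIndicator r k n ω' ∂P) * Real.cos (t * Real.log n)

lemma measurable_centeredTerm (hmeas : ∀ n, Measurable (r n)) (k : ℕ) (t : ℝ) (n : ℕ) :
    Measurable (centeredTerm P r k t n) :=
  ((measurable_cramerIndicator hmeas k n).sub_const _).mul_const _

lemma integral_cramerIndicator_mem_Icc [IsProbabilityMeasure P] (hmeas : ∀ n, Measurable (r n)) (k n : ℕ) :
    ∫ ω, cramerIndicator r k n ω ∂P ∈ Set.Icc (0 : ℝ) 1 := by
  constructor
  · exact integral_nonneg fun ω => (cramerIndicator_mem_Icc r k n ω).1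
  · have := integral_mono (integrable_cramerIndicator (P := P) hmeas k n) (integrable_const 1)
      fun ω => (cramerIndicator_mem_Icc r k n ω).2
    simpa using this

lemma abs_centeredTerm_le [IsProbabilityMeasure P] (hmeas : ∀ n, Measurable (r n)) (k : ℕ) (t : ℝ) (n : ℕ) (ω : Ω) :
    |centeredTerm P r k t n ω| ≤ 1 := by
  have h1 := cramerIndicator_mem_Icc r k n ω
  have h2 := integral_cramerIndicator_mem_Icc (P := P) hmeas k n
  rw [centeredTerm, abs_mul]
  refine mul_le_one₀ ?_ (abs_nonneg _) (Real.abs_cos_le_one _)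
  rw [abs_le]
  constructor <;> linarith [h1.1, h1.2, h2.1, h2.2]

lemma integral_centeredTerm [IsProbabilityMeasure P] (hmeas : ∀ n, Measurable (r n)) (k : ℕ) (t : ℝ) (n : ℕ) :
    ∫ ω, centeredTerm P r k t n ω ∂P = 0 := by
  simp only [centeredTerm]
  rw [integral_mul_const, integral_sub (integrable_cramerIndicator hmeas k n) (integrable_const _)]
  simp

lemma integral_centeredTerm_sq [IsProbabilityMeasure P] (hmeas : ∀ n, Measurable (r n)) (k : ℕ) (t : ℝ) (n : ℕ) :
    ∫ ω, centeredTerm P r k t n ω ^ 2 ∂P = (∫ ω, cramerIndicator r k n ω ∂P) *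
      (1 - ∫ ω, cramerIndicator r k n ω ∂P) * Real.cos (t * Real.log n) ^ 2 := by
  set p := ∫ ω, cramerIndicator r k n ω ∂P with hp
  have h : ∀ ω, centeredTerm P r k t n ω ^ 2 =
      ((1 - 2 * p) * cramerIndicator r k n ω + p ^ 2) * Real.cos (t * Real.log n) ^ 2 := by
    intro ω
    rw [centeredTerm, ← hp, mul_pow, sub_sq, cramerIndicator_sq]
    ring
  simp only [h]
  rw [integral_mul_const, integral_add ((integrable_cramerIndicator hmeas k n).const_mul _)
    (integrable_const _), integral_const_mul, ← hp]
  simp only [integral_const, probReal_univ, one_smul]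
  ring

lemma iIndepFun_centeredTerm (hindep : iIndepFun r P) (k : ℕ) (t : ℝ) :
    iIndepFun (centeredTerm P r k t) P := by
  choose g hg hgeq using fun n => exists_measurable_cramerIndicator_eq r k n
  have h := hindep.comp (fun n x => (g n x - ∫ ω', cramerIndicator r k n ω' ∂P) *
    Real.cos (t * Real.log n)) fun n => ((hg n).sub_const _).mul_const _
  convert! h using 1
  funext n ω
  simp only [centeredTerm, Function.comp]
  rw [hgeq n, Function.comp]

lemma sumOfMeans_eq (k : ℕ) (t : ℝ) (X : ℕ) : sumOfMeans P r k t X =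
    ∑ n ∈ Finset.Icc 3 X, (∫ ω, cramerIndicator r k n ω ∂P) * Real.cos (t * Real.log n) := by
  simp only [sumOfMeans, integral_mul_const]

lemma cutoffCosSum_sub_sumOfMeans (k : ℕ) (t : ℝ) (X : ℕ) (ω : Ω) :
    cutoffCosSum r k t X ω - sumOfMeans P r k t X =
      ∑ n ∈ Finset.Icc 3 X, centeredTerm P r k t n ω := by
  rw [sumOfMeans_eq, cutoffCosSum, ← Finset.sum_sub_distrib]
  simp only [centeredTerm, sub_mul]

lemma integral_cutoffCosSum [IsProbabilityMeasure P] (hmeas : ∀ n, Measurable (r n)) (k : ℕ) (t : ℝ) (X : ℕ) :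
    ∫ ω, cutoffCosSum r k t X ω ∂P = sumOfMeans P r k t X := by
  simp only [cutoffCosSum, sumOfMeans]
  exact integral_finsetSum _ fun n _ => (integrable_cramerIndicator hmeas k n).mul_const _

/-- The central limit theorem for the centered sum up to `N log N`. -/
theorem tendstoInDistribution_cutoffCosSum [IsProbabilityMeasure P] (hmeas : ∀ n, Measurable (r n))
    (hindep : iIndepFun r P) (hunif : ∀ n, pdf.IsUniform (r n) (Set.Icc 0 1) P volume)
    {k : ℕ} (hk : 1 ≤ k) (A : ℕ) :
    TendstoInDistribution
      (fun (q : ℕ × ℝ) (ω : Ω) => cltScale k q.1 *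
        (cutoffCosSum r k q.2 ⌊(q.1 : ℝ) * Real.log q.1⌋₊ ω
          - ∫ ω', cutoffCosSum r k q.2 ⌊(q.1 : ℝ) * Real.log q.1⌋₊ ω' ∂P))
      (jointLimit A) (id : ℝ → ℝ) (fun _ => P) (gaussianReal 0 1) := by
  have h := tendstoInDistribution_sum_of_bounded P (l := jointLimit A)
    (fun q => Finset.Icc 3 ⌊(q.1 : ℝ) * Real.log q.1⌋₊)
    (fun q n ω => cltScale k q.1 * centeredTerm P r k q.2 n ω)
    (fun q n => (measurable_centeredTerm hmeas k q.2 n).const_mul _)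
    (fun q => (iIndepFun_centeredTerm hindep k q.2).comp (fun _ x => cltScale k q.1 * x)
      fun _ => measurable_const_mul _)
    (fun q n _ => by rw [integral_const_mul, integral_centeredTerm hmeas, mul_zero])
    (fun q => cltScale k q.1)
    (fun q n _ ω => by
      rw [abs_mul, abs_of_nonneg (cltScale_nonneg k q.1)]
      exact mul_le_of_le_one_right (cltScale_nonneg k q.1) (abs_centeredTerm_le hmeas k q.2 n ω))
    ((tendsto_cltScale hk).comp (tendsto_fst_jointLimit A)) (by
      refine (tendsto_cltScale_sq_mul_cosVariance hk A).congr fun q => ?_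
      rw [cosVariance, Finset.mul_sum]
      refine Finset.sum_congr rfl fun n hn => ?_
      simp only [mul_pow]
      rw [integral_const_mul, integral_centeredTerm_sq hmeas,
        integral_cramerIndicator hmeas hunif k (Finset.mem_Icc.1 hn).1]
      split_ifs <;> simp)
  convert! h using 3 with q ω
  rw [integral_cutoffCosSum hmeas, cutoffCosSum_sub_sumOfMeans, Finset.mul_sum]

end Model

/-! ### Counting pseudo-primes. -/

section Count

variable {Ω : Type*}

/-- The number of pseudo-primes `n ≤ X`. -/
noncomputable def pseudoCount (r : ℕ → Ω → ℝ) (X : ℕ) (ω : Ω) : ℝ :=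
  ∑ n ∈ Finset.Icc 3 X, cramerIndicator r 1 n ω

open Classical in
lemma natCast_count_eq_pseudoCount (r : ℕ → Ω → ℝ) (X : ℕ) (ω : Ω) :
    (Nat.count (fun n => n ∈ pseudoPrimes r ω) (X + 1) : ℝ) = pseudoCount r X ω := by
  rw [Nat.count_eq_card_filter_range, pseudoCount, Finset.card_filter, Nat.cast_sum]
  have hsub : Finset.Icc 3 X ⊆ Finset.range (X + 1) := by
    intro n hn
    rw [Finset.mem_Icc] at hn
    rw [Finset.mem_range]
    omega
  rw [← Finset.sum_subset hsub]
  · refine Finset.sum_congr rfl fun n hn => ?_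
    rw [Finset.mem_Icc] at hn
    simp [pseudoPrimes, cramerIndicator, hn.1]
  · intro n hn hn'
    rw [Finset.mem_range] at hn
    rw [Finset.mem_Icc] at hn'
    have : ¬ 3 ≤ n := by omega
    simp [pseudoPrimes, this]

/-- Order statistics are translated into the counting function. Infinitude matters because `Nat.nth`
takes the value `0` past the end of a finite set. -/
lemma pseudoPrime_le_iff {r : ℕ → Ω → ℝ} {ω : Ω} (h : (pseudoPrimes r ω).Infinite) {N : ℕ}
    (hN : 1 ≤ N) (X : ℕ) : pseudoPrime r N ω ≤ X ↔ (N : ℝ) ≤ pseudoCount r X ω := by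
  classical
  rw [← natCast_count_eq_pseudoCount, Nat.cast_le, pseudoPrime, ← Nat.lt_succ_iff, Nat.succ_eq_add_one,
    ← Nat.lt_nth_iff_count_lt (p := fun n => n ∈ pseudoPrimes r ω) h]
  omega

/-- The stopping time property: whether `n` is reached is decided by `r j` with `j < n`. -/
lemma le_pseudoPrime_iff {r : ℕ → Ω → ℝ} {ω : Ω} (h : (pseudoPrimes r ω).Infinite) {N : ℕ}
    (hN : 1 ≤ N) {n : ℕ} (hn : 1 ≤ n) :
    n ≤ pseudoPrime r N ω ↔ pseudoCount r (n - 1) ω < N := by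
  rw [← not_le, ← pseudoPrime_le_iff h hN, not_le]
  omega

/-- The sum over the first `N` pseudo-primes is the sum of indicators up to the `N`-th one. -/
lemma pseudoPrimeCosSum_eq_cutoffCosSum {r : ℕ → Ω → ℝ} {ω : Ω} (h : (pseudoPrimes r ω).Infinite)
    (k : ℕ) {N : ℕ} (hN : 1 ≤ N) (t : ℝ) :
    pseudoPrimeCosSum r k N t ω = cutoffCosSum r k t (pseudoPrime r N ω) ω := by
  classical
  set p : ℕ → Prop := fun n => n ∈ pseudoPrimes r ω with hp
  set f : ℕ → ℝ := fun n => if n.Coprime k then Real.cos (t * Real.log n) else 0 with hf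
  have hcut : ∀ X, cutoffCosSum r k t X ω = ∑ n ∈ (Finset.range (X + 1)).filter p, f n := by
    intro X
    rw [cutoffCosSum, Finset.sum_filter]
    have hsub : Finset.Icc 3 X ⊆ Finset.range (X + 1) := by
      intro n hn
      rw [Finset.mem_Icc] at hn
      rw [Finset.mem_range]
      omega
    rw [← Finset.sum_subset hsub]
    · refine Finset.sum_congr rfl fun n hn => ?_
      rw [Finset.mem_Icc] at hn
      by_cases h1 : r n ω ≤ 1 / Real.log n
      · by_cases h2 : n.Coprime k
        · rw [cramerIndicator, if_pos ⟨h1, h2⟩, if_pos (show n ∈ pseudoPrimes r ω from ⟨hn.1, h1⟩),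
            one_mul, hf]
          simp only [if_pos h2]
        · rw [cramerIndicator, if_neg fun h => h2 h.2, zero_mul, hf]
          simp only [if_neg h2, ite_self]
      · rw [cramerIndicator, if_neg fun h => h1 h.1, zero_mul,
          if_neg (show n ∉ pseudoPrimes r ω from fun h => h1 h.2)]
    · intro n hn hn'
      rw [Finset.mem_range] at hn
      rw [Finset.mem_Icc] at hn'
      rw [if_neg]
      intro h
      exact hn' ⟨h.1, by omega⟩
  have key : ∀ m, ∑ n ∈ (Finset.range (Nat.nth p m)).filter p, f n =
      ∑ j ∈ Finset.range m, f (Nat.nth p j) := by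
    intro m
    induction m with
    | zero =>
      have h0 := Nat.count_nth_of_infinite (p := p) h 0
      rw [Nat.count_eq_card_filter_range, Finset.card_eq_zero] at h0
      rw [h0]
      simp
    | succ m ih =>
      rw [Nat.filter_range_nth_eq_insert_of_infinite (p := p) h, Finset.sum_insert, ih,
        Finset.sum_range_succ, add_comm]
      simp
  obtain ⟨m, rfl⟩ : ∃ m, N = m + 1 := ⟨N - 1, by omega⟩
  have hmem : p (Nat.nth p m) := Nat.nth_mem_of_infinite h m
  rw [hcut, pseudoPrime, Nat.add_sub_cancel, Finset.range_add_one, Finset.filter_insert,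
    if_pos hmem, Finset.sum_insert (by simp), key, add_comm (f _), ← Finset.sum_range_succ,
    pseudoPrimeCosSum, Finset.sum_filter, ← Finset.Ico_succ_right_eq_Icc,
    Finset.sum_Ico_eq_sum_range]
  refine Finset.sum_congr (by simp) fun j _ => ?_
  simp only [pseudoPrime, Nat.add_sub_cancel_left, hf, hp]

end Count

/-! ### Concentration and the size of the `N`-th pseudo-prime. -/

section Concentration

variable {Ω : Type*} {r : ℕ → Ω → ℝ} [MeasurableSpace Ω] {P : Measure Ω}

/-- Hoeffding's inequality for sums of centered terms. -/
lemma measureReal_abs_sum_centeredTerm_ge_le [IsProbabilityMeasure P]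
    (hmeas : ∀ n, Measurable (r n))
    (hindep : iIndepFun r P) (k : ℕ) (t : ℝ) (s : Finset ℕ) {ε : ℝ} (hε : 0 ≤ ε) :
    P.real {ω | ε ≤ |∑ n ∈ s, centeredTerm P r k t n ω|} ≤
      2 * Real.exp (-ε ^ 2 / (2 * s.card)) := by
  have hY : ∀ n, HasSubgaussianMGF (centeredTerm P r k t n) 1 P := by
    intro n
    have h := hasSubgaussianMGF_of_mem_Icc_of_integral_eq_zero (μ := P) (a := -1) (b := 1)
      (measurable_centeredTerm hmeas k t n).aemeasurable
      (.of_forall fun ω => abs_le.1 (abs_centeredTerm_le hmeas k t n ω))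
      (integral_centeredTerm hmeas k t n)
    -- Values in `[-1, 1]` give the sub-Gaussian parameter `1`.
    have hc : ((‖(1 : ℝ) - (-1)‖₊ / 2) ^ 2 : NNReal) = 1 := by
      rw [← NNReal.coe_inj]
      norm_num
    rwa [hc] at h
  have hind := iIndepFun_centeredTerm hindep k t
  have h1 := HasSubgaussianMGF.measure_sum_ge_le_of_iIndepFun hind (s := s)
    (fun n _ => hY n) hε
  have h2 := HasSubgaussianMGF.measure_sum_ge_le_of_iIndepFun
    (hind.comp (fun _ x => -x) fun _ => measurable_neg) (s := s)
    (fun n _ => (hY n).neg) hε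
  have hsub : {ω | ε ≤ |∑ n ∈ s, centeredTerm P r k t n ω|} ⊆
      {ω | ε ≤ ∑ n ∈ s, centeredTerm P r k t n ω} ∪
      {ω | ε ≤ ∑ n ∈ s, ((fun x => -x) ∘ centeredTerm P r k t n) ω} := by
    intro ω hω
    simp only [Set.mem_ofPred_eq, Set.mem_union, Function.comp, Finset.sum_neg_distrib] at hω ⊢
    exact le_abs.1 hω
  refine (measureReal_mono hsub).trans ((measureReal_union_le _ _).trans ?_)
  simp only [Finset.sum_const, nsmul_eq_mul, mul_one, NNReal.coe_natCast] at h1 h2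
  linarith

/-- The case `k = 1`, `t = 0` trivializes coprimality and cosine, so the bounds for centered terms
also control the counting function. -/
lemma pseudoCount_sub_eq (hmeas : ∀ n, Measurable (r n))
    (hunif : ∀ n, pdf.IsUniform (r n) (Set.Icc 0 1) P volume) (X : ℕ) (ω : Ω) :
    pseudoCount r X ω - ∑ n ∈ Finset.Icc 3 X, 1 / Real.log n =
      ∑ n ∈ Finset.Icc 3 X, centeredTerm P r 1 0 n ω := by
  rw [pseudoCount, ← Finset.sum_sub_distrib]
  refine Finset.sum_congr rfl fun n hn => ?_
  rw [centeredTerm, integral_cramerIndicator hmeas hunif 1 (Finset.mem_Icc.1 hn).1]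
  simp

/-- With about `c N log N` terms and deviation `δ N`, the Hoeffding exponent is of order `N / log
N`, which eventually exceeds `2 log N`. -/
lemma summable_measureReal_abs_sum_centeredTerm_ge [IsProbabilityMeasure P]
    (hmeas : ∀ n, Measurable (r n))
    (hindep : iIndepFun r P) (k : ℕ) (t : ℝ) {c δ : ℝ} (hc : 0 < c) (hδ : 0 < δ) :
    Summable fun N : ℕ => P.real {ω | δ * N ≤
      |∑ n ∈ Finset.Icc 3 ⌊c * (N * Real.log N)⌋₊, centeredTerm P r k t n ω|} := by
  have hsum : Summable fun N : ℕ => 2 * (1 / (N : ℝ) ^ 2) :=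
    (Real.summable_one_div_nat_pow.2 (by norm_num)).mul_left 2
  refine Summable.of_norm_bounded_eventually_nat hsum ?_
  have hlog : Tendsto (fun N : ℕ => Real.log N ^ 2 / N) atTop (𝓝 0) :=
    (Real.isLittleO_pow_log_id_atTop (n := 2)).tendsto_div_nhds_zero.comp
      tendsto_natCast_atTop_atTop
  have hev := hlog.eventually (gt_mem_nhds (show 0 < δ ^ 2 / (4 * c) by positivity))
  filter_upwards [hev, eventually_ge_atTop 3,
    (tendsto_floor_mul_log_atTop hc).eventually_ge_atTop 3] with N hN hN3 hX
  have hL := one_le_log_of_three_le hN3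
  have hN0 : (0 : ℝ) < N := by
    have : 0 < N := by omega
    exact_mod_cast this
  rw [Real.norm_of_nonneg measureReal_nonneg]
  refine (measureReal_abs_sum_centeredTerm_ge_le hmeas hindep k t _ (by positivity)).trans ?_
  gcongr
  have hcard : ((Finset.Icc 3 ⌊c * (N * Real.log N)⌋₊).card : ℝ) ≤ c * (N * Real.log N) := by
    rw [Nat.card_Icc]
    refine le_trans ?_ (Nat.floor_le (by positivity))
    exact_mod_cast (by omega)
  have hcard0 : (0 : ℝ) < (Finset.Icc 3 ⌊c * (N * Real.log N)⌋₊).card := by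
    rw [Nat.card_Icc]
    exact_mod_cast (by omega)
  rw [one_div, ← Real.exp_log (show (0 : ℝ) < ((N : ℝ) ^ 2)⁻¹ by positivity), Real.exp_le_exp,
    Real.log_inv, Real.log_pow, neg_div, neg_le_neg_iff]
  rw [div_lt_iff₀ hN0] at hN
  rw [le_div_iff₀ (by positivity)]
  push_cast
  calc 2 * Real.log N * (2 * ((Finset.Icc 3 ⌊c * (N * Real.log N)⌋₊).card : ℝ))
      ≤ 2 * Real.log N * (2 * (c * (N * Real.log N))) := by gcongr
    _ = 4 * c * N * Real.log N ^ 2 := by ring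
    _ ≤ 4 * c * N * (δ ^ 2 / (4 * c) * N) := by gcongr
    _ = (δ * N) ^ 2 := by field_simp

/-- The number of pseudo-primes up to `c N log N` is asymptotic to `c N`. -/
lemma ae_tendsto_pseudoCount_div [IsProbabilityMeasure P]
    (hmeas : ∀ n, Measurable (r n))
    (hindep : iIndepFun r P) (hunif : ∀ n, pdf.IsUniform (r n) (Set.Icc 0 1) P volume)
    {c : ℝ} (hc : 0 < c) :
    ∀ᵐ ω ∂P, Tendsto (fun N : ℕ => pseudoCount r ⌊c * (N * Real.log N)⌋₊ ω / N) atTop (𝓝 c) := by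
  have h1 : ∀ j : ℕ, ∀ᵐ ω ∂P, ∀ᶠ N : ℕ in atTop,
      |∑ n ∈ Finset.Icc 3 ⌊c * (N * Real.log N)⌋₊, centeredTerm P r 1 0 n ω| <
        1 / ((j : ℝ) + 1) * N := by
    intro j
    have hs := summable_measureReal_abs_sum_centeredTerm_ge hmeas hindep 1 0 hc
      (show 0 < 1 / ((j : ℝ) + 1) by positivity)
    have hne := hs.tsum_ofReal_ne_top
    rw [tsum_congr fun N => ofReal_measureReal (measure_ne_top P _)] at hne
    -- Borel–Cantelli, for each of the countably many tolerances `1 / (j + 1)`.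
    filter_upwards [ae_eventually_notMem hne] with ω hω
    filter_upwards [hω] with N hN
    simpa using hN
  filter_upwards [ae_all_iff.2 h1] with ω hω
  have h2 : Tendsto (fun N : ℕ =>
      (∑ n ∈ Finset.Icc 3 ⌊c * (N * Real.log N)⌋₊, centeredTerm P r 1 0 n ω) / N) atTop (𝓝 0) := by
    rw [Metric.tendsto_nhds]
    intro ε hε
    obtain ⟨j, hj⟩ := exists_nat_one_div_lt hε
    filter_upwards [hω j, eventually_gt_atTop 0] with N hN hN0
    have hN0' : (0 : ℝ) < N := by exact_mod_cast hN0
    rw [dist_zero_right, norm_div, Real.norm_natCast, div_lt_iff₀ hN0', Real.norm_eq_abs]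
    exact hN.trans (by gcongr)
  have h3 := h2.add (tendsto_sum_inv_log_div hc)
  rw [zero_add] at h3
  refine h3.congr fun N => ?_
  rw [← pseudoCount_sub_eq hmeas hunif]
  ring

lemma ae_eventually_le_pseudoCount [IsProbabilityMeasure P]
    (hmeas : ∀ n, Measurable (r n))
    (hindep : iIndepFun r P) (hunif : ∀ n, pdf.IsUniform (r n) (Set.Icc 0 1) P volume)
    {c : ℝ} (hc : 1 < c) :
    ∀ᵐ ω ∂P, ∀ᶠ N : ℕ in atTop, (N : ℝ) ≤ pseudoCount r ⌊c * (N * Real.log N)⌋₊ ω := by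
  filter_upwards [ae_tendsto_pseudoCount_div hmeas hindep hunif (zero_lt_one.trans hc)] with ω hω
  filter_upwards [hω.eventually (lt_mem_nhds hc), eventually_gt_atTop 0] with N hN hN0
  have hN0' : (0 : ℝ) < N := by exact_mod_cast hN0
  rw [lt_div_iff₀ hN0'] at hN
  linarith

lemma ae_infinite_pseudoPrimes [IsProbabilityMeasure P]
    (hmeas : ∀ n, Measurable (r n))
    (hindep : iIndepFun r P) (hunif : ∀ n, pdf.IsUniform (r n) (Set.Icc 0 1) P volume) :
    ∀ᵐ ω ∂P, (pseudoPrimes r ω).Infinite := by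
  classical
  filter_upwards [ae_eventually_le_pseudoCount hmeas hindep hunif one_lt_two] with ω hω hfin
  obtain ⟨N, hN, hN1⟩ := (hω.and (eventually_gt_atTop hfin.toFinset.card)).exists
  rw [← natCast_count_eq_pseudoCount, Nat.cast_le, Nat.count_eq_card_filter_range] at hN
  have h2 : (Finset.range (⌊2 * ((N : ℝ) * Real.log N)⌋₊ + 1)).filter
      (fun n => n ∈ pseudoPrimes r ω) ⊆ hfin.toFinset := by
    intro n hn
    rw [Set.Finite.mem_toFinset]
    exact (Finset.mem_filter.1 hn).2
  have := Finset.card_le_card h2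
  omega

/-- Almost surely, the `N`-th pseudo-prime lies between `(1 - ε) N log N` and
`(1 + ε) N log N`. -/
lemma ae_eventually_pseudoPrime_mem [IsProbabilityMeasure P]
    (hmeas : ∀ n, Measurable (r n))
    (hindep : iIndepFun r P) (hunif : ∀ n, pdf.IsUniform (r n) (Set.Icc 0 1) P volume)
    {ε : ℝ} (hε : 0 < ε) (hε1 : ε < 1) :
    ∀ᵐ ω ∂P, ∀ᶠ N : ℕ in atTop, ⌊(1 - ε) * (N * Real.log N)⌋₊ ≤ pseudoPrime r N ω ∧
      pseudoPrime r N ω ≤ ⌊(1 + ε) * (N * Real.log N)⌋₊ := by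
  filter_upwards [ae_eventually_le_pseudoCount hmeas hindep hunif (show 1 < 1 + ε by linarith),
    ae_tendsto_pseudoCount_div hmeas hindep hunif (show 0 < 1 - ε by linarith),
    ae_infinite_pseudoPrimes hmeas hindep hunif] with ω h1 h2 hinf
  filter_upwards [h1, h2.eventually (gt_mem_nhds (show 1 - ε < 1 by linarith)),
    eventually_gt_atTop 0] with N hN1 hN2 hN0
  have hN0' : (0 : ℝ) < N := by exact_mod_cast hN0
  refine ⟨?_, (pseudoPrime_le_iff hinf hN0 _).2 hN1⟩
  rw [div_lt_one hN0'] at hN2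
  by_contra h
  push Not at h
  exact absurd ((pseudoPrime_le_iff hinf hN0 _).1 h.le) (not_le.2 hN2)

end Concentration

/-! ### Predictable transforms of the centered terms. -/

section Predictable

variable {Ω : Type*}

/-- The σ-algebra generated by the variables `r j` with `j < n`. -/
@[reducible] def pastSigma (r : ℕ → Ω → ℝ) (n : ℕ) : MeasurableSpace Ω :=
  ⨆ j ∈ Set.Iio n, MeasurableSpace.comap (r j) inferInstance

lemma measurable_pastSigma (r : ℕ → Ω → ℝ) {j n : ℕ} (h : j < n) :
    Measurable[pastSigma r n] (r j) := by
  rw [measurable_iff_comap_le]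
  exact le_iSup₂_of_le (f := fun j (_ : j ∈ Set.Iio n) =>
    MeasurableSpace.comap (r j) inferInstance) j h le_rfl

lemma pastSigma_mono (r : ℕ → Ω → ℝ) {m n : ℕ} (h : m ≤ n) : pastSigma r m ≤ pastSigma r n :=
  biSup_mono fun _ hj => lt_of_lt_of_le hj h

lemma measurable_cramerIndicator_pastSigma (r : ℕ → Ω → ℝ) (k : ℕ) {j n : ℕ} (h : j < n) :
    Measurable[pastSigma r n] (cramerIndicator r k j) := by
  obtain ⟨g, hg, hgeq⟩ := exists_measurable_cramerIndicator_eq r k j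
  rw [hgeq]
  exact hg.comp (measurable_pastSigma r h)

lemma measurable_pseudoCount_pastSigma (r : ℕ → Ω → ℝ) {X n : ℕ} (h : X < n) :
    Measurable[pastSigma r n] (pseudoCount r X) := by
  unfold pseudoCount
  refine @Finset.measurable_fun_sum _ _ _ _ _ _ (pastSigma r n) _ _ fun j hj => ?_
  exact measurable_cramerIndicator_pastSigma r 1 (lt_of_le_of_lt (Finset.mem_Icc.1 hj).2 h)

variable {r : ℕ → Ω → ℝ} [MeasurableSpace Ω] {P : Measure Ω}

lemma pastSigma_le (hmeas : ∀ n, Measurable (r n)) (n : ℕ) :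
    pastSigma r n ≤ ‹MeasurableSpace Ω› :=
  iSup₂_le fun j _ => (hmeas j).comap_le

lemma exists_measurable_centeredTerm_eq (k : ℕ) (t : ℝ) (n : ℕ) :
    ∃ g : ℝ → ℝ, Measurable g ∧ centeredTerm P r k t n = g ∘ r n := by
  obtain ⟨g, hg, hgeq⟩ := exists_measurable_cramerIndicator_eq r k n
  refine ⟨fun x => (g x - ∫ ω', cramerIndicator r k n ω' ∂P) * Real.cos (t * Real.log n),
    (hg.sub_const _).mul_const _, ?_⟩
  funext ω
  simp only [centeredTerm, Function.comp]
  rw [hgeq, Function.comp]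

lemma measurable_centeredTerm_pastSigma (k : ℕ) (t : ℝ) {j n : ℕ} (h : j < n) :
    Measurable[pastSigma r n] (centeredTerm P r k t j) := by
  obtain ⟨g, hg, hgeq⟩ := exists_measurable_centeredTerm_eq (P := P) (r := r) k t j
  rw [hgeq]
  exact hg.comp (measurable_pastSigma r h)

/-- The martingale difference property: `f` is independent of `r n`, and the centered term has mean
zero. -/
lemma integral_mul_centeredTerm_eq_zero [IsProbabilityMeasure P] (hmeas : ∀ n, Measurable (r n))
    (hindep : iIndepFun r P) (k : ℕ) (t : ℝ) (n : ℕ) {f : Ω → ℝ}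
    (hf : Measurable[pastSigma r n] f) : ∫ ω, f ω * centeredTerm P r k t n ω ∂P = 0 := by
  obtain ⟨g, hg, hgeq⟩ := exists_measurable_centeredTerm_eq (P := P) (r := r) k t n
  have hY : Measurable[MeasurableSpace.comap (r n) inferInstance] (centeredTerm P r k t n) := by
    rw [hgeq]
    exact hg.comp (comap_measurable (r n))
  have hI : Indep (pastSigma r n) (⨆ j ∈ ({n} : Set ℕ), MeasurableSpace.comap (r j) inferInstance)
      P := by
    refine indep_iSup_of_disjoint (fun j => (hmeas j).comap_le)
      ((iIndepFun_iff_iIndep _ _ _).1 hindep) ?_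
    simp
  rw [iSup_singleton] at hI
  have hIF : IndepFun f (centeredTerm P r k t n) P := by
    rw [IndepFun_iff_Indep]
    exact indep_of_indep_of_le hI hf.comap_le hY.comap_le
  rw [hIF.integral_fun_mul_eq_mul_integral
    (hf.mono (pastSigma_le hmeas n) le_rfl).aestronglyMeasurable
    (measurable_centeredTerm hmeas k t n).aestronglyMeasurable, integral_centeredTerm hmeas,
    mul_zero]

/-- Orthogonality of the increments of a predictable transform. -/
lemma integral_sq_sum_predictable_le [IsProbabilityMeasure P] (hmeas : ∀ n, Measurable (r n))
    (hindep : iIndepFun r P) (k : ℕ) (t : ℝ) (a : ℕ → Ω → ℝ)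
    (ha : ∀ n, 1 ≤ n → Measurable[pastSigma r n] (a n)) (ha1 : ∀ n ω, |a n ω| ≤ 1) (s e : ℕ)
    (hs : 1 ≤ s) (hse : s ≤ e) :
    ∫ ω, (∑ n ∈ Finset.Ico s e, a n ω * centeredTerm P r k t n ω) ^ 2 ∂P ≤
      ∑ n ∈ Finset.Ico s e, ∫ ω, centeredTerm P r k t n ω ^ 2 ∂P := by
  induction e, hse using Nat.le_induction with
  | base => simp
  | succ e hse ih =>
    set Y := centeredTerm P r k t with hY
    set M : Ω → ℝ := fun ω => ∑ n ∈ Finset.Ico s e, a n ω * Y n ω with hM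
    have hMmeas : Measurable[pastSigma r e] M := by
      refine @Finset.measurable_fun_sum _ _ _ _ _ _ (pastSigma r e) _ _ fun j hj => ?_
      rw [Finset.mem_Ico] at hj
      exact Measurable.fun_mul (m := pastSigma r e)
        ((ha j (by omega)).mono (pastSigma_mono r hj.2.le) le_rfl)
        (measurable_centeredTerm_pastSigma k t hj.2)
    have hMa : Measurable[pastSigma r e] fun ω => M ω * a e ω :=
      Measurable.fun_mul (m := pastSigma r e) hMmeas (ha e (by omega))
    have hM' : Measurable M := hMmeas.mono (pastSigma_le hmeas e) le_rfl
    have ha' : Measurable (a e) := (ha e (by omega)).mono (pastSigma_le hmeas e) le_rfl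
    have hY' : Measurable (Y e) := measurable_centeredTerm hmeas k t e
    have haY : ∀ n ω, |a n ω * Y n ω| ≤ 1 := fun n ω => by
      rw [abs_mul]
      exact mul_le_one₀ (ha1 n ω) (abs_nonneg _) (abs_centeredTerm_le hmeas k t n ω)
    have hMb : ∀ ω, |M ω| ≤ (Finset.Ico s e).card := fun ω => by
      refine (Finset.abs_sum_le_sum_abs _ _).trans ?_
      refine (Finset.sum_le_card_nsmul _ _ 1 fun n _ => haY n ω).trans ?_
      simp
    have hi1 : Integrable (fun ω => M ω ^ 2) P := by
      refine .of_bound (hM'.pow_const 2).aestronglyMeasurable (((Finset.Ico s e).card : ℝ) ^ 2)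
        (.of_forall fun ω => ?_)
      rw [norm_pow, Real.norm_eq_abs]
      exact pow_le_pow_left₀ (abs_nonneg _) (hMb ω) 2
    have hi2 : Integrable (fun ω => M ω * a e ω * Y e ω) P := by
      refine .of_bound ((hM'.mul ha').mul hY').aestronglyMeasurable ((Finset.Ico s e).card : ℝ)
        (.of_forall fun ω => ?_)
      rw [mul_assoc, norm_mul, Real.norm_eq_abs, Real.norm_eq_abs]
      exact (mul_le_mul (hMb ω) (haY e ω) (abs_nonneg _) (Nat.cast_nonneg _)).trans (mul_one _).le
    have hi3 : Integrable (fun ω => (a e ω * Y e ω) ^ 2) P := by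
      refine .of_bound ((ha'.mul hY').pow_const 2).aestronglyMeasurable 1 (.of_forall fun ω => ?_)
      rw [norm_pow, Real.norm_eq_abs]
      exact pow_le_one₀ (abs_nonneg _) (haY e ω)
    have hi4 : Integrable (fun ω => Y e ω ^ 2) P := by
      refine .of_bound (hY'.pow_const 2).aestronglyMeasurable 1 (.of_forall fun ω => ?_)
      rw [norm_pow, Real.norm_eq_abs]
      exact pow_le_one₀ (abs_nonneg _) (abs_centeredTerm_le hmeas k t e ω)
    -- In the opened square the cross term integrates to zero, since `M` and `a e` depend only on
    -- the past of `e`.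
    have hexp : ∀ ω, (∑ n ∈ Finset.Ico s (e + 1), a n ω * Y n ω) ^ 2 =
        M ω ^ 2 + (2 * (M ω * a e ω * Y e ω) + (a e ω * Y e ω) ^ 2) := by
      intro ω
      rw [Finset.sum_Ico_succ_top hse]
      simp only [hM]
      ring
    have hi23 : Integrable (fun ω => 2 * (M ω * a e ω * Y e ω) + (a e ω * Y e ω) ^ 2) P :=
      (hi2.const_mul 2).add hi3
    simp only [hexp]
    rw [integral_add hi1 hi23, integral_add (hi2.const_mul 2) hi3, integral_const_mul,
      integral_mul_centeredTerm_eq_zero hmeas hindep k t e hMa, Finset.sum_Ico_succ_top hse]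
    have h3 : ∫ ω, (a e ω * Y e ω) ^ 2 ∂P ≤ ∫ ω, Y e ω ^ 2 ∂P := by
      refine integral_mono hi3 hi4 fun ω => ?_
      simp only [mul_pow]
      refine mul_le_of_le_one_left (sq_nonneg _) ?_
      rw [← sq_abs]
      exact pow_le_one₀ (abs_nonneg _) (ha1 e ω)
    linarith

lemma integral_centeredTerm_sq_le [IsProbabilityMeasure P] (hmeas : ∀ n, Measurable (r n))
    (hunif : ∀ n, pdf.IsUniform (r n) (Set.Icc 0 1) P volume) (k : ℕ) (t : ℝ) {n : ℕ}
    (hn : 3 ≤ n) : ∫ ω, centeredTerm P r k t n ω ^ 2 ∂P ≤ 1 / Real.log n := by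
  have hL := one_le_log_of_three_le hn
  have hp := integral_cramerIndicator_mem_Icc (P := P) hmeas k n
  have hle : ∫ ω, cramerIndicator r k n ω ∂P ≤ 1 / Real.log n := by
    rw [integral_cramerIndicator hmeas hunif k hn]
    split_ifs
    · exact le_rfl
    · positivity
  rw [integral_centeredTerm_sq hmeas]
  refine le_trans ?_ hle
  have h1 : Real.cos (t * Real.log n) ^ 2 ≤ 1 := Real.cos_sq_le_one _
  have h2 : (∫ ω, cramerIndicator r k n ω ∂P) * (1 - ∫ ω, cramerIndicator r k n ω ∂P) ≤
      ∫ ω, cramerIndicator r k n ω ∂P := mul_le_of_le_one_right hp.1 (by linarith [hp.1])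
  have h3 : 0 ≤ (∫ ω, cramerIndicator r k n ω ∂P) * (1 - ∫ ω, cramerIndicator r k n ω ∂P) :=
    mul_nonneg hp.1 (by linarith [hp.2])
  exact (mul_le_of_le_one_right h3 h1).trans h2

lemma measurable_pseudoCount (hmeas : ∀ n, Measurable (r n)) (X : ℕ) :
    Measurable (pseudoCount r X) :=
  (measurable_pseudoCount_pastSigma r (Nat.lt_succ_self X)).mono (pastSigma_le hmeas _) le_rfl

/-- Almost surely the `j`-th pseudo-prime is the first `X` at which the counting function reaches
`j`. -/
lemma aemeasurable_pseudoPrime [IsProbabilityMeasure P] (hmeas : ∀ n, Measurable (r n))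
    (hindep : iIndepFun r P) (hunif : ∀ n, pdf.IsUniform (r n) (Set.Icc 0 1) P volume) (j : ℕ) :
    AEMeasurable (pseudoPrime r j) P := by
  classical
  -- Truncated subtraction makes the index `0` agree with the index `1`.
  wlog hj : 1 ≤ j generalizing j
  · obtain rfl : j = 0 := by omega
    exact this 1 le_rfl
  -- The second alternative only serves to make the search total where the count never reaches `j`.
  have hex : ∀ ω, ∃ X, (j : ℝ) ≤ pseudoCount r X ω ∨ ∀ Y, pseudoCount r Y ω < j := by
    intro ω
    by_cases h : ∃ X, (j : ℝ) ≤ pseudoCount r X ω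
    · exact h.imp fun _ => Or.inl
    · push Not at h
      exact ⟨0, Or.inr h⟩
  have hfind : Measurable fun ω => Nat.find (hex ω) := by
    refine measurable_find hex fun X => ?_
    refine (measurableSet_le measurable_const (measurable_pseudoCount hmeas X)).union ?_
    have hset : {ω | ∀ Y, pseudoCount r Y ω < j} = ⋂ Y, {ω | pseudoCount r Y ω < j} := by
      ext ω
      simp
    change MeasurableSet {ω | ∀ Y, pseudoCount r Y ω < j}
    rw [hset]
    exact MeasurableSet.iInter fun Y =>
      measurableSet_lt (measurable_pseudoCount hmeas Y) measurable_const
  refine ⟨_, hfind, ?_⟩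
  filter_upwards [ae_infinite_pseudoPrimes hmeas hindep hunif] with ω hω
  symm
  rw [Nat.find_eq_iff]
  refine ⟨Or.inl ((pseudoPrime_le_iff hω hj _).1 le_rfl), fun n hn => ?_⟩
  push Not
  refine ⟨?_, ?_⟩
  · by_contra h
    push Not at h
    exact absurd ((pseudoPrime_le_iff hω hj _).2 h) (not_le.2 hn)
  · exact ⟨_, (pseudoPrime_le_iff hω hj _).1 le_rfl⟩

end Predictable

lemma Finset.sum_Icc_three_eq_add_sum_ite (f : ℕ → ℝ) {lo hi x : ℕ} (hlo : 2 ≤ lo) (h1 : lo ≤ x)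
    (h2 : x ≤ hi) : ∑ n ∈ Finset.Icc 3 x, f n = ∑ n ∈ Finset.Icc 3 lo, f n +
      ∑ n ∈ Finset.Ico (lo + 1) (hi + 1), (if n ≤ x then 1 else 0) * f n := by
  have hfil : (Finset.Ico (lo + 1) (hi + 1)).filter (· ≤ x) = Finset.Ico (lo + 1) (x + 1) := by
    ext n
    simp only [Finset.mem_filter, Finset.mem_Ico]
    omega
  simp only [ite_mul, one_mul, zero_mul]
  rw [← Finset.sum_filter, hfil, ← Finset.Ico_succ_right_eq_Icc, ← Finset.Ico_succ_right_eq_Icc]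
  exact (Finset.sum_Ico_consecutive f (by simpa using by omega) (by simpa using by omega)).symm

/-- Random summation limits become coefficients on a fixed range, the form needed for a predictable
transform. -/
lemma Finset.sum_Icc_three_sub_eq (f : ℕ → ℝ) {lo hi x y : ℕ} (hlo : 2 ≤ lo) (h1 : lo ≤ x)
    (h2 : x ≤ hi) (h3 : lo ≤ y) (h4 : y ≤ hi) :
    ∑ n ∈ Finset.Icc 3 x, f n - ∑ n ∈ Finset.Icc 3 y, f n =
      ∑ n ∈ Finset.Ico (lo + 1) (hi + 1),
        ((if n ≤ x then 1 else 0) - (if n ≤ y then 1 else 0)) * f n := by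
  rw [Finset.sum_Icc_three_eq_add_sum_ite f hlo h1 h2,
    Finset.sum_Icc_three_eq_add_sum_ite f hlo h3 h4]
  simp only [sub_mul, Finset.sum_sub_distrib]
  ring

lemma abs_ite_sub_ite_le (p q : Prop) [Decidable p] [Decidable q] :
    |(if p then (1 : ℝ) else 0) - (if q then 1 else 0)| ≤ 1 := by
  split_ifs <;> simp

lemma sum_Ico_inv_log_eq {lo hi : ℕ} (hlo : 2 ≤ lo) (h : lo ≤ hi) :
    ∑ n ∈ Finset.Ico (lo + 1) (hi + 1), 1 / Real.log n =
      ∑ n ∈ Finset.Icc 3 hi, 1 / Real.log n - ∑ n ∈ Finset.Icc 3 lo, 1 / Real.log n := by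
  rw [Finset.sum_Icc_three_eq_add_sum_ite _ hlo h le_rfl, add_sub_cancel_left]
  refine Finset.sum_congr rfl fun n hn => ?_
  rw [if_pos (by rw [Finset.mem_Ico] at hn; omega), one_mul]

/-! ### Passing to the random cutoff. -/

section FirstPseudoPrimes

variable {Ω : Type*} {r : ℕ → Ω → ℝ}

/-- The event that the `N`-th pseudo-prime is not in `[lo, hi]`. -/
def pseudoPrimeNotMem (r : ℕ → Ω → ℝ) (N lo hi : ℕ) : Set Ω :=
  {ω | pseudoCount r (lo - 1) ω < N ∧ N ≤ pseudoCount r hi ω}ᶜ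

/-- The event is phrased through the counting function so as to be measurable outright; it has its
intended meaning where there are infinitely many pseudo-primes. -/
lemma notMem_pseudoPrimeNotMem {ω : Ω} (h : (pseudoPrimes r ω).Infinite) {N lo hi : ℕ}
    (hN : 1 ≤ N) (hlo : 1 ≤ lo) : ω ∉ pseudoPrimeNotMem r N lo hi ↔
      lo ≤ pseudoPrime r N ω ∧ pseudoPrime r N ω ≤ hi := by
  rw [le_pseudoPrime_iff h hN hlo, pseudoPrime_le_iff h hN, pseudoPrimeNotMem, Set.notMem_compl_iff]
  rfl

variable [MeasurableSpace Ω] {P : Measure Ω}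

lemma measurableSet_pseudoPrimeNotMem (hmeas : ∀ n, Measurable (r n)) (N lo hi : ℕ) :
    MeasurableSet (pseudoPrimeNotMem r N lo hi) :=
  ((measurableSet_lt (measurable_pseudoCount hmeas _) measurable_const).inter
    (measurableSet_le measurable_const (measurable_pseudoCount hmeas _))).compl

lemma tendsto_measureReal_pseudoPrimeNotMem [IsProbabilityMeasure P]
    (hmeas : ∀ n, Measurable (r n)) (hindep : iIndepFun r P)
    (hunif : ∀ n, pdf.IsUniform (r n) (Set.Icc 0 1) P volume) {ε : ℝ} (hε : 0 < ε) (hε1 : ε < 1) :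
    Tendsto (fun N : ℕ => P.real (pseudoPrimeNotMem r N ⌊(1 - ε) * (N * Real.log N)⌋₊
      ⌊(1 + ε) * (N * Real.log N)⌋₊)) atTop (𝓝 0) := by
  have h := tendsto_measure_of_ae_tendsto_indicator atTop (μ := P) (A := ∅) (B := Set.univ)
    MeasurableSet.empty (fun N : ℕ => measurableSet_pseudoPrimeNotMem hmeas N
      ⌊(1 - ε) * (N * Real.log N)⌋₊ ⌊(1 + ε) * (N * Real.log N)⌋₊) MeasurableSet.univ
    (measure_ne_top _ _) (.of_forall fun _ => Set.subset_univ _) (by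
      filter_upwards [ae_eventually_pseudoPrime_mem hmeas hindep hunif hε hε1,
        ae_infinite_pseudoPrimes hmeas hindep hunif] with ω hω hinf
      filter_upwards [hω, eventually_ge_atTop 1,
        (tendsto_floor_mul_log_atTop (sub_pos.2 hε1)).eventually_ge_atTop 1] with N hN h1 hlo
      simpa using (notMem_pseudoPrimeNotMem hinf h1 hlo).2 hN)
  rw [measure_empty] at h
  exact (ENNReal.tendsto_toReal ENNReal.zero_ne_top).comp h

/-- Second moment bound for the difference between the centered sum up to the `N`-th pseudo-prime
and the centered sum up to `y`. -/
lemma measureReal_sum_centeredTerm_sub_ge_le [IsProbabilityMeasure P]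
    (hmeas : ∀ n, Measurable (r n)) (hindep : iIndepFun r P)
    (hunif : ∀ n, pdf.IsUniform (r n) (Set.Icc 0 1) P volume) (k : ℕ) (t : ℝ) {N lo hi y : ℕ}
    (hN : 1 ≤ N) (hlo : 2 ≤ lo) (h1 : lo ≤ y) (h2 : y ≤ hi) (c : ℝ) {η : ℝ} (hη : 0 < η) :
    P.real {ω | η ≤ |c * (∑ n ∈ Finset.Icc 3 (pseudoPrime r N ω), centeredTerm P r k t n ω -
      ∑ n ∈ Finset.Icc 3 y, centeredTerm P r k t n ω)|} ≤
    P.real (pseudoPrimeNotMem r N lo hi) +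
      c ^ 2 * (∑ n ∈ Finset.Icc 3 hi, 1 / Real.log n - ∑ n ∈ Finset.Icc 3 lo, 1 / Real.log n) /
        η ^ 2 := by
  classical
  -- The first indicator is that of `n ≤ p'_N`, written so that it visibly depends only on the past
  -- of `n`.
  set a : ℕ → Ω → ℝ := fun n ω => (if pseudoCount r (n - 1) ω < N then 1 else 0) -
    (if n ≤ y then 1 else 0) with ha
  have ham : ∀ n, 1 ≤ n → Measurable[pastSigma r n] (a n) := fun n hn => by
    have hg : Measurable fun x : ℝ => (if x < N then (1 : ℝ) else 0) - (if n ≤ y then 1 else 0) :=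
      (Measurable.ite measurableSet_Iio measurable_const measurable_const).sub_const _
    exact hg.comp (measurable_pseudoCount_pastSigma r (show n - 1 < n by omega))
  set T : Ω → ℝ := fun ω => ∑ n ∈ Finset.Ico (lo + 1) (hi + 1), a n ω * centeredTerm P r k t n ω
    with hT
  have ha1 : ∀ n ω, |a n ω| ≤ 1 := fun n ω => abs_ite_sub_ite_le _ _
  have hTm : Measurable T := Finset.measurable_fun_sum _ fun n hn =>
    ((ham n (by rw [Finset.mem_Ico] at hn; omega)).mono (pastSigma_le hmeas n) le_rfl).mul
      (measurable_centeredTerm hmeas k t n)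
  have hTb : ∀ ω, |T ω| ≤ (Finset.Ico (lo + 1) (hi + 1)).card := fun ω => by
    refine (Finset.abs_sum_le_sum_abs _ _).trans ?_
    refine (Finset.sum_le_card_nsmul _ _ 1 fun n _ => ?_).trans (by simp)
    rw [abs_mul]
    exact mul_le_one₀ (ha1 n ω) (abs_nonneg _) (abs_centeredTerm_le hmeas k t n ω)
  have hTi : Integrable (fun ω => T ω ^ 2) P := by
    refine .of_bound (hTm.pow_const 2).aestronglyMeasurable
      (((Finset.Ico (lo + 1) (hi + 1)).card : ℝ) ^ 2) (.of_forall fun ω => ?_)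
    rw [norm_pow, Real.norm_eq_abs]
    exact pow_le_pow_left₀ (abs_nonneg _) (hTb ω) 2
  have hT2 : ∫ ω, T ω ^ 2 ∂P ≤
      ∑ n ∈ Finset.Icc 3 hi, 1 / Real.log n - ∑ n ∈ Finset.Icc 3 lo, 1 / Real.log n := by
    rw [← sum_Ico_inv_log_eq hlo (h1.trans h2)]
    refine (integral_sq_sum_predictable_le hmeas hindep k t a ham ha1 _ _ (by omega)
      (by omega)).trans (Finset.sum_le_sum fun n hn => ?_)
    exact integral_centeredTerm_sq_le hmeas hunif k t (by rw [Finset.mem_Ico] at hn; omega)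
  have hcheb : P.real {ω | η ^ 2 ≤ c ^ 2 * T ω ^ 2} ≤ c ^ 2 *
      (∑ n ∈ Finset.Icc 3 hi, 1 / Real.log n - ∑ n ∈ Finset.Icc 3 lo, 1 / Real.log n) / η ^ 2 := by
    rw [le_div_iff₀ (by positivity), mul_comm]
    refine (mul_meas_ge_le_integral_of_nonneg (.of_forall fun ω => by positivity)
      (hTi.const_mul _) _).trans ?_
    rw [integral_const_mul]
    gcongr
  refine le_trans ?_ (add_le_add le_rfl hcheb)
  refine le_trans ?_ (measureReal_union_le _ _)
  refine ENNReal.toReal_mono (measure_ne_top _ _) (measure_mono_ae ?_)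
  filter_upwards [ae_infinite_pseudoPrimes hmeas hindep hunif] with ω hinf hω
  by_cases hb : ω ∈ pseudoPrimeNotMem r N lo hi
  · exact Or.inl hb
  right
  rw [notMem_pseudoPrimeNotMem hinf hN (by omega)] at hb
  have hdiff : ∑ n ∈ Finset.Icc 3 (pseudoPrime r N ω), centeredTerm P r k t n ω -
      ∑ n ∈ Finset.Icc 3 y, centeredTerm P r k t n ω = T ω := by
    rw [Finset.sum_Icc_three_sub_eq _ hlo hb.1 hb.2 h1 h2]
    refine Finset.sum_congr rfl fun n hn => ?_
    simp only [ha, le_pseudoPrime_iff hinf hN (show 1 ≤ n by rw [Finset.mem_Ico] at hn; omega)]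
  change η ≤ |c * (_ - _)| at hω
  rw [hdiff] at hω
  change η ^ 2 ≤ c ^ 2 * T ω ^ 2
  rw [← mul_pow, ← sq_abs (c * T ω)]
  exact pow_le_pow_left₀ hη.le hω 2

/-- The normalized difference of the two centered sums tends to zero in probability. -/
lemma tendstoInMeasure_sum_centeredTerm_sub [IsProbabilityMeasure P]
    (hmeas : ∀ n, Measurable (r n)) (hindep : iIndepFun r P)
    (hunif : ∀ n, pdf.IsUniform (r n) (Set.Icc 0 1) P volume) {k : ℕ} (hk : 1 ≤ k) (A : ℕ) :
    TendstoInMeasure P (fun (q : ℕ × ℝ) ω => cltScale k q.1 *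
      (∑ n ∈ Finset.Icc 3 (pseudoPrime r q.1 ω), centeredTerm P r k q.2 n ω -
        ∑ n ∈ Finset.Icc 3 ⌊(q.1 : ℝ) * Real.log q.1⌋₊, centeredTerm P r k q.2 n ω))
      (jointLimit A) 0 := by
  rw [tendstoInMeasure_iff_measureReal_norm]
  intro η hη
  simp only [Pi.zero_apply, sub_zero, Real.norm_eq_abs]
  have hs := totient_div_pos hk
  set s2 := (k.totient : ℝ) / (2 * (k : ℝ)) with hs2
  have hscale : Tendsto (fun N : ℕ => cltScale k N ^ 2 * N) atTop (𝓝 (1 / s2)) := by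
    have h := (tendsto_log_log_div_log.const_add 1).div_const s2
    rw [add_zero] at h
    refine h.congr' ?_
    filter_upwards [eventually_ge_atTop 3] with N hN
    have : (N : ℝ) ≠ 0 := by
      have : N ≠ 0 := by omega
      exact_mod_cast this
    rw [cltScale_sq hk hN, ← hs2, div_mul_eq_mul_div, mul_div_mul_right _ _ this]
  rw [Metric.tendsto_nhds]
  intro δ hδ
  -- The left side of the last inequality is the limit of the second moment bound for the window `(1
  -- ± ε) N log N`.
  obtain ⟨ε, hε, hε1, hεδ⟩ : ∃ ε : ℝ, 0 < ε ∧ ε < 1 ∧ 1 / s2 * (2 * ε) / η ^ 2 < δ := by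
    refine ⟨min (1 / 2) (δ * η ^ 2 * s2 / 4), by positivity,
      (min_le_left _ _).trans_lt (by norm_num), ?_⟩
    calc 1 / s2 * (2 * min (1 / 2) (δ * η ^ 2 * s2 / 4)) / η ^ 2
        ≤ 1 / s2 * (2 * (δ * η ^ 2 * s2 / 4)) / η ^ 2 := by
          gcongr
          exact min_le_right _ _
      _ = δ / 2 := by field_simp; norm_num
      _ < δ := by linarith
  have hW := (tendsto_sum_inv_log_div (show 0 < 1 + ε by linarith)).sub
    (tendsto_sum_inv_log_div (show 0 < 1 - ε by linarith))
  have hlim := (tendsto_measureReal_pseudoPrimeNotMem hmeas hindep hunif hε hε1).add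
    ((hscale.mul hW).div_const (η ^ 2))
  rw [zero_add, show 1 + ε - (1 - ε) = 2 * ε by ring] at hlim
  -- The bound does not involve `t`, so `N → ∞` alone suffices.
  have hev : ∀ᶠ N : ℕ in atTop, ∀ t : ℝ, P.real {ω | η ≤ |cltScale k N *
      (∑ n ∈ Finset.Icc 3 (pseudoPrime r N ω), centeredTerm P r k t n ω -
        ∑ n ∈ Finset.Icc 3 ⌊(N : ℝ) * Real.log N⌋₊, centeredTerm P r k t n ω)|} < δ := by
    filter_upwards [hlim.eventually (gt_mem_nhds hεδ), eventually_ge_atTop 3,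
      (tendsto_floor_mul_log_atTop (sub_pos.2 hε1)).eventually_ge_atTop 2] with N hN hN3 hlo t
    have hL := one_le_log_of_three_le hN3
    have hN0 : (0 : ℝ) < N := by
      have : 0 < N := by omega
      exact_mod_cast this
    have hNL : 0 ≤ N * Real.log N := by positivity
    refine lt_of_le_of_lt ?_ hN
    refine (measureReal_sum_centeredTerm_sub_ge_le hmeas hindep hunif k t (by omega) hlo
      (Nat.floor_le_floor (mul_le_of_le_one_left (a := 1 - ε) hNL (by linarith)))
    (Nat.floor_le_floor (le_mul_of_one_le_left (a := 1 + ε) hNL (by linarith))) (cltScale k N)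
      hη).trans (le_of_eq ?_)
    rw [← sub_div, mul_assoc, mul_div_cancel₀ _ hN0.ne']
  filter_upwards [(tendsto_fst_jointLimit A).eventually hev] with q hq
  rw [dist_zero_right, Real.norm_of_nonneg measureReal_nonneg]
  exact hq q.2

lemma aemeasurable_pseudoPrimeCosSum_sub [IsProbabilityMeasure P]
    (hmeas : ∀ n, Measurable (r n)) (hindep : iIndepFun r P)
    (hunif : ∀ n, pdf.IsUniform (r n) (Set.Icc 0 1) P volume) (k N : ℕ) (t : ℝ) :
    AEMeasurable (fun ω => pseudoPrimeCosSum r k N t ω -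
      sumOfMeans P r k t (pseudoPrime r N ω)) P := by
  classical
  have hp := aemeasurable_pseudoPrime hmeas hindep hunif
  have h : ∀ (g : ℕ → ℝ) (j : ℕ), AEMeasurable (fun ω => g (pseudoPrime r j ω)) P := fun g j =>
    (measurable_from_nat (f := g)).comp_aemeasurable (hp j)
  refine AEMeasurable.sub ?_ (h _ N)
  have heq : pseudoPrimeCosSum r k N t = fun ω => ∑ j ∈ Finset.Icc 1 N,
      if (pseudoPrime r j ω).Coprime k then Real.cos (t * Real.log (pseudoPrime r j ω)) else 0 := by
    funext ω
    rw [pseudoPrimeCosSum, Finset.sum_filter]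
  rw [heq]
  exact Finset.aemeasurable_fun_sum _ fun j _ =>
    h (fun n => if n.Coprime k then Real.cos (t * Real.log n) else 0) j

/-- The central limit theorem for the sum over the first `N` pseudo-primes. -/
theorem tendstoInDistribution_pseudoPrimeCosSum [IsProbabilityMeasure P]
    (hmeas : ∀ n, Measurable (r n)) (hindep : iIndepFun r P)
    (hunif : ∀ n, pdf.IsUniform (r n) (Set.Icc 0 1) P volume) {k : ℕ} (hk : 1 ≤ k) (A : ℕ) :
    TendstoInDistribution
      (fun (q : ℕ × ℝ) (ω : Ω) => cltScale k q.1 *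
        (pseudoPrimeCosSum r k q.1 q.2 ω - sumOfMeans P r k q.2 (pseudoPrime r q.1 ω)))
      (jointLimit A) (id : ℝ → ℝ) (fun _ => P) (gaussianReal 0 1) := by
  -- Slutsky: the two normalized sums differ by a quantity tending to zero in probability.
  refine tendstoInDistribution_of_tendstoInMeasure_sub _ _
    (tendstoInDistribution_cutoffCosSum hmeas hindep hunif hk A) ?_ fun q =>
    (aemeasurable_pseudoPrimeCosSum_sub hmeas hindep hunif k q.1 q.2).const_mul _
  have h := tendstoInMeasure_sum_centeredTerm_sub hmeas hindep hunif hk A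
  refine h.congr' ?_ .rfl
  filter_upwards [(tendsto_fst_jointLimit A).eventually_ge_atTop 1] with q hq
  filter_upwards [ae_infinite_pseudoPrimes hmeas hindep hunif] with ω hinf
  simp only [Pi.sub_apply]
  rw [pseudoPrimeCosSum_eq_cutoffCosSum hinf k hq, cutoffCosSum_sub_sumOfMeans,
    integral_cutoffCosSum hmeas, cutoffCosSum_sub_sumOfMeans]
  ring

/-- Almost surely the sum of means up to the `N`-th pseudo-prime differs by `o(N)` from the sum of
means up to `N log N`. -/
lemma ae_tendsto_sumOfMeans_pseudoPrime_sub_div [IsProbabilityMeasure P]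
    (hmeas : ∀ n, Measurable (r n)) (hindep : iIndepFun r P)
    (hunif : ∀ n, pdf.IsUniform (r n) (Set.Icc 0 1) P volume) (k : ℕ) (t : ℝ) :
    ∀ᵐ ω ∂P, Tendsto (fun N : ℕ => (sumOfMeans P r k t (pseudoPrime r N ω) -
      sumOfMeans P r k t ⌊(N : ℝ) * Real.log N⌋₊) / (N : ℝ)) atTop (𝓝 0) := by
  have h1 : ∀ j : ℕ, (0 : ℝ) < 1 / ((j : ℝ) + 1 + 1) := fun j => by positivity
  have h2 : ∀ j : ℕ, 1 / ((j : ℝ) + 1 + 1) < 1 := fun j => by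
    rw [div_lt_one (by positivity)]
    have := Nat.cast_nonneg (α := ℝ) j
    linarith
  filter_upwards [ae_all_iff.2 fun j =>
    ae_eventually_pseudoPrime_mem hmeas hindep hunif (h1 j) (h2 j)] with ω hω
  rw [Metric.tendsto_nhds]
  intro δ hδ
  obtain ⟨j, hj⟩ := exists_nat_one_div_lt (show 0 < δ / 2 by positivity)
  set ε : ℝ := 1 / ((j : ℝ) + 1 + 1) with hε
  have hεδ : 2 * ε < δ := by
    have : ε ≤ 1 / ((j : ℝ) + 1) := by
      rw [hε]
      gcongr
      linarith
    linarith
  have hε0 : 0 < ε := h1 j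
  have hε1 : ε < 1 := h2 j
  have hW := (tendsto_sum_inv_log_div (show 0 < 1 + ε by linarith)).sub
    (tendsto_sum_inv_log_div (show 0 < 1 - ε by linarith))
  rw [show 1 + ε - (1 - ε) = 2 * ε by ring] at hW
  filter_upwards [hW.eventually (gt_mem_nhds hεδ), hω j, eventually_ge_atTop 3,
      (tendsto_floor_mul_log_atTop (sub_pos.2 hε1)).eventually_ge_atTop 2] with N hN hp hN3 hlo
  have hL := one_le_log_of_three_le hN3
  have hN0 : (0 : ℝ) < N := by
    have : 0 < N := by omega
    exact_mod_cast this
  have hNL : 0 ≤ N * Real.log N := by positivity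
  rw [dist_zero_right, norm_div, Real.norm_natCast]
  refine lt_of_le_of_lt ?_ hN
  rw [← sub_div]
  gcongr
  -- Both cutoffs lie in the window, and each mean is at most `1 / log n` in absolute value, so the
  -- difference is at most the weight of the window, about `2 ε N`.
  rw [sumOfMeans, sumOfMeans, Finset.sum_Icc_three_sub_eq _ hlo hp.1 hp.2
    (Nat.floor_le_floor (mul_le_of_le_one_left (a := 1 - ε) hNL (by linarith)))
    (Nat.floor_le_floor (le_mul_of_one_le_left (a := 1 + ε) hNL (by linarith))),
    ← sum_Ico_inv_log_eq hlo (hp.1.trans hp.2)]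
  refine norm_sum_le_of_le _ fun n hn => ?_
  have hn3 : 3 ≤ n := by rw [Finset.mem_Ico] at hn; omega
  have hLn := one_le_log_of_three_le hn3
  rw [norm_mul, Real.norm_eq_abs, integral_mul_const, norm_mul, Real.norm_eq_abs, Real.norm_eq_abs,
    abs_of_nonneg (integral_cramerIndicator_mem_Icc hmeas k n).1]
  refine (mul_le_of_le_one_left (by
    have := (integral_cramerIndicator_mem_Icc (P := P) hmeas k n).1
    positivity) (abs_ite_sub_ite_le _ _)).trans ?_
  refine (mul_le_of_le_one_right (integral_cramerIndicator_mem_Icc hmeas k n).1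
    (Real.abs_cos_le_one _)).trans ?_
  rw [integral_cramerIndicator hmeas hunif k hn3]
  split_ifs
  · exact le_rfl
  · positivity

end FirstPseudoPrimes

/-! ### The exponential integral and partial summation. -/

/-- The exponential series without its constant term, divided by `z`; this is the termwise
derivative of the series in `expIntegralEi`. -/
lemma Complex.hasSum_pow_div_factorial_succ {z : ℂ} (hz : z ≠ 0) :
    HasSum (fun n : ℕ => z ^ n / ((n + 1).factorial : ℂ)) ((Complex.exp z - 1) / z) := by
  have h := NormedSpace.expSeries_div_hasSum_exp z
  rw [← Complex.exp_eq_exp_ℂ, ← hasSum_nat_add_iff' 1] at h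
  simp only [Finset.range_one, Finset.sum_singleton, pow_zero, Nat.factorial_zero, Nat.cast_one,
    div_one] at h
  refine (h.div_const z).congr_fun fun n => ?_
  field_simp
  ring

/-- Termwise differentiation is justified on the ball of radius `R = ‖z‖ + 1`, where the derivatives
are dominated by `R ^ n / n!`. -/
lemma hasDerivAt_expIntegralEi_series {z : ℂ} (hz : z ≠ 0) :
    HasDerivAt (fun z : ℂ => ∑' n : ℕ, z ^ (n + 1) / (((n + 1 : ℕ) : ℂ) * ((n + 1).factorial : ℂ)))
      ((Complex.exp z - 1) / z) z := by
  rw [← (Complex.hasSum_pow_div_factorial_succ hz).tsum_eq]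
  refine hasDerivAt_tsum_of_isPreconnected (t := Metric.ball (0 : ℂ) (‖z‖ + 1)) (y₀ := 0)
    (Real.summable_pow_div_factorial (‖z‖ + 1)) Metric.isOpen_ball
    (convex_ball _ _).isPreconnected (g' := fun n y => y ^ n / ((n + 1).factorial : ℂ))
    ?_ ?_ (Metric.mem_ball_self (by positivity)) ?_ (show z ∈ _ by simp)
  · intro n y _
    have h := ((hasDerivAt_pow (n + 1) y).div_const
      (((n + 1 : ℕ) : ℂ) * ((n + 1).factorial : ℂ)))
    convert! h using 1
    have h1 : ((n + 1 : ℕ) : ℂ) ≠ 0 := Nat.cast_ne_zero.2 n.succ_ne_zero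
    rw [Nat.add_sub_cancel, mul_div_mul_left _ _ h1]
  · intro n y hy
    rw [mem_ball_zero_iff] at hy
    rw [norm_div, norm_pow, Complex.norm_natCast]
    have : (n.factorial : ℝ) ≤ (n + 1).factorial := by
      exact_mod_cast Nat.factorial_le n.le_succ
    gcongr
  · simp

lemma hasDerivAt_expIntegralEi {z : ℂ} (hz : z ∈ Complex.slitPlane) :
    HasDerivAt expIntegralEi (Complex.exp z / z) z := by
  have hz0 := Complex.slitPlane_ne_zero hz
  have h := ((hasDerivAt_const z (Real.eulerMascheroniConstant : ℂ)).add
    (Complex.hasDerivAt_log hz)).add (hasDerivAt_expIntegralEi_series hz0)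
  convert! h using 1
  field_simp
  ring

/-- The real part of `Ei ((1 + i t) log x)` is a primitive of `cos (t log x) / log x`. -/
lemma hasDerivAt_re_expIntegralEi (t : ℝ) {x : ℝ} (hx : 1 < x) :
    HasDerivAt (fun x : ℝ => (expIntegralEi ((1 + (t : ℂ) * Complex.I) *
      ((Real.log x : ℝ) : ℂ))).re) (Real.cos (t * Real.log x) / Real.log x) x := by
  have hL := Real.log_pos hx
  have hre : ((1 + (t : ℂ) * Complex.I) * ((Real.log x : ℝ) : ℂ)).re = Real.log x := by simp
  have him : ((1 + (t : ℂ) * Complex.I) * ((Real.log x : ℝ) : ℂ)).im = t * Real.log x := by simp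
  have hmem : (1 + (t : ℂ) * Complex.I) * ((Real.log x : ℝ) : ℂ) ∈ Complex.slitPlane :=
    Or.inl (by rw [hre]; exact hL)
  have hlog : HasDerivAt (fun x : ℝ => ((Real.log x : ℝ) : ℂ)) ((x⁻¹ : ℝ) : ℂ) x :=
    (Real.hasDerivAt_log (by positivity)).ofReal_comp
  have h := (hasDerivAt_expIntegralEi hmem).comp x
    (hlog.const_mul (1 + (t : ℂ) * Complex.I))
  have h2 := (Complex.reCLM.hasFDerivAt.comp_hasDerivAt x h)
  convert! h2 using 1
  have hne : (1 + (t : ℂ) * Complex.I) ≠ 0 := by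
    intro h0
    have := congrArg Complex.re h0
    simp at this
  have hL' : ((Real.log x : ℝ) : ℂ) ≠ 0 := by exact_mod_cast hL.ne'
  -- The factor `1 + it` from the chain rule cancels the one in the denominator, and `exp ((1 + it)
  -- log x)` has real part `x cos (t log x)`.
  have hval : Complex.exp ((1 + (t : ℂ) * Complex.I) * ((Real.log x : ℝ) : ℂ)) /
      ((1 + (t : ℂ) * Complex.I) * ((Real.log x : ℝ) : ℂ)) *
        ((1 + (t : ℂ) * Complex.I) * ((x⁻¹ : ℝ) : ℂ)) =
      (((Real.log x)⁻¹ * x⁻¹ : ℝ) : ℂ) *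
        Complex.exp ((1 + (t : ℂ) * Complex.I) * ((Real.log x : ℝ) : ℂ)) := by
    push_cast
    field_simp
  rw [hval, Complex.reCLM_apply, Complex.re_ofReal_mul, Complex.exp_re, hre, him,
    Real.exp_log (by positivity)]
  field_simp

/-- The derivative of `cos (t log x) / log x`. -/
noncomputable def derivCosDivLog (t x : ℝ) : ℝ :=
  (-(Real.sin (t * Real.log x)) * (t * x⁻¹) * Real.log x - Real.cos (t * Real.log x) * x⁻¹) /
    Real.log x ^ 2

lemma hasDerivAt_cos_div_log (t : ℝ) {x : ℝ} (hx : 1 < x) :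
    HasDerivAt (fun x : ℝ => Real.cos (t * Real.log x) / Real.log x) (derivCosDivLog t x) x := by
  have hL := Real.log_pos hx
  have hlog := Real.hasDerivAt_log (show x ≠ 0 by positivity)
  exact (hlog.const_mul t).cos.div hlog hL.ne'

lemma continuousOn_derivCosDivLog (t : ℝ) : ContinuousOn (derivCosDivLog t) (Set.Ioi 1) := by
  have hlog : ContinuousOn Real.log (Set.Ioi 1) :=
    Real.continuousOn_log.mono fun x hx => by
      have : (1 : ℝ) < x := hx
      simp only [Set.mem_compl_iff, Set.mem_singleton_iff]
      positivity
  have hinv : ContinuousOn (fun x : ℝ => x⁻¹) (Set.Ioi 1) :=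
    continuousOn_inv₀.mono fun x hx => by
      have : (1 : ℝ) < x := hx
      simp only [Set.mem_compl_iff, Set.mem_singleton_iff]
      positivity
  have htl : ContinuousOn (fun x => t * Real.log x) (Set.Ioi 1) := hlog.const_mul t
  unfold derivCosDivLog
  refine ContinuousOn.div ?_ (hlog.pow 2) fun x hx => pow_ne_zero _ (Real.log_pos hx).ne'
  exact (((Real.continuous_sin.comp_continuousOn htl).neg.mul (hinv.const_mul t)).mul hlog).sub
    ((Real.continuous_cos.comp_continuousOn htl).mul hinv)

lemma abs_derivCosDivLog_le (t : ℝ) {x : ℝ} (hx : 2 ≤ x) :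
    |derivCosDivLog t x| ≤ (|t| / Real.log 2 + 1 / Real.log 2 ^ 2) * (1 / x) := by
  have h2 : 0 < Real.log 2 := Real.log_pos one_lt_two
  have hL : Real.log 2 ≤ Real.log x := Real.log_le_log two_pos hx
  have hL0 : 0 < Real.log x := h2.trans_le hL
  have hx0 : 0 < x := by linarith
  have heq : derivCosDivLog t x = (-(Real.sin (t * Real.log x) * (t / Real.log x)) -
      Real.cos (t * Real.log x) * (1 / Real.log x ^ 2)) * (1 / x) := by
    unfold derivCosDivLog
    field_simp
  rw [heq, abs_mul, abs_of_pos (show 0 < 1 / x by positivity)]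
  gcongr
  refine (abs_sub _ _).trans ?_
  rw [abs_neg, abs_mul, abs_mul, abs_div, abs_of_pos hL0,
    abs_of_pos (show 0 < 1 / Real.log x ^ 2 by positivity)]
  refine add_le_add ((mul_le_of_le_one_left (by positivity) (Real.abs_sin_le_one _)).trans ?_)
    ((mul_le_of_le_one_left (by positivity) (Real.abs_cos_le_one _)).trans ?_)
  · gcongr
  · gcongr

/-- The extra `1` pays for replacing `⌊x⌋ + 1` by `x`. -/
lemma abs_sum_Icc_coprime_sub_le {k : ℕ} (hk : 1 ≤ k) {x : ℝ} (hx : 0 ≤ x) :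
    |∑ n ∈ Finset.Icc 0 ⌊x⌋₊, (if n.Coprime k then (1 : ℝ) else 0) -
      (k.totient : ℝ) / k * x| ≤ k + 1 := by
  have h := abs_card_coprime_sub_le hk (⌊x⌋₊ + 1)
  have hs : ∑ n ∈ Finset.Icc 0 ⌊x⌋₊, (if n.Coprime k then (1 : ℝ) else 0) =
      ((Finset.range (⌊x⌋₊ + 1)).filter (·.Coprime k)).card := by
    rw [Finset.sum_boole, Nat.range_succ_eq_Icc_zero]
  have hk0 : (0 : ℝ) < k := by exact_mod_cast hk
  have hκ0 : 0 ≤ (k.totient : ℝ) / k := by positivity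
  have hκ1 : (k.totient : ℝ) / k ≤ 1 := by
    rw [div_le_one hk0]
    exact_mod_cast Nat.totient_le k
  have h1 := Nat.floor_le hx
  have h2 := Nat.lt_floor_add_one x
  rw [hs]
  rw [abs_le] at h ⊢
  push_cast at h
  constructor <;> nlinarith

/-- Partial summation of `cos (t log n) / log n` over the integers coprime to `k`. -/
lemma exists_abs_sum_coprime_sub_le {k : ℕ} (hk : 1 ≤ k) (t : ℝ) :
    ∃ K : ℝ, ∀ b : ℝ, 2 ≤ b →
      |∑ n ∈ Finset.Icc 3 ⌊b⌋₊, Real.cos (t * Real.log n) / Real.log n *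
          (if n.Coprime k then 1 else 0) -
        (k.totient : ℝ) / k * (expIntegralEi ((1 + (t : ℂ) * Complex.I) *
          ((Real.log b : ℝ) : ℂ))).re| ≤ K * (1 + Real.log b) := by
  set f : ℝ → ℝ := fun x => Real.cos (t * Real.log x) / Real.log x with hf
  set H : ℝ → ℝ := fun x => (expIntegralEi ((1 + (t : ℂ) * Complex.I) *
    ((Real.log x : ℝ) : ℂ))).re with hH
  set κ : ℝ := (k.totient : ℝ) / k with hκ
  set c : ℕ → ℝ := fun n => if n.Coprime k then 1 else 0 with hc
  set D : ℝ := |t| / Real.log 2 + 1 / Real.log 2 ^ 2 with hD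
  set E : ℝ → ℝ := fun x => ∑ n ∈ Finset.Icc 0 ⌊x⌋₊, c n - κ * x with hE
  have h2 : 0 < Real.log 2 := Real.log_pos one_lt_two
  have hD0 : 0 ≤ D := by positivity
  have hEb : ∀ x, 0 ≤ x → |E x| ≤ k + 1 := fun x hx => abs_sum_Icc_coprime_sub_le hk hx
  have hfb : ∀ x, 2 ≤ x → |f x| ≤ 1 / Real.log 2 := fun x hx => by
    have hL : Real.log 2 ≤ Real.log x := Real.log_le_log two_pos hx
    rw [hf]
    simp only
    rw [abs_div, abs_of_pos (h2.trans_le hL)]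
    gcongr
    exact Real.abs_cos_le_one _
  refine ⟨|κ * H 2| + 2 * (1 / Real.log 2 * (k + 1)) + (k + 1) * D, fun b hb => ?_⟩
  have hsub : Set.Icc 2 b ⊆ Set.Ioi (1 : ℝ) := fun x hx => by
    have := hx.1
    exact lt_of_lt_of_le one_lt_two this
  have hder : ∀ x ∈ Set.Icc 2 b, HasDerivAt f (derivCosDivLog t x) x := fun x hx =>
    hasDerivAt_cos_div_log t (hsub hx)
  have hcont := (continuousOn_derivCosDivLog t).mono hsub
  have hint : IntegrableOn (derivCosDivLog t) (Set.Icc 2 b) := hcont.integrableOn_Icc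
  have habel := sum_mul_eq_sub_sub_integral_mul c (f := f) zero_le_two hb
    (fun x hx => (hder x hx).differentiableAt)
    (hint.congr_fun (fun x hx => (hder x hx).deriv.symm) measurableSet_Icc)
  have hI : ∫ x in Set.Ioc 2 b, deriv f x * ∑ n ∈ Finset.Icc 0 ⌊x⌋₊, c n =
      ∫ x in Set.Ioc 2 b, derivCosDivLog t x * ∑ n ∈ Finset.Icc 0 ⌊x⌋₊, c n :=
    setIntegral_congr_fun measurableSet_Ioc fun x hx => by
      simp only [(hder x (Set.Ioc_subset_Icc_self hx)).deriv]
  have hint1 : IntegrableOn (fun x => derivCosDivLog t x * ∑ n ∈ Finset.Icc 0 ⌊x⌋₊, c n)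
      (Set.Ioc 2 b) :=
    (integrableOn_mul_sum_Icc c zero_le_two hint).mono_set Set.Ioc_subset_Icc_self
  have hint2 : IntegrableOn (fun x => derivCosDivLog t x * (κ * x)) (Set.Ioc 2 b) :=
    ((hcont.mul (continuousOn_id.const_mul κ)).integrableOn_Icc).mono_set Set.Ioc_subset_Icc_self
  -- The counting function is `κ x` plus a bounded error `E`; the linear part produces the main
  -- term.
  have hsplit : ∫ x in Set.Ioc 2 b, derivCosDivLog t x * ∑ n ∈ Finset.Icc 0 ⌊x⌋₊, c n =
      (∫ x in Set.Ioc 2 b, derivCosDivLog t x * (κ * x)) +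
        ∫ x in Set.Ioc 2 b, derivCosDivLog t x * E x := by
    have : ∀ x, derivCosDivLog t x * E x = derivCosDivLog t x * ∑ n ∈ Finset.Icc 0 ⌊x⌋₊, c n -
        derivCosDivLog t x * (κ * x) := fun x => by rw [hE]; ring
    simp only [this]
    rw [integral_sub hint1 hint2]
    ring
  -- Since `H' = f`, the function `x f - H` is a primitive of `x f'`.
  have hmain : ∫ x in Set.Ioc 2 b, derivCosDivLog t x * (κ * x) =
      κ * (b * f b - H b) - κ * (2 * f 2 - H 2) := by
    rw [← intervalIntegral.integral_of_le hb]
    refine intervalIntegral.integral_eq_sub_of_hasDerivAt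
      (f := fun x => κ * (x * f x - H x)) (fun x hx => ?_)
      ((intervalIntegrable_iff_integrableOn_Ioc_of_le hb).2 hint2)
    rw [Set.uIcc_of_le hb] at hx
    have h := (((hasDerivAt_id x).mul (hder x hx)).sub
      (hasDerivAt_re_expIntegralEi t (hsub hx))).const_mul κ
    convert! h using 1
    simp only [hf, id]
    ring
  -- Here `f' = O(1 / x)` for fixed `t` while `E` is bounded, hence the logarithm.
  have herr : |∫ x in Set.Ioc 2 b, derivCosDivLog t x * E x| ≤ (k + 1) * D * Real.log b := by
    have hbound : ∀ x ∈ Set.Ioc 2 b, ‖derivCosDivLog t x * E x‖ ≤ (k + 1) * D * (1 / x) :=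
      fun x hx => by
        rw [norm_mul, Real.norm_eq_abs, Real.norm_eq_abs]
        have h3 := abs_derivCosDivLog_le t hx.1.le
        have h4 := hEb x (by linarith [hx.1])
        have h5 : 0 < 1 / x := by
          have := hx.1
          positivity
        calc _ ≤ D * (1 / x) * (k + 1) := mul_le_mul h3 h4 (abs_nonneg _) (by positivity)
          _ = _ := by ring
    have hgi : IntegrableOn (fun x : ℝ => (k + 1) * D * (1 / x)) (Set.Ioc 2 b) := by
      refine (ContinuousOn.integrableOn_Icc ?_).mono_set Set.Ioc_subset_Icc_self
      refine (continuousOn_const.div continuousOn_id fun x hx => ?_).const_mul _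
      have := hsub hx
      simp only [Set.mem_Ioi] at this
      simp only [id]
      positivity
    have h := norm_integral_le_of_norm_le hgi
      ((ae_restrict_iff' measurableSet_Ioc).2 (.of_forall hbound))
    rw [Real.norm_eq_abs] at h
    refine h.trans ?_
    rw [integral_const_mul, ← intervalIntegral.integral_of_le hb,
      integral_one_div_of_pos two_pos (by linarith), Real.log_div (by linarith) two_ne_zero]
    gcongr
    linarith
  have hset : Finset.Ioc ⌊(2 : ℝ)⌋₊ ⌊b⌋₊ = Finset.Icc 3 ⌊b⌋₊ := by
    rw [Nat.floor_ofNat]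
    rfl
  have hb0 : (0 : ℝ) ≤ b := by linarith
  have hcb : ∑ n ∈ Finset.Icc 0 ⌊b⌋₊, c n = κ * b + E b := by rw [hE]; ring
  have hc2 : ∑ n ∈ Finset.Icc 0 ⌊(2 : ℝ)⌋₊, c n = κ * 2 + E 2 := by rw [hE]; ring
  rw [hset, hcb, hc2, hI, hsplit, hmain] at habel
  change |∑ n ∈ Finset.Icc 3 ⌊b⌋₊, f n * c n - κ * H b| ≤ _
  rw [habel]
  have hLb : 0 ≤ Real.log b := Real.log_nonneg (by linarith)
  have e1 : |f b * E b| ≤ 1 / Real.log 2 * (k + 1) := by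
    rw [abs_mul]
    exact mul_le_mul (hfb b hb) (hEb b hb0) (abs_nonneg _) (by positivity)
  have e2 : |f 2 * E 2| ≤ 1 / Real.log 2 * (k + 1) := by
    rw [abs_mul]
    exact mul_le_mul (hfb 2 le_rfl) (hEb 2 zero_le_two) (abs_nonneg _) (by positivity)
  set J := ∫ x in Set.Ioc 2 b, derivCosDivLog t x * E x
  have heq : f b * (κ * b + E b) - f 2 * (κ * 2 + E 2) -
      (κ * (b * f b - H b) - κ * (2 * f 2 - H 2) + J) - κ * H b =
      f b * E b - f 2 * E 2 - J - κ * H 2 := by ring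
  rw [heq]
  have hQ : 0 ≤ 1 / Real.log 2 * ((k : ℝ) + 1) := by positivity
  have hP : 0 ≤ ((k : ℝ) + 1) * D := by positivity
  have hR := abs_nonneg (κ * H 2)
  calc |f b * E b - f 2 * E 2 - J - κ * H 2|
      ≤ |f b * E b| + |f 2 * E 2| + |J| + |κ * H 2| :=
        (abs_sub _ _).trans (by gcongr; exact (abs_sub _ _).trans (by gcongr; exact abs_sub _ _))
    _ ≤ 1 / Real.log 2 * (k + 1) + 1 / Real.log 2 * (k + 1) + (k + 1) * D * Real.log b +
        |κ * H 2| := by gcongr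
    _ ≤ _ := by nlinarith [mul_nonneg hQ hLb, mul_nonneg hP hLb, mul_nonneg hR hLb]

lemma tendsto_one_add_log_mul_log_div_sqrt :
    Tendsto (fun N : ℕ => (1 + Real.log (N * Real.log N)) / √(N : ℝ)) atTop (𝓝 0) := by
  have h1 : Tendsto (fun N : ℕ => Real.log N / √(N : ℝ)) atTop (𝓝 0) := by
    have h := (isLittleO_log_rpow_atTop (r := 1 / 2) (by norm_num)).tendsto_div_nhds_zero
    refine (h.comp tendsto_natCast_atTop_atTop).congr fun N => ?_
    simp only [Function.comp, Real.sqrt_eq_rpow]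
  have h2 := h1.const_mul 3
  rw [mul_zero] at h2
  refine squeeze_zero' ?_ ?_ h2
  · filter_upwards [eventually_ge_atTop 3] with N hN
    have hL := one_le_log_of_three_le hN
    have hN1 : (1 : ℝ) ≤ N := by
      have : 1 ≤ N := by omega
      exact_mod_cast this
    have := Real.log_nonneg (show 1 ≤ N * Real.log N by nlinarith)
    positivity
  · filter_upwards [eventually_ge_atTop 3] with N hN
    have hL := one_le_log_of_three_le hN
    have hN0 : (0 : ℝ) < N := by
      have : 0 < N := by omega
      exact_mod_cast this
    rw [← mul_div_assoc]
    gcongr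
    rw [Real.log_mul hN0.ne' (by linarith)]
    have := Real.log_le_sub_one_of_pos (show 0 < Real.log N by linarith)
    linarith

/-! ### The means and their main term. -/

section Means

variable {Ω : Type*} {r : ℕ → Ω → ℝ} [MeasurableSpace Ω] {P : Measure Ω}

/-- The sum of means up to `N log N` is the main term up to `o(√N)`. -/
lemma tendsto_sumOfMeans_sub_meanMainTerm_div_sqrt [IsProbabilityMeasure P]
    (hmeas : ∀ n, Measurable (r n))
    (hunif : ∀ n, pdf.IsUniform (r n) (Set.Icc 0 1) P volume) {k : ℕ} (hk : 1 ≤ k) (t : ℝ) :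
    Tendsto (fun N : ℕ => (sumOfMeans P r k t ⌊(N : ℝ) * Real.log N⌋₊ - meanMainTerm k N t) /
      √(N : ℝ)) atTop (𝓝 0) := by
  obtain ⟨K, hK⟩ := exists_abs_sum_coprime_sub_le hk t
  have h := tendsto_one_add_log_mul_log_div_sqrt.const_mul K
  rw [mul_zero] at h
  refine squeeze_zero_norm' ?_ h
  filter_upwards [eventually_ge_atTop 3] with N hN
  have hL := one_le_log_of_three_le hN
  have hN3 : (3 : ℝ) ≤ N := by exact_mod_cast hN
  rw [norm_div, Real.norm_of_nonneg (Real.sqrt_nonneg _), ← mul_div_assoc]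
  gcongr
  rw [Real.norm_eq_abs]
  convert! hK (N * Real.log N) (by nlinarith) using 3
  rw [sumOfMeans_eq]
  refine Finset.sum_congr rfl fun n hn => ?_
  rw [integral_cramerIndicator hmeas hunif k (Finset.mem_Icc.1 hn).1]
  split_ifs
  · ring
  · ring

/-- Almost surely the sum of means up to the `N`-th pseudo-prime is the main term up to `o(N)`. -/
lemma ae_tendsto_sumOfMeans_pseudoPrime_sub_meanMainTerm_div [IsProbabilityMeasure P]
    (hmeas : ∀ n, Measurable (r n)) (hindep : iIndepFun r P)
    (hunif : ∀ n, pdf.IsUniform (r n) (Set.Icc 0 1) P volume) {k : ℕ} (hk : 1 ≤ k) (t : ℝ) :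
    ∀ᵐ ω ∂P, Tendsto
      (fun N : ℕ => (sumOfMeans P r k t (pseudoPrime r N ω) - meanMainTerm k N t) / (N : ℝ))
      atTop (𝓝 0) := by
  have hsqrt : Tendsto (fun N : ℕ => 1 / √(N : ℝ)) atTop (𝓝 0) :=
    (Real.tendsto_sqrt_atTop.comp tendsto_natCast_atTop_atTop).const_div_atTop 1
  have h1 := (tendsto_sumOfMeans_sub_meanMainTerm_div_sqrt (P := P) hmeas hunif hk t).mul hsqrt
  rw [mul_zero] at h1
  filter_upwards [ae_tendsto_sumOfMeans_pseudoPrime_sub_div hmeas hindep hunif k t] with ω hω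
  have h2 := hω.add h1
  rw [add_zero] at h2
  refine h2.congr fun N => ?_
  rw [div_mul_div_comm, mul_one, Real.mul_self_sqrt (Nat.cast_nonneg N)]
  ring

end Means

theorem theorem4 {Ω : Type*} [MeasurableSpace Ω] (P : Measure Ω) [IsProbabilityMeasure P]
    (r : ℕ → Ω → ℝ) (hmeas : ∀ n, Measurable (r n)) (hindep : iIndepFun r P)
    (hunif : ∀ n, pdf.IsUniform (r n) (Set.Icc 0 1) P volume)
    (k : ℕ) (hk : 1 ≤ k) :
    -- the sum over the first `N` pseudo-primes, centered at `∑_{n ≤ p'_N} μ_n`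
    (∀ A : ℕ, TendstoInDistribution
      (fun (q : ℕ × ℝ) (ω : Ω) => cltScale k q.1 *
        (pseudoPrimeCosSum r k q.1 q.2 ω - sumOfMeans P r k q.2 (pseudoPrime r q.1 ω)))
      (jointLimit A) (id : ℝ → ℝ) (fun _ => P) (gaussianReal 0 1)) ∧
    (∀ t : ℝ, ∀ᵐ ω ∂P, Tendsto
      (fun N : ℕ => (sumOfMeans P r k t (pseudoPrime r N ω) - meanMainTerm k N t) / (N : ℝ))
      atTop (𝓝 0)) ∧
    -- the same with `p'_N` replaced by its asymptotic value `N log N`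
    (∀ A : ℕ, TendstoInDistribution
      (fun (q : ℕ × ℝ) (ω : Ω) => cltScale k q.1 *
        (cutoffCosSum r k q.2 ⌊(q.1 : ℝ) * Real.log q.1⌋₊ ω
          - ∫ ω', cutoffCosSum r k q.2 ⌊(q.1 : ℝ) * Real.log q.1⌋₊ ω' ∂P))
      (jointLimit A) (id : ℝ → ℝ) (fun _ => P) (gaussianReal 0 1)) ∧
    (∀ t : ℝ, Tendsto
      (fun N : ℕ => ((∫ ω, cutoffCosSum r k t ⌊(N : ℝ) * Real.log N⌋₊ ω ∂P)
        - meanMainTerm k N t) / √(N : ℝ))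
      atTop (𝓝 0)) := by
  refine ⟨fun A => tendstoInDistribution_pseudoPrimeCosSum hmeas hindep hunif hk A,
    fun t => ae_tendsto_sumOfMeans_pseudoPrime_sub_meanMainTerm_div hmeas hindep hunif hk t,
    fun A => tendstoInDistribution_cutoffCosSum hmeas hindep hunif hk A, fun t => ?_⟩
  simp only [integral_cutoffCosSum hmeas]
  exact tendsto_sumOfMeans_sub_meanMainTerm_div_sqrt hmeas hunif hk t
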